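/- All algebras are complex, associative and unital. Let $H$ be a Hopf algebra with invertible antipode $S$ (Sweedler notation $\Delta(h)=\sum h_1\otimes h_2$). Let $(\mathcal P,\Delta_{\mathcal P},H,B,\iota,(\chi_i,J_i)_{i\in I})$ be a locally trivial quantum principal fibre bundle: $I$ is finite, $\mathcal P$ is a right $H$-comodule algebra, $(J_i)_{i\in I}$ is a complete covering of the algebra $B$ by two-sided ideals, $B_i=B/J_i$ with projection $\pi_i:B\to B_i$, the homomorphisms $\chi_i:\mathcal P\to B_i\otimes H$ are surjective and $\iota:B\to\mathcal P$ is injective, $(\mathrm{id}\otimes\Delta)\circ\chi_i=(\chi_i\otimes\mathrm{id})\circ\Delta_{\mathcal P}$, $\chi_i(\iota(a))=\pi_i(a)\otimes 1$, $(\ker\chi_i)_{i\in I}$ is a complete covering of $\mathcal P$, and $\iota(B)=\{f\in\mathcal P:\Delta_{\mathcal P}(f)=f\otimes 1\}$. Here a family of ideals $(K_i)_{i\in I}$ of an algebra $A$ is a covering if $\bigcap_iK_i=0$; its covering completion $A_c$ is the algebra of all $(a_i)\in\prod_iA/K_i$ such that $a_i$ and $a_j$ have the same image in $A/(K_i+K_j)$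 for all $i,j$; it is complete if the embedding $A\to A_c$ is onto. Let differential calculi $\Gamma(B_i)$ over $B_i$ and a right covariant differential calculus $\Gamma(H)$ over $H$, with coaction $\Delta^\Gamma$, be given. Let $\Gamma(\mathcal P)$ and $\Gamma(B)$ be the differential calculi adapted to them: $\chi_i$ and $\pi_i$ extend to homomorphisms of differential algebras $\chi_{i_\Gamma}:\Gamma(\mathcal P)\to\Gamma(B_i)\hat\otimes\Gamma(H)$ (skew tensor product) and $\pi_{i_\Gamma}:\Gamma(B)\to\Gamma(B_i)$, and $\bigcap_i\ker\chi_{i_\Gamma}=0$, $\bigcap_i\ker\pi_{i_\Gamma}=0$. Let $\Gamma_c(\mathcal P)\subset\prod_i\Gamma(B_i)\hat\otimes\Gamma(H)$ and $\Gamma_c(B)\subset\prod_i\Gamma(B_i)$ be the covering completions with respect to these kernels, with the componentwise differential $d$ and grading, let $\chi_{i_{\Gamma_c}}$ be the $i$-th projection of $\Gamma_c(\mathcal P)$, let $\Delta^{\Gamma_c}$ be the coaction of $H$ on $\Gamma_c(\mathcal P)$ given by $\mathrm{id}\otimes\Delta^\Gamma$ in each component, written $\gamma\mapsto\sum\gamma_0\otimes\gamma_1$,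 and let $\iota_{\Gamma_c}:\Gamma_c(B)\to\Gamma_c(\mathcal P)$, $(\rho_i)\mapsto(\rho_i\hat\otimes 1)$. Put $\mathrm{hor}\,\Gamma_c(\mathcal P)=\{\gamma\in\Gamma_c(\mathcal P):\chi_{i_{\Gamma_c}}(\gamma)\in\Gamma(B_i)\hat\otimes H\ \forall i\}$. A left (resp. right) covariant derivative is a linear map $D:\mathrm{hor}\,\Gamma_c(\mathcal P)\to\mathrm{hor}\,\Gamma_c(\mathcal P)$ which raises degrees by one and satisfies $D(1)=0$, $(D\otimes\mathrm{id})\circ\Delta^{\Gamma_c}=\Delta^{\Gamma_c}\circ D$, $D(\ker\chi_{i_{\Gamma_c}}\cap\mathrm{hor}\,\Gamma_c(\mathcal P))\subset\ker\chi_{i_{\Gamma_c}}$ for all $i$, and, for $\alpha\in\mathrm{hor}\,\Gamma_c(\mathcal P)$ and $\rho\in\Gamma_c(B)$, $$D(\iota_{\Gamma_c}(\rho)\alpha)=(d\iota_{\Gamma_c}(\rho))\alpha+(-1)^n\iota_{\Gamma_c}(\rho)D(\alpha)\quad(\rho\text{ of degree }n)$$ $$\text{(resp. } D(\alpha\,\iota_{\Gamma_c}(\rho))=D(\alpha)\iota_{\Gamma_c}(\rho)+(-1)^n\alpha\,d\iota_{\Gamma_c}(\rho)\quad(\alpha\text{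 of degree }n)\text{)}.$$ A left (resp. right) pre-connection form is a linear map $\omega:H\to\Gamma^1_c(\mathcal P)$ with $\omega(1)=0$ and, for all $h\in H$ and $i\in I$, $$\Delta^{\Gamma_c}(\omega(h))=\sum\omega(h_2)\otimes S(h_1)h_3,\qquad(1-\mathrm{hor}_c)\chi_{i_{\Gamma_c}}(\omega(h))=-\sum1\hat\otimes S(h_1)dh_2$$ $$\text{(resp. }\Delta^{\Gamma_c}(\omega(h))=\sum\omega(h_2)\otimes h_3S^{-1}(h_1),\qquad(1-\mathrm{hor}_c)\chi_{i_{\Gamma_c}}(\omega(h))=-\sum1\hat\otimes(dh_2)S^{-1}(h_1)\text{)},$$ where $\mathrm{hor}_c$ is the projection of $(\Gamma^1(B_i)\hat\otimes H)\oplus(B_i\hat\otimes\Gamma^1(H))$ onto the first summand. Proposition. There is a bijection $D\leftrightarrow\omega$ between the left covariant derivatives and the left pre-connection forms such that $$D(\gamma)=d\gamma+(-1)^n\sum\gamma_0\,\omega(\gamma_1)\quad\text{for all }\gamma\in\mathrm{hor}\,\Gamma^n_c(\mathcal P),\ n\ge0,$$ and there is a bijection $D\leftrightarrow\omega$ between the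 right covariant derivatives and the right pre-connection forms such that $$D(\gamma)=d\gamma+\sum\omega(\gamma_1)\,\gamma_0\quad\text{for all }\gamma\in\mathrm{hor}\,\Gamma_c(\mathcal P).$$ -/

import Mathlib

open scoped TensorProduct

noncomputable section

namespace QPB

universe u v w

/-! ### Differential calculi -/

/-- A differential calculus over a complex algebra `A`: an `ℕ`-graded complex algebra `carrier`
whose degree zero part is (a copy, via `of`, of) `A`, with a graded derivation `d` of degree one and
square zero, generated as an algebra by `A` and `dA`. -/
structure DifferentialCalculus (A : Type u) [Ring A] [Algebra ℂ A] where
  carrier : Type v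
  [ring : Ring carrier]
  [algebra : Algebra ℂ carrier]
  gr : ℕ → Submodule ℂ carrier
  [graded : GradedAlgebra gr]
  of : A →ₐ[ℂ] carrier
  of_injective : Function.Injective of
  range_of : LinearMap.range of.toLinearMap = gr 0
  d : carrier →ₗ[ℂ] carrier
  d_mem : ∀ {n : ℕ} {x : carrier}, x ∈ gr n → d x ∈ gr (n + 1)
  leibniz : ∀ {n : ℕ} {x : carrier}, x ∈ gr n → ∀ y : carrier,
    d (x * y) = d x * y + (-1 : ℂ) ^ n • (x * d y)
  d_d : ∀ x : carrier, d (d x) = 0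
  generated : Algebra.adjoin ℂ (Set.range of ∪ Set.range fun a => d (of a)) = ⊤

attribute [instance] DifferentialCalculus.ring DifferentialCalculus.algebra
  DifferentialCalculus.graded

namespace DifferentialCalculus

variable {A : Type u} [Ring A] [Algebra ℂ A] (Γ : DifferentialCalculus.{u, v} A)

/-- The linear map with `x ↦ (-1)^n x` for `x` of degree `n`. -/
def parity : Γ.carrier →ₗ[ℂ] Γ.carrier :=
  DirectSum.toModule ℂ ℕ Γ.carrier (fun n => (-1 : ℂ) ^ n • (Γ.gr n).subtype) ∘ₗ
    (DirectSum.decomposeLinearEquiv Γ.gr).toLinearMap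

/-- The projection onto the degree zero component. -/
def projZero : Γ.carrier →ₗ[ℂ] Γ.carrier := GradedAlgebra.proj Γ.gr 0

lemma of_mem (a : A) : Γ.of a ∈ Γ.gr 0 := by
  rw [← Γ.range_of]; exact ⟨a, rfl⟩

lemma parity_of_mem {n : ℕ} {x : Γ.carrier} (hx : x ∈ Γ.gr n) :
    Γ.parity x = (-1 : ℂ) ^ n • x := by
  simp only [parity, LinearMap.comp_apply, LinearEquiv.coe_coe,
    DirectSum.decomposeLinearEquiv_apply]
  rw [DirectSum.decompose_of_mem _ hx, ← DirectSum.lof_eq_of ℂ, DirectSum.toModule_lof]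
  rfl

lemma d_one : Γ.d 1 = 0 := by
  have h := Γ.leibniz (n := 0) (x := 1) SetLike.GradedOne.one_mem 1
  simpa using h

end DifferentialCalculus

/-! ### The skew tensor product of two differential calculi -/

section Skew

variable {A : Type*} [Ring A] [Algebra ℂ A] {C : Type*} [Ring C] [Algebra ℂ C]
variable (Γ : DifferentialCalculus A) (Λ : DifferentialCalculus C)

/-- The algebra `Γ(A) ⊗̂ Γ(C)`, with `(γ ⊗ ρ)(ω ⊗ τ) = (-1)^(mn) γω ⊗ ρτ` for `ω` of degree `n` and
`ρ` of degree `m`. -/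
abbrev Skew : Type _ := GradedTensorProduct ℂ Γ.gr Λ.gr

/-- The linear identification of `Γ(A) ⊗ Γ(C)` with `Γ(A) ⊗̂ Γ(C)`. -/
abbrev skewEquiv : Γ.carrier ⊗[ℂ] Λ.carrier ≃ₗ[ℂ] Skew Γ Λ :=
  GradedTensorProduct.of ℂ Γ.gr Λ.gr

/-- The element `γ ⊗ ρ` of `Γ(A) ⊗̂ Γ(C)`. -/
abbrev skewTmul (x : Γ.carrier) (y : Λ.carrier) : Skew Γ Λ := skewEquiv Γ Λ (x ⊗ₜ[ℂ] y)

/-- The differential `d(γ ⊗ ρ) = dγ ⊗ ρ + (-1)^n γ ⊗ dρ`, `γ` of degree `n`. -/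
def skewD : Skew Γ Λ →ₗ[ℂ] Skew Γ Λ :=
  (skewEquiv Γ Λ).toLinearMap ∘ₗ
    (TensorProduct.map Γ.d LinearMap.id + TensorProduct.map Γ.parity Λ.d) ∘ₗ
      (skewEquiv Γ Λ).symm.toLinearMap

/-- The part of total degree `n` of `Γ(A) ⊗̂ Γ(C)`. -/
def skewGr (n : ℕ) : Submodule ℂ (Skew Γ Λ) :=
  Submodule.span ℂ {z | ∃ p q : ℕ, p + q = n ∧ ∃ x ∈ Γ.gr p, ∃ y ∈ Λ.gr q, z = skewTmul Γ Λ x y}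

/-- The inclusion of `A ⊗ C` as the degree zero part of `Γ(A) ⊗̂ Γ(C)`. -/
def skewOf : A ⊗[ℂ] C →ₗ[ℂ] Skew Γ Λ :=
  (skewEquiv Γ Λ).toLinearMap ∘ₗ TensorProduct.map Γ.of.toLinearMap Λ.of.toLinearMap

/-- The canonical projection `hor_c` onto `Γ(A) ⊗̂ C` along `Γ(A) ⊗̂ Γ^k(C)`, `k ≥ 1`. In total degree
one, it is the projection of `(Γ¹(A) ⊗̂ C) ⊕ (A ⊗̂ Γ¹(C))` onto the first summand. -/
def horC : Skew Γ Λ →ₗ[ℂ] Skew Γ Λ :=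
  (skewEquiv Γ Λ).toLinearMap ∘ₗ TensorProduct.map LinearMap.id Λ.projZero ∘ₗ
    (skewEquiv Γ Λ).symm.toLinearMap

variable {Γ Λ}

lemma skewD_tmul (x : Γ.carrier) (y : Λ.carrier) :
    skewD Γ Λ (skewTmul Γ Λ x y) =
      skewTmul Γ Λ (Γ.d x) y + skewTmul Γ Λ (Γ.parity x) (Λ.d y) := by
  simp [skewD, skewTmul]

lemma skewTmul_mul {j i : ℕ} (a : Γ.carrier) {b : Λ.carrier} (hb : b ∈ Λ.gr j)
    {a' : Γ.carrier} (ha : a' ∈ Γ.gr i) (c : Λ.carrier) :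
    skewTmul Γ Λ a b * skewTmul Γ Λ a' c =
      (-1 : ℂ) ^ (j * i) • skewTmul Γ Λ (a * a') (b * c) := by
  have h := GradedTensorProduct.tmul_coe_mul_coe_tmul (R := ℂ) Γ.gr Λ.gr a ⟨b, hb⟩ ⟨a', ha⟩ c
  refine h.trans ?_
  rcases Nat.even_or_odd (j * i) with he | ho
  · simp [he.neg_one_pow]
  · simp [ho.neg_one_pow]

lemma skewTmul_of_mul (a : Γ.carrier) (h : C) (a' : Γ.carrier) (c : Λ.carrier) :
    skewTmul Γ Λ a (Λ.of h) * skewTmul Γ Λ a' c = skewTmul Γ Λ (a * a') (Λ.of h * c) := by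
  induction a' using DirectSum.Decomposition.inductionOn Γ.gr with
  | zero => simp [skewTmul]
  | homogeneous x => simpa using skewTmul_mul a (Λ.of_mem h) x.2 c
  | add x y hx hy =>
    simp only [skewTmul, TensorProduct.add_tmul, mul_add, map_add] at *
    rw [hx, hy]

lemma skewTmul_one_mul (a : Γ.carrier) (a' : Γ.carrier) (c : Λ.carrier) :
    skewTmul Γ Λ a 1 * skewTmul Γ Λ a' c = skewTmul Γ Λ (a * a') c := by
  simpa using skewTmul_of_mul (Λ := Λ) a 1 a' c

lemma skewTmul_add_left (a a' : Γ.carrier) (c : Λ.carrier) :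
    skewTmul Γ Λ (a + a') c = skewTmul Γ Λ a c + skewTmul Γ Λ a' c := by
  simp [skewTmul, TensorProduct.add_tmul]

variable (Γ Λ)

/-- The subalgebra `Γ(A) ⊗̂ C` of horizontal elements of `Γ(A) ⊗̂ Γ(C)`. -/
def horLoc : Subalgebra ℂ (Skew Γ Λ) where
  __ := LinearMap.range ((skewEquiv Γ Λ).toLinearMap ∘ₗ
    TensorProduct.map LinearMap.id Λ.of.toLinearMap : Γ.carrier ⊗[ℂ] C →ₗ[ℂ] Skew Γ Λ)
  mul_mem' := by
    rintro _ _ ⟨s, rfl⟩ ⟨t, rfl⟩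
    change _ ∈ LinearMap.range _
    induction s with
    | zero => simp
    | add s s' hs hs' => rw [map_add, add_mul]; exact add_mem hs hs'
    | tmul a h =>
      induction t with
      | zero => simp
      | add t t' ht ht' => rw [map_add, mul_add]; exact add_mem ht ht'
      | tmul a' h' =>
        refine ⟨(a * a') ⊗ₜ (h * h'), ?_⟩
        have := skewTmul_of_mul (Γ := Γ) (Λ := Λ) a h a' (Λ.of h')
        simpa using this.symm
  algebraMap_mem' r := by
    change _ ∈ LinearMap.range _
    refine ⟨algebraMap ℂ Γ.carrier r ⊗ₜ 1, ?_⟩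
    simp [GradedTensorProduct.algebraMap_def]

lemma mem_horLoc {x : Skew Γ Λ} : x ∈ horLoc Γ Λ ↔ ∃ t : Γ.carrier ⊗[ℂ] C,
    skewEquiv Γ Λ (TensorProduct.map LinearMap.id Λ.of.toLinearMap t) = x := Iff.rfl

end Skew

/-! ### Restricting a coaction to an invariant subspace -/

section Restrict

variable {V W H : Type*} [AddCommGroup V] [Module ℂ V] [AddCommGroup W] [Module ℂ W]
  [AddCommGroup H] [Module ℂ H]

/-- Slicing with a functional on the second factor. -/
def slice (V : Type*) [AddCommGroup V] [Module ℂ V] (φ : H →ₗ[ℂ] ℂ) : V ⊗[ℂ] H →ₗ[ℂ] V :=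
  (TensorProduct.rid ℂ V).toLinearMap ∘ₗ LinearMap.lTensor V φ

lemma slice_tmul (φ : H →ₗ[ℂ] ℂ) (v : V) (h : H) : slice V φ (v ⊗ₜ h) = φ h • v := by
  simp [slice]

lemma slice_rTensor (φ : H →ₗ[ℂ] ℂ) (f : V →ₗ[ℂ] W) (t : V ⊗[ℂ] H) :
    slice W φ (LinearMap.rTensor H f t) = f (slice V φ t) := by
  induction t with
  | zero => simp
  | add s t hs ht => simp only [map_add, hs, ht]
  | tmul v h => simp [slice_tmul]

lemma mem_range_of_slice (U : Submodule ℂ V) (t : V ⊗[ℂ] H)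
    (ht : ∀ φ : H →ₗ[ℂ] ℂ, slice V φ t ∈ U) :
    t ∈ LinearMap.range (LinearMap.rTensor H U.subtype) := by
  have hex : Function.Exact (LinearMap.rTensor H U.subtype) (LinearMap.rTensor H U.mkQ) :=
    rTensor_exact H (LinearMap.exact_subtype_mkQ U) U.mkQ_surjective
  refine (hex t).1 ?_
  classical
  let b := Module.Basis.ofVectorSpace ℂ H
  refine (TensorProduct.equivFinsuppOfBasisRight b).injective ?_
  rw [map_zero]
  ext i
  have key : ∀ s : (V ⧸ U) ⊗[ℂ] H,
      TensorProduct.equivFinsuppOfBasisRight b s i = slice _ (b.coord i) s := by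
    intro s
    induction s with
    | zero => simp
    | add s t hs ht => simp only [map_add, Finsupp.add_apply, hs, ht]
    | tmul v h => simp [slice_tmul]
  rw [key, slice_rTensor]
  simpa using ht (b.coord i)

lemma rTensor_subtype_injective (U : Submodule ℂ V) :
    Function.Injective (LinearMap.rTensor H U.subtype) :=
  Module.Flat.rTensor_preserves_injective_linearMap _ U.subtype_injective

/-- The restriction of a linear map `δ : V → V ⊗ H` to a subspace `U` with `δ(U) ⊆ U ⊗ H`. -/
def restrictCoaction (δ : V →ₗ[ℂ] V ⊗[ℂ] H) (U : Submodule ℂ V)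
    (hU : ∀ x ∈ U, δ x ∈ LinearMap.range (LinearMap.rTensor H U.subtype)) :
    U →ₗ[ℂ] U ⊗[ℂ] H :=
  (LinearEquiv.ofInjective _ (rTensor_subtype_injective U)).symm.toLinearMap ∘ₗ
    (δ ∘ₗ U.subtype).codRestrict _ fun x => hU x x.2

lemma rTensor_restrictCoaction (δ : V →ₗ[ℂ] V ⊗[ℂ] H) (U : Submodule ℂ V)
    (hU : ∀ x ∈ U, δ x ∈ LinearMap.range (LinearMap.rTensor H U.subtype)) (x : U) :
    LinearMap.rTensor H U.subtype (restrictCoaction δ U hU x) = δ x := by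
  have := LinearEquiv.apply_symm_apply
    (LinearEquiv.ofInjective _ (rTensor_subtype_injective (H := H) U))
    ((δ ∘ₗ U.subtype).codRestrict _ (fun x => hU x x.2) x)
  exact congrArg Subtype.val this

end Restrict

/-! ### Right covariant differential calculi over a Hopf algebra -/

/-- A right covariant differential calculus over the Hopf algebra `H`: a differential calculus
`Γ(H)` which is a right `H`-comodule algebra, with coaction
`h₀ dh₁ ⋯ dhₙ ↦ Δ(h₀) (d ⊗ id)Δ(h₁) ⋯ (d ⊗ id)Δ(hₙ)`. -/
structure RightCovariantCalculus (H : Type u) [Ring H] [HopfAlgebra ℂ H]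
    extends DifferentialCalculus.{u, v} H where
  coact : carrier →ₐ[ℂ] carrier ⊗[ℂ] H
  coact_of : ∀ h : H, coact (of h) =
    TensorProduct.map of.toLinearMap LinearMap.id (Coalgebra.comul (R := ℂ) h)
  coact_d_of : ∀ h : H, coact (d (of h)) =
    TensorProduct.map (d ∘ₗ of.toLinearMap) LinearMap.id (Coalgebra.comul (R := ℂ) h)
  coassoc : ∀ x : carrier,
    TensorProduct.assoc ℂ carrier H H (LinearMap.rTensor H coact.toLinearMap (coact x)) =
      LinearMap.lTensor carrier (Coalgebra.comul (R := ℂ)) (coact x)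
  coact_counit : ∀ x : carrier,
    TensorProduct.rid ℂ carrier
      (LinearMap.lTensor carrier (Coalgebra.counit (R := ℂ)) (coact x)) = x

section Hopf

variable (H : Type*) [Ring H] [HopfAlgebra ℂ H]

/-- The inverse of a bijective antipode. -/
def antipodeInv (hS : Function.Bijective (HopfAlgebra.antipode ℂ : H →ₗ[ℂ] H)) : H →ₗ[ℂ] H :=
  (LinearEquiv.ofBijective (HopfAlgebra.antipode ℂ : H →ₗ[ℂ] H) hS).symm.toLinearMap

/-- The iterated comultiplication with the first two legs interchanged,
`h ↦ ∑ h₂ ⊗ (h₁ ⊗ h₃)`. -/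
def comulSwap : H →ₗ[ℂ] H ⊗[ℂ] (H ⊗[ℂ] H) :=
  (TensorProduct.leftComm ℂ H H H).toLinearMap ∘ₗ
    LinearMap.lTensor H (Coalgebra.comul (R := ℂ)) ∘ₗ Coalgebra.comul (R := ℂ)

/-- The left adjoint coaction `h ↦ ∑ h₂ ⊗ S(h₁)h₃`. -/
def adL : H →ₗ[ℂ] H ⊗[ℂ] H :=
  LinearMap.lTensor H (LinearMap.mul' ℂ H ∘ₗ
    TensorProduct.map (HopfAlgebra.antipode ℂ) LinearMap.id) ∘ₗ comulSwap H

/-- The right adjoint coaction `h ↦ ∑ h₂ ⊗ h₃S⁻¹(h₁)`. -/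
def adR (hS : Function.Bijective (HopfAlgebra.antipode ℂ : H →ₗ[ℂ] H)) : H →ₗ[ℂ] H ⊗[ℂ] H :=
  LinearMap.lTensor H (LinearMap.mul' ℂ H ∘ₗ (TensorProduct.comm ℂ H H).toLinearMap ∘ₗ
    TensorProduct.map (antipodeInv H hS) LinearMap.id) ∘ₗ comulSwap H

variable {H}
variable (Λ : RightCovariantCalculus H)

/-- The map `h ↦ ∑ S(h₁)dh₂`. -/
def vertL : H →ₗ[ℂ] Λ.carrier :=
  LinearMap.mul' ℂ Λ.carrier ∘ₗ
    TensorProduct.map (Λ.of.toLinearMap ∘ₗ HopfAlgebra.antipode ℂ) (Λ.d ∘ₗ Λ.of.toLinearMap) ∘ₗ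
      Coalgebra.comul (R := ℂ)

/-- The map `h ↦ ∑ (dh₂)S⁻¹(h₁)`. -/
def vertR (hS : Function.Bijective (HopfAlgebra.antipode ℂ : H →ₗ[ℂ] H)) : H →ₗ[ℂ] Λ.carrier :=
  LinearMap.mul' ℂ Λ.carrier ∘ₗ (TensorProduct.comm ℂ Λ.carrier Λ.carrier).toLinearMap ∘ₗ
    TensorProduct.map (Λ.of.toLinearMap ∘ₗ antipodeInv H hS) (Λ.d ∘ₗ Λ.of.toLinearMap) ∘ₗ
      Coalgebra.comul (R := ℂ)

end Hopf

section Covariant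

variable {A : Type*} [Ring A] [Algebra ℂ A] {H : Type*} [Ring H] [HopfAlgebra ℂ H]
variable (Γ : DifferentialCalculus A) (Λ : RightCovariantCalculus H)

/-- The coaction `id ⊗ Δ^Γ` of `H` on `Γ(A) ⊗̂ Γ(H)`. -/
def coactLoc : Skew Γ Λ.toDifferentialCalculus →ₗ[ℂ] Skew Γ Λ.toDifferentialCalculus ⊗[ℂ] H :=
  LinearMap.rTensor H (skewEquiv Γ Λ.toDifferentialCalculus).toLinearMap ∘ₗ
    (TensorProduct.assoc ℂ Γ.carrier Λ.carrier H).symm.toLinearMap ∘ₗ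
      LinearMap.lTensor Γ.carrier Λ.coact.toLinearMap ∘ₗ
        (skewEquiv Γ Λ.toDifferentialCalculus).symm.toLinearMap

variable {Γ Λ}

/-- The map `ρ ⊗ h ↦ (a ⊗ ρ) ⊗ h`. -/
def leftInsert (a : Γ.carrier) :
    Λ.carrier ⊗[ℂ] H →ₗ[ℂ] Skew Γ Λ.toDifferentialCalculus ⊗[ℂ] H :=
  LinearMap.rTensor H ((skewEquiv Γ Λ.toDifferentialCalculus).toLinearMap ∘ₗ
    TensorProduct.mk ℂ Γ.carrier Λ.carrier a)

lemma leftInsert_tmul (a : Γ.carrier) (y : Λ.carrier) (h : H) :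
    leftInsert a (y ⊗ₜ[ℂ] h) = skewTmul Γ Λ.toDifferentialCalculus a y ⊗ₜ[ℂ] h := rfl

lemma coactLoc_tmul (a : Γ.carrier) (y : Λ.carrier) :
    coactLoc Γ Λ (skewTmul Γ Λ.toDifferentialCalculus a y) = leftInsert a (Λ.coact y) := by
  simp only [coactLoc, skewTmul, LinearMap.comp_apply, LinearEquiv.coe_coe,
    LinearEquiv.symm_apply_apply, LinearMap.lTensor_tmul, AlgHom.toLinearMap_apply]
  generalize Λ.coact y = t
  induction t with
  | zero => simp
  | tmul x h => rfl
  | add s t hs ht => simp only [TensorProduct.tmul_add, map_add, hs, ht]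

/-- The coaction preserves degrees. -/
lemma coact_mem {n : ℕ} {x : Λ.carrier} (hx : x ∈ Λ.gr n) :
    Λ.coact x ∈ LinearMap.range (LinearMap.rTensor H (Λ.gr n).subtype) := by
  let G : ℕ → Submodule ℂ Λ.carrier := fun n => Λ.gr n ⊓
    (LinearMap.range (LinearMap.rTensor H (Λ.gr n).subtype)).comap Λ.coact.toLinearMap
  have hof : ∀ h, Λ.of h ∈ G 0 := by
    refine fun h => ⟨Λ.of_mem h, ?_⟩
    change Λ.coact (Λ.of h) ∈ LinearMap.range (LinearMap.rTensor H (Λ.gr (0)).subtype)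
    rw [Λ.coact_of]
    generalize Coalgebra.comul (R := ℂ) h = t
    induction t with
    | zero => simp
    | tmul x y => exact ⟨⟨Λ.of x, Λ.of_mem x⟩ ⊗ₜ y, rfl⟩
    | add s t hs ht => rw [map_add]; exact add_mem hs ht
  have hd : ∀ h, Λ.d (Λ.of h) ∈ G 1 := by
    refine fun h => ⟨Λ.d_mem (Λ.of_mem h), ?_⟩
    change Λ.coact (Λ.d (Λ.of h)) ∈
      LinearMap.range (LinearMap.rTensor H (Λ.gr (1)).subtype)
    rw [Λ.coact_d_of]
    generalize Coalgebra.comul (R := ℂ) h = t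
    induction t with
    | zero => simp
    | tmul x y => exact ⟨⟨Λ.d (Λ.of x), Λ.d_mem (Λ.of_mem x)⟩ ⊗ₜ y, rfl⟩
    | add s t hs ht => rw [map_add]; exact add_mem hs ht
  have hmul : ∀ {m k : ℕ} {x y : Λ.carrier}, x ∈ G m → y ∈ G k → x * y ∈ G (m + k) := by
    rintro m k x y ⟨hx, hx'⟩ ⟨hy, hy'⟩
    refine ⟨SetLike.GradedMul.mul_mem hx hy, ?_⟩
    change Λ.coact (x * y) ∈ LinearMap.range (LinearMap.rTensor H (Λ.gr (m + k)).subtype)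
    change Λ.coact x ∈ LinearMap.range (LinearMap.rTensor H (Λ.gr (m)).subtype) at hx'
    change Λ.coact y ∈ LinearMap.range (LinearMap.rTensor H (Λ.gr (k)).subtype) at hy'
    rw [map_mul]
    obtain ⟨s, hs⟩ := hx'
    obtain ⟨t, ht⟩ := hy'
    rw [← hs, ← ht]
    clear hs ht
    induction s with
    | zero => simp
    | add s s' hs hs' => rw [map_add, add_mul]; exact add_mem hs hs'
    | tmul a h =>
      induction t with
      | zero => simp
      | add t t' ht ht' => rw [map_add, mul_add]; exact add_mem ht ht'
      | tmul a' h' =>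
        refine ⟨⟨a.1 * a'.1, SetLike.GradedMul.mul_mem a.2 a'.2⟩ ⊗ₜ (h * h'), ?_⟩
        simp only [LinearMap.rTensor_tmul, Submodule.subtype_apply,
          Algebra.TensorProduct.tmul_mul_tmul]
  have htop : ∀ x, x ∈ ⨆ n, G n := by
    intro x
    have hx : x ∈ Algebra.adjoin ℂ
        (Set.range Λ.of ∪ Set.range fun a => Λ.d (Λ.of a)) := by
      rw [Λ.generated]; trivial
    induction hx using Algebra.adjoin_induction with
    | mem x hx =>
      rcases hx with ⟨h, rfl⟩ | ⟨h, rfl⟩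
      · exact Submodule.mem_iSup_of_mem 0 (hof h)
      · exact Submodule.mem_iSup_of_mem 1 (hd h)
    | algebraMap r =>
      rw [← Λ.of.commutes r]
      exact Submodule.mem_iSup_of_mem 0 (hof _)
    | add x y _ _ hx hy => exact add_mem hx hy
    | mul x y hx0 hy0 hx hy =>
      clear hx0 hy0
      induction hx using Submodule.iSup_induction' with
      | zero => simp
      | add a b _ _ ha hb => rw [add_mul]; exact add_mem ha hb
      | mem m a ha =>
        induction hy using Submodule.iSup_induction' with
        | zero => simp
        | add c e _ _ hc he => rw [mul_add]; exact add_mem hc he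
        | mem k c hc => exact Submodule.mem_iSup_of_mem (m + k) (hmul ha hc)
  have hproj : ∀ y ∈ ⨆ n, G n, ∀ n, (DirectSum.decompose Λ.gr y n : Λ.carrier) ∈ G n := by
    intro y hy
    induction hy using Submodule.iSup_induction' with
    | zero => intro n; simp
    | add a b _ _ ha hb =>
      intro n
      rw [DirectSum.decompose_add, DirectSum.add_apply]
      exact add_mem (ha n) (hb n)
    | mem m a ha =>
      intro n
      by_cases h : m = n
      · subst h
        rw [DirectSum.decompose_of_mem_same _ ha.1]
        exact ha
      · rw [DirectSum.decompose_of_mem_ne _ ha.1 h]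
        exact zero_mem _
  have := hproj x (htop x) n
  rw [DirectSum.decompose_of_mem_same _ hx] at this
  exact this.2

lemma leftInsert_mul {j i : ℕ} (a : Γ.carrier) {a' : Γ.carrier} (ha : a' ∈ Γ.gr i)
    {u : Λ.carrier ⊗[ℂ] H} (hu : u ∈ LinearMap.range (LinearMap.rTensor H (Λ.gr j).subtype))
    (v : Λ.carrier ⊗[ℂ] H) :
    leftInsert a u * leftInsert a' v = (-1 : ℂ) ^ (j * i) • leftInsert (a * a') (u * v) := by
  obtain ⟨s, rfl⟩ := hu
  induction s with
  | zero => simp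
  | add s s' hs hs' => simp only [map_add, add_mul, hs, hs', smul_add]
  | tmul b h =>
    induction v with
    | zero => simp
    | add t t' ht ht' => simp only [map_add, mul_add, ht, ht', smul_add]
    | tmul c h' =>
      rw [LinearMap.rTensor_tmul, leftInsert_tmul, leftInsert_tmul,
        Algebra.TensorProduct.tmul_mul_tmul, Algebra.TensorProduct.tmul_mul_tmul, leftInsert_tmul,
        Submodule.subtype_apply, skewTmul_mul a b.2 ha c, TensorProduct.smul_tmul']

lemma skew_induction {motive : Skew Γ Λ.toDifferentialCalculus → Prop}
    (x : Skew Γ Λ.toDifferentialCalculus) (zero : motive 0)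
    (tmul : ∀ (i j : ℕ) (a : Γ.carrier) (b : Λ.carrier), a ∈ Γ.gr i → b ∈ Λ.gr j →
      motive (skewTmul Γ Λ.toDifferentialCalculus a b))
    (add : ∀ x y, motive x → motive y → motive (x + y)) : motive x := by
  obtain ⟨t, rfl⟩ := (skewEquiv Γ Λ.toDifferentialCalculus).surjective x
  induction t with
  | zero => simpa using zero
  | add s t hs ht => rw [map_add]; exact add _ _ hs ht
  | tmul a b =>
    induction a using DirectSum.Decomposition.inductionOn Γ.gr with
    | zero => simpa using zero
    | add a a' ha ha' => rw [TensorProduct.add_tmul, map_add]; exact add _ _ ha ha'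
    | @homogeneous i a =>
      induction b using DirectSum.Decomposition.inductionOn Λ.gr with
      | zero => simpa using zero
      | add b b' hb hb' => rw [TensorProduct.tmul_add, map_add]; exact add _ _ hb hb'
      | @homogeneous j b => exact tmul i j a b a.2 b.2

lemma coactLoc_mul (x y : Skew Γ Λ.toDifferentialCalculus) :
    coactLoc Γ Λ (x * y) = coactLoc Γ Λ x * coactLoc Γ Λ y := by
  induction x using skew_induction with
  | zero => simp
  | add x x' hx hx' => simp only [map_add, add_mul, hx, hx']
  | tmul _ j a b _ hb =>
    induction y using skew_induction with
    | zero => simp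
    | add y y' hy hy' => simp only [map_add, mul_add, hy, hy']
    | tmul i _ a' c ha _ =>
      rw [skewTmul_mul a hb ha, map_smul, coactLoc_tmul, coactLoc_tmul, coactLoc_tmul, map_mul,
        leftInsert_mul a ha (coact_mem hb)]

lemma coactLoc_algebraMap (r : ℂ) :
    coactLoc Γ Λ (algebraMap ℂ _ r) = algebraMap ℂ _ r := by
  have h : (algebraMap ℂ (Skew Γ Λ.toDifferentialCalculus) r) =
      skewTmul Γ Λ.toDifferentialCalculus (algebraMap ℂ _ r) 1 := rfl
  rw [h, coactLoc_tmul, map_one, Algebra.TensorProduct.one_def, leftInsert_tmul, ← h]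
  rfl

lemma coactLoc_skewOf (x : A ⊗[ℂ] H) :
    coactLoc Γ Λ (skewOf Γ Λ.toDifferentialCalculus x) =
      LinearMap.rTensor H (skewOf Γ Λ.toDifferentialCalculus)
        ((TensorProduct.assoc ℂ A H H).symm
          (LinearMap.lTensor A (Coalgebra.comul (R := ℂ)) x)) := by
  induction x with
  | zero => simp
  | add x y hx hy => simp only [map_add, hx, hy]
  | tmul a h =>
    change coactLoc Γ Λ (skewTmul Γ Λ.toDifferentialCalculus (Γ.of a) (Λ.of h)) = _
    rw [coactLoc_tmul, Λ.coact_of, LinearMap.lTensor_tmul]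
    generalize Coalgebra.comul (R := ℂ) h = t
    induction t with
    | zero => simp
    | tmul x h => rfl
    | add s t hs ht => simp only [TensorProduct.tmul_add, map_add, hs, ht]

lemma coactLoc_skewD_skewOf (x : A ⊗[ℂ] H) :
    coactLoc Γ Λ (skewD Γ Λ.toDifferentialCalculus (skewOf Γ Λ.toDifferentialCalculus x)) =
      LinearMap.rTensor H (skewD Γ Λ.toDifferentialCalculus)
        (coactLoc Γ Λ (skewOf Γ Λ.toDifferentialCalculus x)) := by
  induction x with
  | zero => simp
  | add x y hx hy => simp only [map_add, hx, hy]
  | tmul a h =>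
    change coactLoc Γ Λ (skewD _ _ (skewTmul Γ Λ.toDifferentialCalculus (Γ.of a) (Λ.of h))) =
      LinearMap.rTensor H _
        (coactLoc Γ Λ (skewTmul Γ Λ.toDifferentialCalculus (Γ.of a) (Λ.of h)))
    rw [skewD_tmul, map_add, coactLoc_tmul, coactLoc_tmul, coactLoc_tmul, Λ.coact_of,
      Λ.coact_d_of]
    generalize Coalgebra.comul (R := ℂ) h = t
    induction t with
    | zero => simp
    | tmul x h =>
      simp only [TensorProduct.map_tmul, leftInsert_tmul, LinearMap.id_apply,
        LinearMap.comp_apply, AlgHom.toLinearMap_apply, LinearMap.rTensor_tmul, skewD_tmul,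
        TensorProduct.add_tmul]
    | add s t hs ht =>
      simp only [map_add] at *
      rw [← hs, ← ht]
      abel

/-- The coaction on `Γ(A) ⊗̂ Γ(H)` preserves horizontal elements. -/
lemma coactLoc_horLoc {x : Skew Γ Λ.toDifferentialCalculus}
    (hx : x ∈ horLoc Γ Λ.toDifferentialCalculus) (φ : H →ₗ[ℂ] ℂ) :
    slice _ φ (coactLoc Γ Λ x) ∈
      horLoc Γ Λ.toDifferentialCalculus := by
  obtain ⟨t, rfl⟩ := (mem_horLoc _ _).1 hx
  clear hx
  induction t with
  | zero => simp
  | add s t hs ht => simp only [map_add]; exact add_mem hs ht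
  | tmul a h =>
    change slice _ φ (coactLoc Γ Λ
      (skewTmul Γ Λ.toDifferentialCalculus a (Λ.of h))) ∈ _
    rw [coactLoc_tmul, Λ.coact_of]
    generalize Coalgebra.comul (R := ℂ) h = t
    induction t with
    | zero => simp
    | add s t hs ht => simp only [map_add]; exact add_mem hs ht
    | tmul x h =>
      rw [TensorProduct.map_tmul, leftInsert_tmul, slice_tmul]
      exact Subalgebra.smul_mem _ ((mem_horLoc _ _).2 ⟨a ⊗ₜ x, rfl⟩) _

end Covariant

/-! ### Coverings -/

section Covering

variable {I : Type*} {A : Type*} [Ring A] [Algebra ℂ A]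
  {Q : I → Type*} [∀ i, Ring (Q i)] [∀ i, Algebra ℂ (Q i)]

/-- Let `p i : A → Q i` be surjective homomorphisms, so that `Q i ≅ A / ker (p i)`.
For `a ∈ Q i` and `b ∈ Q j`, this says that the images of `a` and `b` in
`A / (ker (p i) + ker (p j))` are equal. -/
def Compatible (p : ∀ i, A →ₐ[ℂ] Q i) (i j : I) (a : Q i) (b : Q j) : Prop :=
  ∃ x y : A, p i x = a ∧ p j y = b ∧ x - y ∈ RingHom.ker (p i) ⊔ RingHom.ker (p j)

lemma compatible_iff (p : ∀ i, A →ₐ[ℂ] Q i) (i j : I) (a : Q i) (b : Q j) :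
    Compatible p i j a b ↔ ∃ x, p i x = a ∧ p j x = b := by
  constructor
  · rintro ⟨x, y, rfl, rfl, h⟩
    obtain ⟨s, hs, t, ht, hst⟩ := Submodule.mem_sup.1 h
    rw [RingHom.mem_ker] at hs ht
    refine ⟨x - s, by simp [hs], ?_⟩
    have : x - s = y + t := by rw [sub_eq_iff_eq_add, add_assoc, add_comm t, hst]; abel
    rw [this, map_add, ht, add_zero]
  · rintro ⟨x, rfl, rfl⟩
    exact ⟨x, x, rfl, rfl, by simp⟩

/-- The covering completion of `A` with respect to the family of ideals `ker (p i)`, where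
`A / ker (p i)` is identified with `Q i` by means of the surjection `p i`. -/
def coveringCompletion (p : ∀ i, A →ₐ[ℂ] Q i) : Subalgebra ℂ (∀ i, Q i) where
  carrier := {a | ∀ i j, Compatible p i j (a i) (a j)}
  mul_mem' := by
    intro a b ha hb i j
    obtain ⟨x, hx, hx'⟩ := (compatible_iff _ _ _ _ _).1 (ha i j)
    obtain ⟨y, hy, hy'⟩ := (compatible_iff _ _ _ _ _).1 (hb i j)
    exact (compatible_iff _ _ _ _ _).2 ⟨x * y, by simp [hx, hy], by simp [hx', hy']⟩
  add_mem' := by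
    intro a b ha hb i j
    obtain ⟨x, hx, hx'⟩ := (compatible_iff _ _ _ _ _).1 (ha i j)
    obtain ⟨y, hy, hy'⟩ := (compatible_iff _ _ _ _ _).1 (hb i j)
    exact (compatible_iff _ _ _ _ _).2 ⟨x + y, by simp [hx, hy], by simp [hx', hy']⟩
  algebraMap_mem' r i j := (compatible_iff _ _ _ _ _).2
    ⟨algebraMap ℂ A r, by simp, by simp⟩

lemma mem_coveringCompletion (p : ∀ i, A →ₐ[ℂ] Q i) (a : ∀ i, Q i) :
    a ∈ coveringCompletion p ↔ ∀ i j, ∃ x, p i x = a i ∧ p j x = a j := by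
  refine forall_congr' fun i => forall_congr' fun j => ?_
  exact compatible_iff p i j (a i) (a j)

/-- The ideals `ker (p i)` form a covering of `A` (their intersection is zero). -/
def IsCovering (p : ∀ i, A →ₐ[ℂ] Q i) : Prop := ⨅ i, RingHom.ker (p i) = ⊥

/-- The ideals `ker (p i)` form a complete covering of `A`: they form a covering, and the canonical
embedding of `A` into the covering completion is onto. -/
def IsCompleteCovering (p : ∀ i, A →ₐ[ℂ] Q i) : Prop :=
  IsCovering p ∧ ∀ a ∈ coveringCompletion p, ∃ x : A, ∀ i, p i x = a i

end Covering

/-! ### Locally trivial quantum principal fibre bundles -/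

/-- A locally trivial quantum principal fibre bundle with total space `P`, base `B`, structure group
`H`, and a covering of the base indexed by `I`. -/
structure LocallyTrivialBundle (I : Type*) (P : Type*) (B : Type*) (H : Type*)
    [Ring P] [Algebra ℂ P] [Ring B] [Algebra ℂ B] [Ring H] [HopfAlgebra ℂ H] where
  /-- the right coaction on the total space -/
  coact : P →ₐ[ℂ] P ⊗[ℂ] H
  coassoc : ∀ x : P,
    TensorProduct.assoc ℂ P H H (LinearMap.rTensor H coact.toLinearMap (coact x)) =
      LinearMap.lTensor P (Coalgebra.comul (R := ℂ)) (coact x)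
  coact_counit : ∀ x : P,
    TensorProduct.rid ℂ P (LinearMap.lTensor P (Coalgebra.counit (R := ℂ)) (coact x)) = x
  /-- the covering of the base by two-sided ideals -/
  J : I → Ideal B
  [twoSided : ∀ i, (J i).IsTwoSided]
  complete_base : IsCompleteCovering fun i => Ideal.Quotient.mkₐ ℂ (J i)
  /-- the local trivializations -/
  χ : ∀ i, P →ₐ[ℂ] (B ⧸ J i) ⊗[ℂ] H
  χ_surjective : ∀ i, Function.Surjective (χ i)
  /-- the embedding of the base -/
  ι : B →ₐ[ℂ] P
  ι_injective : Function.Injective ι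
  χ_coact : ∀ i x, TensorProduct.assoc ℂ (B ⧸ J i) H H
      (LinearMap.rTensor H (χ i).toLinearMap (coact x)) =
    LinearMap.lTensor (B ⧸ J i) (Coalgebra.comul (R := ℂ)) (χ i x)
  χ_ι : ∀ i a, χ i (ι a) = Ideal.Quotient.mk (J i) a ⊗ₜ[ℂ] (1 : H)
  complete_total : IsCompleteCovering χ
  range_ι : Set.range ι = {f : P | coact f = f ⊗ₜ[ℂ] (1 : H)}

attribute [instance] LocallyTrivialBundle.twoSided

/-! ### Differential structures on a bundle -/

section Bundle

variable {I P B H : Type*} [Ring P] [Algebra ℂ P] [Ring B] [Algebra ℂ B] [Ring H] [HopfAlgebra ℂ H]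

universe v₁ v₂ v₃ v₄

/-- A differential structure on a locally trivial bundle: differential calculi `Γ(B_i)` over the
`B_i = B / J_i`, a right covariant differential calculus `Γ(H)`, and the differential calculi
`Γ(P)` and `Γ(B)` over `P` and `B` which are adapted to the coverings: the maps
`χ_i : P → B_i ⊗ H` and `π_i : B → B_i` extend to homomorphisms
`Γ(P) → Γ(B_i) ⊗̂ Γ(H)` and `Γ(B) → Γ(B_i)` of differential algebras, and the kernels of the
extensions have intersection zero. -/
structure DifferentialStructure (E : LocallyTrivialBundle I P B H) where
  ΓB : ∀ i, DifferentialCalculus.{_, v₁} (B ⧸ E.J i)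
  ΓH : RightCovariantCalculus.{_, v₂} H
  ΓP : DifferentialCalculus.{_, v₃} P
  χΓ : ∀ i, ΓP.carrier →ₐ[ℂ] Skew (ΓB i) ΓH.toDifferentialCalculus
  χΓ_of : ∀ i x, χΓ i (ΓP.of x) = skewOf (ΓB i) ΓH.toDifferentialCalculus (E.χ i x)
  χΓ_mem : ∀ i n x, x ∈ ΓP.gr n → χΓ i x ∈ skewGr (ΓB i) ΓH.toDifferentialCalculus n
  χΓ_d : ∀ i x, χΓ i (ΓP.d x) = skewD (ΓB i) ΓH.toDifferentialCalculus (χΓ i x)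
  covering_total : IsCovering χΓ
  ΓBase : DifferentialCalculus.{_, v₄} B
  πΓ : ∀ i, ΓBase.carrier →ₐ[ℂ] (ΓB i).carrier
  πΓ_of : ∀ i b, πΓ i (ΓBase.of b) = (ΓB i).of (Ideal.Quotient.mk (E.J i) b)
  πΓ_mem : ∀ i n x, x ∈ ΓBase.gr n → πΓ i x ∈ (ΓB i).gr n
  πΓ_d : ∀ i x, πΓ i (ΓBase.d x) = (ΓB i).d (πΓ i x)
  covering_base : IsCovering πΓ

namespace DifferentialStructure

variable {E : LocallyTrivialBundle I P B H} (S : DifferentialStructure E)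

/-- The local algebra `Γ(B_i) ⊗̂ Γ(H)`. -/
abbrev Loc (i : I) : Type _ := Skew (S.ΓB i) S.ΓH.toDifferentialCalculus

/-- The direct sum (product) of the local algebras, which contains the covering completion of
`Γ(P)`. -/
abbrev Tot : Type _ := ∀ i, S.Loc i

/-- The covering completion `Γ_c(P)`. The map `χ_i` on it is the `i`-th projection. -/
def gammaC : Subalgebra ℂ S.Tot := coveringCompletion S.χΓ

/-- The covering completion `Γ_c(B)`. -/
def gammaCBase : Subalgebra ℂ (∀ i, (S.ΓB i).carrier) := coveringCompletion S.πΓ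

/-- The algebra `hor Γ_c(P)` of horizontal forms. -/
def hor : Subalgebra ℂ S.Tot :=
  S.gammaC ⊓ Subalgebra.pi Set.univ fun i => horLoc (S.ΓB i) S.ΓH.toDifferentialCalculus

/-- The componentwise differential, whose restriction is the differential of `Γ_c(P)`. -/
def dTot : S.Tot →ₗ[ℂ] S.Tot :=
  LinearMap.pi fun i => skewD (S.ΓB i) S.ΓH.toDifferentialCalculus ∘ₗ LinearMap.proj i

/-- The componentwise differential, whose restriction is the differential of `Γ_c(B)`. -/
def dBase : (∀ i, (S.ΓB i).carrier) →ₗ[ℂ] ∀ i, (S.ΓB i).carrier :=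
  LinearMap.pi fun i => (S.ΓB i).d ∘ₗ LinearMap.proj i

/-- Forms of degree `n` in the direct sum of the local algebras. -/
def gradeTot (n : ℕ) : Submodule ℂ S.Tot :=
  Submodule.pi Set.univ fun i => skewGr (S.ΓB i) S.ΓH.toDifferentialCalculus n

/-- Forms of degree `n` in the direct sum of the `Γ(B_i)`. -/
def gradeBase (n : ℕ) : Submodule ℂ (∀ i, (S.ΓB i).carrier) :=
  Submodule.pi Set.univ fun i => (S.ΓB i).gr n

lemma dTot_mem {x : S.Tot} (hx : x ∈ S.gammaC) : S.dTot x ∈ S.gammaC := by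
  rw [gammaC, mem_coveringCompletion] at *
  intro i j
  obtain ⟨y, hi, hj⟩ := hx i j
  exact ⟨S.ΓP.d y, by simp [S.χΓ_d, hi, dTot], by simp [S.χΓ_d, hj, dTot]⟩

/-- Every form on the base defines a form on the total space. -/
lemma exists_pullback (x : S.ΓBase.carrier) : ∃ y : S.ΓP.carrier,
    ∀ i, S.χΓ i y = skewTmul (S.ΓB i) S.ΓH.toDifferentialCalculus (S.πΓ i x) 1 := by
  have hx : x ∈ Algebra.adjoin ℂ
      (Set.range S.ΓBase.of ∪ Set.range fun a => S.ΓBase.d (S.ΓBase.of a)) := by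
    rw [S.ΓBase.generated]; trivial
  induction hx using Algebra.adjoin_induction with
  | mem x hx =>
    have key : ∀ b i, S.χΓ i (S.ΓP.of (E.ι b)) =
        skewTmul (S.ΓB i) S.ΓH.toDifferentialCalculus (S.πΓ i (S.ΓBase.of b)) 1 := by
      intro b i
      rw [S.χΓ_of, E.χ_ι, S.πΓ_of]
      simp [skewOf, skewTmul]
    rcases hx with ⟨b, rfl⟩ | ⟨b, rfl⟩
    · exact ⟨_, key b⟩
    · refine ⟨S.ΓP.d (S.ΓP.of (E.ι b)), fun i => ?_⟩
      rw [S.χΓ_d, key, skewD_tmul, S.ΓH.d_one]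
      simp [S.πΓ_d, skewTmul]
  | algebraMap r =>
    exact ⟨algebraMap ℂ _ r, fun i => by simp [GradedTensorProduct.algebraMap_def]⟩
  | add x y _ _ hx hy =>
    obtain ⟨s, hs⟩ := hx
    obtain ⟨t, ht⟩ := hy
    exact ⟨s + t, fun i => by rw [map_add, hs, ht, map_add, skewTmul_add_left]⟩
  | mul x y _ _ hx hy =>
    obtain ⟨s, hs⟩ := hx
    obtain ⟨t, ht⟩ := hy
    exact ⟨s * t, fun i => by rw [map_mul, hs, ht, map_mul, skewTmul_one_mul]⟩

/-- The embedding of `Γ_c(B)` into `hor Γ_c(P)`, `(ρ_i) ↦ (ρ_i ⊗ 1)`. -/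
def iotaC (ρ : S.gammaCBase) : S.hor :=
  ⟨fun i => skewTmul (S.ΓB i) S.ΓH.toDifferentialCalculus (ρ.1 i) 1, by
    refine ⟨?_, fun i _ => ?_⟩
    · refine (mem_coveringCompletion _ _).2 fun i j => ?_
      obtain ⟨x, hi, hj⟩ := (mem_coveringCompletion _ _).1 ρ.2 i j
      obtain ⟨y, hy⟩ := S.exists_pullback x
      exact ⟨y, by rw [hy, hi], by rw [hy, hj]⟩
    · exact (mem_horLoc _ _).2 ⟨ρ.1 i ⊗ₜ 1, by simp [skewTmul]⟩⟩


lemma exists_coact (x : S.ΓP.carrier) : ∃ t : S.ΓP.carrier ⊗[ℂ] H, ∀ i,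
    LinearMap.rTensor H (S.χΓ i).toLinearMap t = coactLoc (S.ΓB i) S.ΓH (S.χΓ i x) := by
  have hx : x ∈ Algebra.adjoin ℂ
      (Set.range S.ΓP.of ∪ Set.range fun a => S.ΓP.d (S.ΓP.of a)) := by
    rw [S.ΓP.generated]; trivial
  have key : ∀ p i, LinearMap.rTensor H (S.χΓ i).toLinearMap
      (LinearMap.rTensor H S.ΓP.of.toLinearMap (E.coact p)) =
        coactLoc (S.ΓB i) S.ΓH (S.χΓ i (S.ΓP.of p)) := by
    intro p i
    rw [S.χΓ_of, coactLoc_skewOf, ← E.χ_coact, LinearEquiv.symm_apply_apply,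
      ← LinearMap.comp_apply, ← LinearMap.comp_apply, ← LinearMap.rTensor_comp,
      ← LinearMap.rTensor_comp]
    congr 2
    ext y
    simp [S.χΓ_of]
  induction hx using Algebra.adjoin_induction with
  | mem x hx =>
    rcases hx with ⟨p, rfl⟩ | ⟨p, rfl⟩
    · exact ⟨_, key p⟩
    · refine ⟨LinearMap.rTensor H S.ΓP.d
        (LinearMap.rTensor H S.ΓP.of.toLinearMap (E.coact p)), fun i => ?_⟩
      have h := coactLoc_skewD_skewOf (Γ := S.ΓB i) (Λ := S.ΓH) (E.χ i p)
      rw [← S.χΓ_of, ← key, ← S.χΓ_d] at h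
      rw [h, ← LinearMap.comp_apply, ← LinearMap.comp_apply (LinearMap.rTensor H (skewD _ _)),
        ← LinearMap.rTensor_comp, ← LinearMap.rTensor_comp]
      congr 2
      ext y
      simp [S.χΓ_d]
  | algebraMap r =>
    refine ⟨algebraMap ℂ _ r, fun i => ?_⟩
    rw [AlgHom.commutes, coactLoc_algebraMap]
    simp [Algebra.TensorProduct.algebraMap_apply]
  | add x y _ _ hx hy =>
    obtain ⟨s, hs⟩ := hx
    obtain ⟨t, ht⟩ := hy
    exact ⟨s + t, fun i => by rw [map_add, hs, ht, map_add, map_add]⟩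
  | mul x y _ _ hx hy =>
    obtain ⟨s, hs⟩ := hx
    obtain ⟨t, ht⟩ := hy
    refine ⟨s * t, fun i => ?_⟩
    refine (map_mul (Algebra.TensorProduct.map (S.χΓ i) (AlgHom.id ℂ H)) s t).trans ?_
    rw [map_mul (S.χΓ i), coactLoc_mul, ← hs, ← ht]
    rfl

section Coaction

variable [Fintype I] [DecidableEq I]

/-- The componentwise coaction of `H` on the direct sum of the local algebras. -/
def coactTot : S.Tot →ₗ[ℂ] S.Tot ⊗[ℂ] H :=
  ∑ i, LinearMap.rTensor H (LinearMap.single ℂ S.Loc i) ∘ₗ coactLoc (S.ΓB i) S.ΓH ∘ₗ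
    LinearMap.proj i

lemma rTensor_proj_coactTot (x : S.Tot) (i : I) :
    LinearMap.rTensor H (LinearMap.proj i : S.Tot →ₗ[ℂ] S.Loc i) (S.coactTot x) =
      coactLoc (S.ΓB i) S.ΓH (x i) := by
  simp only [coactTot, LinearMap.sum_apply, map_sum, LinearMap.comp_apply, LinearMap.proj_apply]
  rw [Finset.sum_eq_single i]
  · rw [← LinearMap.comp_apply, ← LinearMap.rTensor_comp, LinearMap.proj_comp_single_same,
      LinearMap.rTensor_id, LinearMap.id_apply]
  · intro j _ hj
    rw [← LinearMap.comp_apply, ← LinearMap.rTensor_comp,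
      LinearMap.proj_comp_single_ne ℂ S.Loc i j hj.symm, LinearMap.rTensor_zero,
      LinearMap.zero_apply]
  · simp

lemma slice_coactTot (x : S.Tot) (i : I) (φ : H →ₗ[ℂ] ℂ) :
    slice S.Tot φ (S.coactTot x) i = slice _ φ (coactLoc (S.ΓB i) S.ΓH (x i)) := by
  rw [← rTensor_proj_coactTot, slice_rTensor]
  rfl

lemma slice_mem_gammaC {x : S.Tot} (hx : x ∈ S.gammaC) (φ : H →ₗ[ℂ] ℂ) :
    slice S.Tot φ (S.coactTot x) ∈ S.gammaC := by
  rw [gammaC, mem_coveringCompletion] at *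
  intro i j
  obtain ⟨y, hi, hj⟩ := hx i j
  obtain ⟨t, ht⟩ := S.exists_coact y
  refine ⟨slice _ φ t, ?_, ?_⟩
  · rw [slice_coactTot, ← hi, ← ht, slice_rTensor]; rfl
  · rw [slice_coactTot, ← hj, ← ht, slice_rTensor]; rfl

lemma coactTot_mem_gammaC : ∀ x ∈ Subalgebra.toSubmodule S.gammaC, S.coactTot x ∈
    LinearMap.range (LinearMap.rTensor H (Subalgebra.toSubmodule S.gammaC).subtype) :=
  fun _ hx => mem_range_of_slice _ _ fun φ => S.slice_mem_gammaC hx φ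

lemma coactTot_mem_hor : ∀ x ∈ Subalgebra.toSubmodule S.hor, S.coactTot x ∈
    LinearMap.range (LinearMap.rTensor H (Subalgebra.toSubmodule S.hor).subtype) := by
  refine fun x hx => mem_range_of_slice _ _ fun φ => ⟨S.slice_mem_gammaC hx.1 φ, fun i _ => ?_⟩
  rw [slice_coactTot]
  exact coactLoc_horLoc (hx.2 i trivial) φ

/-- The coaction of `H` on `Γ_c(P)`. -/
def coactC : S.gammaC →ₗ[ℂ] S.gammaC ⊗[ℂ] H :=
  restrictCoaction S.coactTot (Subalgebra.toSubmodule S.gammaC) S.coactTot_mem_gammaC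

/-- The coaction of `H` on `hor Γ_c(P)`. -/
def coactHor : S.hor →ₗ[ℂ] S.hor ⊗[ℂ] H :=
  restrictCoaction S.coactTot (Subalgebra.toSubmodule S.hor) S.coactTot_mem_hor

/-- `coactC` is the coaction with `(χ_i ⊗ id) ∘ Δ = (id ⊗ Δ^Γ) ∘ χ_i` for all `i`. -/
lemma coactC_spec (x : S.gammaC) (i : I) :
    LinearMap.rTensor H (LinearMap.proj i ∘ₗ S.gammaC.val.toLinearMap : S.gammaC →ₗ[ℂ] S.Loc i)
      (S.coactC x) = coactLoc (S.ΓB i) S.ΓH (x.1 i) := by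
  have h := rTensor_restrictCoaction S.coactTot (Subalgebra.toSubmodule S.gammaC)
    S.coactTot_mem_gammaC x
  have h' := S.rTensor_proj_coactTot x.1 i
  rw [← h, ← LinearMap.comp_apply, ← LinearMap.rTensor_comp] at h'
  exact h'

/-- `coactHor` is the restriction of `coactC`. -/
lemma coactHor_spec (x : S.hor) (i : I) :
    LinearMap.rTensor H (LinearMap.proj i ∘ₗ S.hor.val.toLinearMap : S.hor →ₗ[ℂ] S.Loc i)
      (S.coactHor x) = coactLoc (S.ΓB i) S.ΓH (x.1 i) := by
  have h := rTensor_restrictCoaction S.coactTot (Subalgebra.toSubmodule S.hor)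
    S.coactTot_mem_hor x
  have h' := S.rTensor_proj_coactTot x.1 i
  rw [← h, ← LinearMap.comp_apply, ← LinearMap.rTensor_comp] at h'
  exact h'

/-! ### Covariant derivatives -/

/-- The conditions common to left and right covariant derivatives. -/
structure IsCovariantOperator (D : S.hor →ₗ[ℂ] S.hor) : Prop where
  degree : ∀ (n : ℕ) (γ : S.hor), γ.1 ∈ S.gradeTot n → (D γ).1 ∈ S.gradeTot (n + 1)
  map_one : D 1 = 0
  covariant : ∀ γ : S.hor, LinearMap.rTensor H D (S.coactHor γ) = S.coactHor (D γ)
  map_ker : ∀ (i : I) (γ : S.hor), γ.1 i = 0 → (D γ).1 i = 0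

/-- Left covariant derivatives. -/
structure IsLeftCovariantDerivative (D : S.hor →ₗ[ℂ] S.hor) : Prop
    extends S.IsCovariantOperator D where
  leibniz : ∀ (n : ℕ) (ρ : S.gammaCBase) (α : S.hor), ρ.1 ∈ S.gradeBase n →
    (D (S.iotaC ρ * α)).1 =
      S.dTot (S.iotaC ρ).1 * α.1 + (-1 : ℂ) ^ n • ((S.iotaC ρ).1 * (D α).1)

/-- Right covariant derivatives. -/
structure IsRightCovariantDerivative (D : S.hor →ₗ[ℂ] S.hor) : Prop
    extends S.IsCovariantOperator D where
  leibniz : ∀ (n : ℕ) (ρ : S.gammaCBase) (α : S.hor), α.1 ∈ S.gradeTot n →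
    (D (α * S.iotaC ρ)).1 =
      (D α).1 * (S.iotaC ρ).1 + (-1 : ℂ) ^ n • (α.1 * S.dTot (S.iotaC ρ).1)

/-! ### Pre-connection forms -/

/-- Left pre-connection forms. -/
structure IsLeftPreConnectionForm (ω : H →ₗ[ℂ] S.gammaC) : Prop where
  degree : ∀ h : H, (ω h).1 ∈ S.gradeTot 1
  map_one : ω 1 = 0
  covariant : ∀ h : H, S.coactC (ω h) = LinearMap.rTensor H ω (adL H h)
  vertical : ∀ (i : I) (h : H), (ω h).1 i - horC _ _ ((ω h).1 i) =
    -skewTmul (S.ΓB i) S.ΓH.toDifferentialCalculus 1 (vertL S.ΓH h)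

/-- Right pre-connection forms. -/
structure IsRightPreConnectionForm
    (hS : Function.Bijective (HopfAlgebra.antipode ℂ : H →ₗ[ℂ] H))
    (ω : H →ₗ[ℂ] S.gammaC) : Prop where
  degree : ∀ h : H, (ω h).1 ∈ S.gradeTot 1
  map_one : ω 1 = 0
  covariant : ∀ h : H, S.coactC (ω h) = LinearMap.rTensor H ω (adR H hS h)
  vertical : ∀ (i : I) (h : H), (ω h).1 i - horC _ _ ((ω h).1 i) =
    -skewTmul (S.ΓB i) S.ΓH.toDifferentialCalculus 1 (vertR S.ΓH hS h)

/-- `∑ γ₀ ω(γ₁)` for a horizontal form `γ`. -/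
def convL (ω : H →ₗ[ℂ] S.gammaC) : S.hor →ₗ[ℂ] S.Tot :=
  LinearMap.mul' ℂ S.Tot ∘ₗ
    TensorProduct.map S.hor.val.toLinearMap (S.gammaC.val.toLinearMap ∘ₗ ω) ∘ₗ S.coactHor

/-- `∑ ω(γ₁) γ₀` for a horizontal form `γ`. -/
def convR (ω : H →ₗ[ℂ] S.gammaC) : S.hor →ₗ[ℂ] S.Tot :=
  LinearMap.mul' ℂ S.Tot ∘ₗ (TensorProduct.comm ℂ S.Tot S.Tot).toLinearMap ∘ₗ
    TensorProduct.map S.hor.val.toLinearMap (S.gammaC.val.toLinearMap ∘ₗ ω) ∘ₗ S.coactHor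

end Coaction

end DifferentialStructure
end Bundle
end QPB
end

/-! The correspondence is local: `map_ker` says that the `i`-th component of `D γ` depends only on
the `i`-th component of `γ`, so a covariant derivative induces operators `D_i` on the algebras
`Γ(B_i) ⊗̂ H`. These are spanned by products of `a ∈ Γ(B_i)` with `1 ⊗ h`, and both factors lift to
global forms: `a` to the base and `1 ⊗ h` to `P`. The Leibniz rule then reduces `D_i` to the single
linear map `δ_i(h) = D_i(1 ⊗ h) - d(1 ⊗ h)`.

Write `j_i(h) = 1 ⊗ h`. The required formula for `D` on `1 ⊗ h` reads `δ_i(h) = ∑ j_i(h₁)ω_i(h₂)`,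
that is, `δ_i = j_i * ω_i` for the convolution product. An algebra homomorphism `j` has the
convolution inverse `j ∘ S`, so there is exactly one solution `ω_i = (j_i ∘ S) * δ_i`. In the right
case the product is reversed, `δ_i(h) = ∑ ω_i(h₂)j_i(h₁)`, and the inverse is `j ∘ S⁻¹`.

Multiplication by `j_i` also matches the axioms. Adjoint covariance of `ω_i` is equivalent to `δ_i`
intertwining the coaction with `Δ` (`coactLoc_comp_eq_adL_iff`), because the coaction is an algebra
homomorphism. The prescribed vertical part of `ω_i` is equivalent to `δ_i` having vertical part `-1
⊗ dh` (`vertC_comp_eq_vertL_iff`), which is what horizontality of `D_i(1 ⊗ h)` requires.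

It remains to see that the `ω_i(h)` fit together to an element of `Γ_c(P)`. In `Γ(P)/(ker χ_i + ker
χ_j)` let `ε` be the difference of the images of `ω_i` and `ω_j`. For `p ∈ P` the elements `∑
p₀ω(p₁) = D(p) - dp` do fit together, so `∑ p₀ε(p₁) = 0` in the quotient. Taking `p` with `χ_i(p) =
1 ⊗ h` turns this into `j * ε = 0`, and cancelling `j` gives `ε = 0` (`compatible_of_mul`). -/

noncomputable section
namespace QPB

/-! ### Convolution -/

section Convolution

variable {H A A' : Type*} [Ring H] [HopfAlgebra ℂ H] [Ring A] [Algebra ℂ A] [Ring A'] [Algebra ℂ A']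

/-- The convolution product `h ↦ ∑ f(h₁)g(h₂)`. -/
def conv (f g : H →ₗ[ℂ] A) : H →ₗ[ℂ] A :=
  LinearMap.mul' ℂ A ∘ₗ TensorProduct.map f g ∘ₗ Coalgebra.comul (R := ℂ)

/-- The opposite convolution product `h ↦ ∑ g(h₂)f(h₁)`. -/
def convOp (f g : H →ₗ[ℂ] A) : H →ₗ[ℂ] A :=
  LinearMap.mul' ℂ A ∘ₗ (TensorProduct.comm ℂ A A).toLinearMap ∘ₗ TensorProduct.map f g ∘ₗ
    Coalgebra.comul (R := ℂ)

variable (H A) in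
/-- The unit `h ↦ ε(h)1` of the convolution product. -/
def convUnit : H →ₗ[ℂ] A := Algebra.linearMap ℂ A ∘ₗ Coalgebra.counit

/-- Identifies `conv` with the product of the convolution ring `WithConv`, which supplies
associativity and the unit law. -/
lemma toConv_conv (f g : H →ₗ[ℂ] A) :
    WithConv.toConv (conv f g) = WithConv.toConv f * WithConv.toConv g := rfl

lemma toConv_convUnit : WithConv.toConv (convUnit H A) = 1 := rfl

/-- The reversed product is ordinary convolution with values in the opposite algebra, so its
associativity and unit law need no separate proof. -/
lemma op_comp_convOp (f g : H →ₗ[ℂ] A) :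
    (MulOpposite.opLinearEquiv ℂ : A ≃ₗ[ℂ] Aᵐᵒᵖ).toLinearMap ∘ₗ convOp f g =
      conv ((MulOpposite.opLinearEquiv ℂ : A ≃ₗ[ℂ] Aᵐᵒᵖ).toLinearMap ∘ₗ f)
        ((MulOpposite.opLinearEquiv ℂ : A ≃ₗ[ℂ] Aᵐᵒᵖ).toLinearMap ∘ₗ g) := by
  ext h
  simp only [conv, convOp, LinearMap.comp_apply]
  generalize Coalgebra.comul (R := ℂ) h = t
  induction t with
  | zero => simp
  | tmul x y => simp
  | add s t hs ht => simp only [map_add, hs, ht]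

lemma op_comp_convUnit :
    (MulOpposite.opLinearEquiv ℂ : A ≃ₗ[ℂ] Aᵐᵒᵖ).toLinearMap ∘ₗ convUnit H A =
      convUnit H Aᵐᵒᵖ := rfl

lemma op_comp_injective :
    Function.Injective fun f : H →ₗ[ℂ] A =>
      (MulOpposite.opLinearEquiv ℂ : A ≃ₗ[ℂ] Aᵐᵒᵖ).toLinearMap ∘ₗ f := by
  intro f g h
  ext x
  exact MulOpposite.op_injective (LinearMap.congr_fun h x)

lemma conv_assoc (f g k : H →ₗ[ℂ] A) : conv (conv f g) k = conv f (conv g k) := by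
  apply WithConv.toConv_injective
  simp only [toConv_conv, mul_assoc]

lemma convUnit_conv (f : H →ₗ[ℂ] A) : conv (convUnit H A) f = f := by
  apply WithConv.toConv_injective
  simp only [toConv_conv, toConv_convUnit, one_mul]

lemma conv_zero (f : H →ₗ[ℂ] A) : conv f 0 = 0 := by
  simp [conv, TensorProduct.map_zero_right]

lemma convOp_assoc (f g k : H →ₗ[ℂ] A) : convOp (convOp f g) k = convOp f (convOp g k) := by
  apply op_comp_injective
  simp only [op_comp_convOp, conv_assoc]

lemma convUnit_convOp (f : H →ₗ[ℂ] A) : convOp (convUnit H A) f = f := by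
  apply op_comp_injective
  simp only [op_comp_convOp, op_comp_convUnit, convUnit_conv]

lemma convOp_zero (f : H →ₗ[ℂ] A) : convOp f 0 = 0 := by
  simp [convOp, TensorProduct.map_zero_right]

lemma conv_sub (f g k : H →ₗ[ℂ] A) : conv f (g - k) = conv f g - conv f k := by
  rw [sub_eq_add_neg, sub_eq_add_neg]
  ext h
  simp only [conv, LinearMap.comp_apply, LinearMap.add_apply, LinearMap.neg_apply]
  generalize Coalgebra.comul (R := ℂ) h = t
  induction t with
  | zero => simp
  | tmul x y => simp [mul_add]
  | add s t hs ht => simp only [map_add, hs, ht]; abel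

lemma convOp_sub (f g k : H →ₗ[ℂ] A) : convOp f (g - k) = convOp f g - convOp f k := by
  ext h
  simp only [convOp, LinearMap.comp_apply, LinearMap.sub_apply]
  generalize Coalgebra.comul (R := ℂ) h = t
  induction t with
  | zero => simp
  | tmul x y => simp [sub_mul]
  | add s t hs ht => simp only [map_add, hs, ht]; abel

lemma comp_conv (φ : A →ₐ[ℂ] A') (f g : H →ₗ[ℂ] A) :
    φ.toLinearMap ∘ₗ conv f g = conv (φ.toLinearMap ∘ₗ f) (φ.toLinearMap ∘ₗ g) := by
  ext h
  simp only [conv, LinearMap.comp_apply]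
  generalize Coalgebra.comul (R := ℂ) h = t
  induction t with
  | zero => simp
  | tmul x y => simp
  | add s t hs ht => simp only [map_add, hs, ht]

lemma comp_convOp (φ : A →ₐ[ℂ] A') (f g : H →ₗ[ℂ] A) :
    φ.toLinearMap ∘ₗ convOp f g = convOp (φ.toLinearMap ∘ₗ f) (φ.toLinearMap ∘ₗ g) := by
  ext h
  simp only [convOp, LinearMap.comp_apply]
  generalize Coalgebra.comul (R := ℂ) h = t
  induction t with
  | zero => simp
  | tmul x y => simp
  | add s t hs ht => simp only [map_add, hs, ht]

/-- A linear map which is balanced against convolution factors on each elementary tensor is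
balanced against the convolution product. -/
lemma comp_conv_of_mul {V : Type*} [AddCommGroup V] [Module ℂ V] (L : A →ₗ[ℂ] V) {f g : H →ₗ[ℂ] A}
    {f' g' : H →ₗ[ℂ] A'} (L' : A' →ₗ[ℂ] V) (h : ∀ x y, L (f x * g y) = L' (f' x * g' y)) (x : H) :
    L (conv f g x) = L' (conv f' g' x) := by
  simp only [conv, LinearMap.comp_apply]
  generalize Coalgebra.comul (R := ℂ) x = t
  induction t with
  | zero => simp
  | tmul x y => simpa using h x y
  | add s t hs ht => simp only [map_add, hs, ht]

lemma comp_convOp_of_mul {V : Type*} [AddCommGroup V] [Module ℂ V] (L : A →ₗ[ℂ] V)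
    {f g : H →ₗ[ℂ] A} {f' g' : H →ₗ[ℂ] A'} (L' : A' →ₗ[ℂ] V)
    (h : ∀ x y, L (g y * f x) = L' (g' y * f' x)) (x : H) :
    L (convOp f g x) = L' (convOp f' g' x) := by
  simp only [convOp, LinearMap.comp_apply]
  generalize Coalgebra.comul (R := ℂ) x = t
  induction t with
  | zero => simp
  | tmul x y => simpa using h x y
  | add s t hs ht => simp only [map_add, hs, ht]

lemma conv_mem (U : Submodule ℂ A) {f g : H →ₗ[ℂ] A} (h : ∀ x y, f x * g y ∈ U) (x : H) :
    conv f g x ∈ U := by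
  simp only [conv, LinearMap.comp_apply]
  generalize Coalgebra.comul (R := ℂ) x = t
  induction t with
  | zero => simp
  | tmul x y => simpa using h x y
  | add s t hs ht => simp only [map_add]; exact add_mem hs ht

lemma convOp_mem (U : Submodule ℂ A) {f g : H →ₗ[ℂ] A} (h : ∀ x y, g y * f x ∈ U) (x : H) :
    convOp f g x ∈ U := by
  simp only [convOp, LinearMap.comp_apply]
  generalize Coalgebra.comul (R := ℂ) x = t
  induction t with
  | zero => simp
  | tmul x y => simpa using h x y
  | add s t hs ht => simp only [map_add]; exact add_mem hs ht

lemma conv_antipode_left (j : H →ₐ[ℂ] A) :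
    conv (j.toLinearMap ∘ₗ HopfAlgebra.antipode ℂ) j.toLinearMap = convUnit H A := by
  have h : conv (HopfAlgebra.antipode ℂ) LinearMap.id = convUnit H H :=
    HopfAlgebra.mul_antipode_rTensor_comul
  have h' := comp_conv j (HopfAlgebra.antipode ℂ) LinearMap.id
  rw [h, LinearMap.comp_id] at h'
  rw [← h']
  ext x
  simp [convUnit]

lemma conv_antipode_right (j : H →ₐ[ℂ] A) :
    conv j.toLinearMap (j.toLinearMap ∘ₗ HopfAlgebra.antipode ℂ) = convUnit H A := by
  have h : conv LinearMap.id (HopfAlgebra.antipode ℂ) = convUnit H H :=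
    HopfAlgebra.mul_antipode_lTensor_comul
  have h' := comp_conv j LinearMap.id (HopfAlgebra.antipode ℂ)
  rw [h, LinearMap.comp_id] at h'
  rw [← h']
  ext x
  simp [convUnit]

/-! ### The inverse antipode as inverse for the reversed convolution -/

section AntipodeInv

variable (hS : Function.Bijective (HopfAlgebra.antipode ℂ : H →ₗ[ℂ] H))

lemma antipode_antipodeInv (h : H) : HopfAlgebra.antipode ℂ (antipodeInv H hS h) = h :=
  (LinearEquiv.ofBijective (HopfAlgebra.antipode ℂ : H →ₗ[ℂ] H) hS).apply_symm_apply h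

lemma antipode_comp_convOp (f g : H →ₗ[ℂ] H) :
    HopfAlgebra.antipode ℂ ∘ₗ convOp f g =
      conv (HopfAlgebra.antipode ℂ ∘ₗ f) (HopfAlgebra.antipode ℂ ∘ₗ g) := by
  ext h
  simp only [conv, convOp, LinearMap.comp_apply]
  generalize Coalgebra.comul (R := ℂ) h = t
  induction t with
  | zero => simp
  | tmul x y => simp [HopfAlgebra.antipode_mul_antidistrib]
  | add s t hs ht => simp only [map_add, hs, ht]

lemma antipode_comp_convUnit :
    HopfAlgebra.antipode ℂ ∘ₗ convUnit H H = convUnit H H := by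
  ext h
  simp [convUnit, Algebra.algebraMap_eq_smul_one]

lemma antipode_comp_antipodeInv : HopfAlgebra.antipode ℂ ∘ₗ antipodeInv H hS = LinearMap.id :=
  LinearMap.ext (antipode_antipodeInv hS)

lemma convOp_antipodeInv_left (j : H →ₐ[ℂ] A) :
    convOp (j.toLinearMap ∘ₗ antipodeInv H hS) j.toLinearMap = convUnit H A := by
  have h : convOp (antipodeInv H hS) LinearMap.id = convUnit H H := by
    ext x
    -- Since `S` reverses products, applying it to `∑ h₂S⁻¹(h₁)` gives `∑ h₁S(h₂)`, which is known;
    -- injectivity of `S` brings the identity back.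
    apply hS.1
    refine (LinearMap.congr_fun (antipode_comp_convOp (antipodeInv H hS) LinearMap.id) x).trans ?_
    refine Eq.trans ?_ (LinearMap.congr_fun antipode_comp_convUnit x).symm
    rw [antipode_comp_antipodeInv, LinearMap.comp_id]
    exact LinearMap.congr_fun HopfAlgebra.mul_antipode_lTensor_comul x
  have h' := comp_convOp j (antipodeInv H hS) LinearMap.id
  rw [h, LinearMap.comp_id] at h'
  rw [← h']
  ext x
  simp [convUnit]

lemma convOp_antipodeInv_right (j : H →ₐ[ℂ] A) :
    convOp j.toLinearMap (j.toLinearMap ∘ₗ antipodeInv H hS) = convUnit H A := by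
  have h : convOp LinearMap.id (antipodeInv H hS) = convUnit H H := by
    ext x
    apply hS.1
    refine (LinearMap.congr_fun (antipode_comp_convOp LinearMap.id (antipodeInv H hS)) x).trans ?_
    refine Eq.trans ?_ (LinearMap.congr_fun antipode_comp_convUnit x).symm
    rw [antipode_comp_antipodeInv, LinearMap.comp_id]
    exact LinearMap.congr_fun HopfAlgebra.mul_antipode_rTensor_comul x
  have h' := comp_convOp j LinearMap.id (antipodeInv H hS)
  rw [h, LinearMap.comp_id] at h'
  rw [← h']
  ext x
  simp [convUnit]

end AntipodeInv

lemma conv_antipode_cancel (j : H →ₐ[ℂ] A) (f : H →ₗ[ℂ] A) :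
    conv (j.toLinearMap ∘ₗ HopfAlgebra.antipode ℂ) (conv j.toLinearMap f) = f := by
  rw [← conv_assoc, conv_antipode_left, convUnit_conv]

lemma conv_cancel_antipode (j : H →ₐ[ℂ] A) (f : H →ₗ[ℂ] A) :
    conv j.toLinearMap (conv (j.toLinearMap ∘ₗ HopfAlgebra.antipode ℂ) f) = f := by
  rw [← conv_assoc, conv_antipode_right, convUnit_conv]

lemma convOp_antipodeInv_cancel (hS : Function.Bijective (HopfAlgebra.antipode ℂ : H →ₗ[ℂ] H))
    (j : H →ₐ[ℂ] A) (f : H →ₗ[ℂ] A) :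
    convOp (j.toLinearMap ∘ₗ antipodeInv H hS) (convOp j.toLinearMap f) = f := by
  rw [← convOp_assoc, convOp_antipodeInv_left, convUnit_convOp]

lemma convOp_cancel_antipodeInv (hS : Function.Bijective (HopfAlgebra.antipode ℂ : H →ₗ[ℂ] H))
    (j : H →ₐ[ℂ] A) (f : H →ₗ[ℂ] A) :
    convOp j.toLinearMap (convOp (j.toLinearMap ∘ₗ antipodeInv H hS) f) = f := by
  rw [← convOp_assoc, convOp_antipodeInv_right, convUnit_convOp]

/-- An algebra homomorphism is convolution invertible. This cancellation carries uniqueness of the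
form, the transfer of covariance and of vertical parts, and the glueing. -/
lemma conv_left_injective (j : H →ₐ[ℂ] A) : Function.Injective (conv j.toLinearMap) :=
  Function.LeftInverse.injective (conv_antipode_cancel j)

lemma convOp_left_injective (hS : Function.Bijective (HopfAlgebra.antipode ℂ : H →ₗ[ℂ] H))
    (j : H →ₐ[ℂ] A) : Function.Injective (convOp j.toLinearMap) :=
  Function.LeftInverse.injective (convOp_antipodeInv_cancel hS j)

/-! ### Equivariance in terms of convolution -/

variable (H A) in
/-- The homomorphism `a ↦ a ⊗ 1`. -/
abbrev inA : A →ₐ[ℂ] A ⊗[ℂ] H := Algebra.TensorProduct.includeLeft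

variable (H A) in
/-- The homomorphism `h ↦ 1 ⊗ h`. -/
abbrev inH : H →ₐ[ℂ] A ⊗[ℂ] H := Algebra.TensorProduct.includeRight

/-- Turns covariance conditions into convolution identities in `A ⊗ H`. Since `A ⊗ 1` and `1 ⊗ H`
commute, the same map is also a reversed convolution, as used for right forms. -/
lemma rTensor_comul_eq_conv (f : H →ₗ[ℂ] A) :
    LinearMap.rTensor H f ∘ₗ Coalgebra.comul (R := ℂ) =
      conv ((inA H A).toLinearMap ∘ₗ f) (inH H A).toLinearMap := by
  ext h
  simp only [conv, LinearMap.comp_apply]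
  generalize Coalgebra.comul (R := ℂ) h = t
  induction t with
  | zero => simp
  | tmul x y => simp
  | add s t hs ht => simp only [map_add, hs, ht]

lemma rTensor_comul_eq_convOp (f : H →ₗ[ℂ] A) :
    LinearMap.rTensor H f ∘ₗ Coalgebra.comul (R := ℂ) =
      convOp ((inA H A).toLinearMap ∘ₗ f) (inH H A).toLinearMap := by
  ext h
  simp only [convOp, LinearMap.comp_apply]
  generalize Coalgebra.comul (R := ℂ) h = t
  induction t with
  | zero => simp
  | tmul x y => simp
  | add s t hs ht => simp only [map_add, hs, ht]

/-- The leg `S(h₁)` of the adjoint coaction multiplies from the left in `H`, so it splits off as a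
left convolution factor. -/
lemma rTensor_adL_eq_conv (f : H →ₗ[ℂ] A) :
    LinearMap.rTensor H f ∘ₗ adL H =
      conv ((inH H A).toLinearMap ∘ₗ HopfAlgebra.antipode ℂ)
        (LinearMap.rTensor H f ∘ₗ Coalgebra.comul (R := ℂ)) := by
  ext h
  simp only [conv, adL, comulSwap, LinearMap.comp_apply]
  generalize Coalgebra.comul (R := ℂ) h = t
  induction t with
  | zero => simp
  | add s t hs ht => simp only [map_add, hs, ht]
  | tmul x y =>
    simp only [LinearMap.lTensor_tmul, TensorProduct.map_tmul, LinearMap.comp_apply]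
    generalize Coalgebra.comul (R := ℂ) y = t
    induction t with
    | zero => simp
    | add s t hs ht => simp only [map_add, TensorProduct.tmul_add, hs, ht]
    | tmul y z => simp

lemma rTensor_adR_eq_convOp (hS : Function.Bijective (HopfAlgebra.antipode ℂ : H →ₗ[ℂ] H))
    (f : H →ₗ[ℂ] A) :
    LinearMap.rTensor H f ∘ₗ adR H hS =
      convOp ((inH H A).toLinearMap ∘ₗ antipodeInv H hS)
        (LinearMap.rTensor H f ∘ₗ Coalgebra.comul (R := ℂ)) := by
  ext h
  simp only [convOp, adR, comulSwap, LinearMap.comp_apply]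
  generalize Coalgebra.comul (R := ℂ) h = t
  induction t with
  | zero => simp
  | add s t hs ht => simp only [map_add, hs, ht]
  | tmul x y =>
    simp only [LinearMap.lTensor_tmul, TensorProduct.map_tmul, LinearMap.comp_apply]
    generalize Coalgebra.comul (R := ℂ) y = t
    induction t with
    | zero => simp
    | add s t hs ht => simp only [map_add, TensorProduct.tmul_add, hs, ht]
    | tmul y z => simp

/-- `∑ (j(h₁) ⊗ h₂)(ω(h₄) ⊗ S(h₃)h₅) = ∑ j(h₁)ω(h₂) ⊗ h₃`. -/
lemma conv_rTensor_adL (j ω : H →ₗ[ℂ] A) :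
    conv (LinearMap.rTensor H j ∘ₗ Coalgebra.comul (R := ℂ)) (LinearMap.rTensor H ω ∘ₗ adL H) =
      LinearMap.rTensor H (conv j ω) ∘ₗ Coalgebra.comul (R := ℂ) := by
  -- The factor `1 ⊗ h` from the coproduct of `j` meets the factor `1 ⊗ S(h)` of the adjoint
  -- coaction, and the two cancel.
  rw [rTensor_adL_eq_conv, rTensor_comul_eq_conv j, conv_assoc, conv_cancel_antipode,
    rTensor_comul_eq_conv, rTensor_comul_eq_conv, ← conv_assoc, comp_conv]

/-- `∑ (ω(h₄) ⊗ h₅S⁻¹(h₃))(j(h₁) ⊗ h₂) = ∑ ω(h₂)j(h₁) ⊗ h₃`. -/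
lemma convOp_rTensor_adR (hS : Function.Bijective (HopfAlgebra.antipode ℂ : H →ₗ[ℂ] H))
    (j ω : H →ₗ[ℂ] A) :
    convOp (LinearMap.rTensor H j ∘ₗ Coalgebra.comul (R := ℂ))
        (LinearMap.rTensor H ω ∘ₗ adR H hS) =
      LinearMap.rTensor H (convOp j ω) ∘ₗ Coalgebra.comul (R := ℂ) := by
  rw [rTensor_adR_eq_convOp, rTensor_comul_eq_convOp j, convOp_assoc, convOp_cancel_antipodeInv,
    rTensor_comul_eq_convOp, rTensor_comul_eq_convOp, ← convOp_assoc, comp_convOp]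

end Convolution

/-! ### Slices -/

section Slice

variable {V W H : Type*} [AddCommGroup V] [Module ℂ V] [AddCommGroup W] [Module ℂ W]
  [AddCommGroup H] [Module ℂ H]

/-- All slices of `s - t` lie in the zero subspace, so `s - t` lies in the image of `0 ⊗ H`. -/
lemma eq_of_slice {s t : V ⊗[ℂ] H} (h : ∀ φ : H →ₗ[ℂ] ℂ, slice V φ s = slice V φ t) : s = t := by
  have h0 : s - t ∈ LinearMap.range (LinearMap.rTensor H (⊥ : Submodule ℂ V).subtype) :=
    mem_range_of_slice ⊥ _ fun φ => by simp [h]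
  obtain ⟨u, hu⟩ := h0
  have : (⊥ : Submodule ℂ V).subtype = 0 := by
    ext x; exact (Submodule.mem_bot ℂ).1 x.2
  rw [this, LinearMap.rTensor_zero, LinearMap.zero_apply] at hu
  exact sub_eq_zero.1 hu.symm

/-- If the kernel of `f` is contained in that of `g`, then the same holds after tensoring. -/
lemma rTensor_eq_of_ker_le {W' : Type*} [AddCommGroup W'] [Module ℂ W'] {f : V →ₗ[ℂ] W}
    {g : V →ₗ[ℂ] W'} (hfg : ∀ v, f v = 0 → g v = 0) {s t : V ⊗[ℂ] H}
    (h : LinearMap.rTensor H f s = LinearMap.rTensor H f t) :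
    LinearMap.rTensor H g s = LinearMap.rTensor H g t := by
  refine eq_of_slice fun φ => ?_
  rw [slice_rTensor, slice_rTensor, ← sub_eq_zero, ← map_sub, ← map_sub]
  apply hfg
  rw [map_sub, map_sub, ← slice_rTensor, ← slice_rTensor, h, sub_self]

/-- Joint injectivity survives tensoring with `H`, because slicing commutes with every `f i ⊗ id`.
It lets covariance be checked one component at a time. -/
lemma eq_of_rTensor_eq {ι : Type*} {W : ι → Type*} [∀ i, AddCommGroup (W i)] [∀ i, Module ℂ (W i)]
    {f : ∀ i, V →ₗ[ℂ] W i} (hf : ∀ v, (∀ i, f i v = 0) → v = 0) {s t : V ⊗[ℂ] H}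
    (h : ∀ i, LinearMap.rTensor H (f i) s = LinearMap.rTensor H (f i) t) : s = t := by
  refine eq_of_slice fun φ => ?_
  rw [← sub_eq_zero]
  refine hf _ fun i => ?_
  rw [map_sub, ← slice_rTensor, ← slice_rTensor, h, sub_self]

end Slice


/-! ### The local algebras -/

lemma DifferentialCalculus.one_mem_gr {A : Type*} [Ring A] [Algebra ℂ A]
    (Γ : DifferentialCalculus A) : (1 : Γ.carrier) ∈ Γ.gr 0 :=
  SetLike.GradedOne.one_mem

section Skew

variable {A : Type*} [Ring A] [Algebra ℂ A] {C : Type*} [Ring C] [Algebra ℂ C]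
variable (Γ : DifferentialCalculus A) (Λ : DifferentialCalculus C)

/-- The homomorphism `a ↦ a ⊗ 1`. -/
def inl : Γ.carrier →ₐ[ℂ] Skew Γ Λ := GradedTensorProduct.includeLeft Γ.gr Λ.gr

/-- The homomorphism `b ↦ 1 ⊗ b`. -/
def inr : Λ.carrier →ₐ[ℂ] Skew Γ Λ := GradedTensorProduct.includeRight Γ.gr Λ.gr

/-- The homomorphism `h ↦ 1 ⊗ h` on the elements of degree zero. -/
def fib : C →ₐ[ℂ] Skew Γ Λ := (inr Γ Λ).comp Λ.of

variable {Γ Λ}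

lemma inl_eq (a : Γ.carrier) : inl Γ Λ a = skewTmul Γ Λ a 1 := rfl

lemma inr_eq (b : Λ.carrier) : inr Γ Λ b = skewTmul Γ Λ 1 b := rfl

lemma fib_eq (h : C) : fib Γ Λ h = skewTmul Γ Λ 1 (Λ.of h) := rfl

lemma inl_mul_skewTmul (a a' : Γ.carrier) (b : Λ.carrier) :
    inl Γ Λ a * skewTmul Γ Λ a' b = skewTmul Γ Λ (a * a') b := skewTmul_one_mul a a' b

lemma fib_mul_skewTmul (h : C) (a : Γ.carrier) (b : Λ.carrier) :
    fib Γ Λ h * skewTmul Γ Λ a b = skewTmul Γ Λ a (Λ.of h * b) := by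
  rw [fib_eq, skewTmul_of_mul, one_mul]

lemma skewTmul_mul_fib (a : Γ.carrier) (b : Λ.carrier) (h : C) :
    skewTmul Γ Λ a b * fib Γ Λ h = skewTmul Γ Λ a (b * Λ.of h) := by
  induction b using DirectSum.Decomposition.inductionOn Λ.gr with
  | zero => simp [skewTmul]
  | homogeneous b =>
    rw [fib_eq, skewTmul_mul a b.2 Γ.one_mem_gr (Λ.of h), mul_zero, pow_zero, one_smul, mul_one]
  | add x y hx hy =>
    simp only [skewTmul, TensorProduct.tmul_add, add_mul, map_add] at *
    rw [hx, hy]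

lemma inl_mul_inr (a : Γ.carrier) (b : Λ.carrier) :
    inl Γ Λ a * inr Γ Λ b = skewTmul Γ Λ a b := by
  rw [inr_eq, inl_mul_skewTmul, mul_one]

lemma inl_mul_fib (a : Γ.carrier) (h : C) :
    inl Γ Λ a * fib Γ Λ h = skewTmul Γ Λ a (Λ.of h) := inl_mul_inr a (Λ.of h)

/-- No sign appears because `1 ⊗ h` has degree zero. -/
lemma fib_mul_inl (a : Γ.carrier) (h : C) :
    fib Γ Λ h * inl Γ Λ a = inl Γ Λ a * fib Γ Λ h := by
  rw [inl_mul_fib, inl_eq, fib_mul_skewTmul, mul_one]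

lemma skew_hom_induction {motive : Skew Γ Λ → Prop} (x : Skew Γ Λ) (zero : motive 0)
    (tmul : ∀ (i j : ℕ) (a : Γ.carrier) (b : Λ.carrier), a ∈ Γ.gr i → b ∈ Λ.gr j →
      motive (skewTmul Γ Λ a b))
    (add : ∀ x y, motive x → motive y → motive (x + y)) : motive x := by
  obtain ⟨t, rfl⟩ := (skewEquiv Γ Λ).surjective x
  induction t with
  | zero => simpa using zero
  | add s t hs ht => rw [map_add]; exact add _ _ hs ht
  | tmul a b =>
    induction a using DirectSum.Decomposition.inductionOn Γ.gr with
    | zero => simpa using zero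
    | add a a' ha ha' => rw [TensorProduct.add_tmul, map_add]; exact add _ _ ha ha'
    | @homogeneous i a =>
      induction b using DirectSum.Decomposition.inductionOn Λ.gr with
      | zero => simpa using zero
      | add b b' hb hb' => rw [TensorProduct.tmul_add, map_add]; exact add _ _ hb hb'
      | @homogeneous j b => exact tmul i j a b a.2 b.2

lemma inl_mem_horLoc (a : Γ.carrier) : inl Γ Λ a ∈ horLoc Γ Λ :=
  (mem_horLoc _ _).2 ⟨a ⊗ₜ 1, by simp [inl_eq]⟩

lemma fib_mem_horLoc (h : C) : fib Γ Λ h ∈ horLoc Γ Λ :=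
  (mem_horLoc _ _).2 ⟨1 ⊗ₜ h, rfl⟩

-- The left factor is taken homogeneous because the Leibniz rule and the parity signs are stated by
-- degree.
@[elab_as_elim]
lemma horLoc_induction {motive : (x : Skew Γ Λ) → x ∈ horLoc Γ Λ → Prop}
    (zero : motive 0 (zero_mem _))
    (mul : ∀ (n : ℕ) (a : Γ.carrier) (h : C) (_ : a ∈ Γ.gr n) (hx : inl Γ Λ a * fib Γ Λ h ∈ _),
      motive (inl Γ Λ a * fib Γ Λ h) hx)
    (add : ∀ x y hx hy, motive x hx → motive y hy → motive (x + y) (add_mem hx hy))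
    {x : Skew Γ Λ} (hx : x ∈ horLoc Γ Λ) : motive x hx := by
  -- The motive depends on the membership proof, so the induction carries both together.
  suffices h : ∃ hx, motive x hx from h.2
  obtain ⟨t, rfl⟩ := (mem_horLoc _ _).1 hx
  clear hx
  induction t with
  | zero => rw [map_zero, map_zero]; exact ⟨_, zero⟩
  | add s t hs ht =>
    obtain ⟨hs, hs'⟩ := hs
    obtain ⟨ht, ht'⟩ := ht
    rw [map_add, map_add]
    exact ⟨_, add _ _ hs ht hs' ht'⟩
  | tmul a h =>
    change ∃ hx, motive (skewTmul Γ Λ a (Λ.of h)) hx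
    rw [← inl_mul_fib]
    induction a using DirectSum.Decomposition.inductionOn Γ.gr with
    | zero => rw [map_zero, zero_mul]; exact ⟨_, zero⟩
    | add a a' ha ha' =>
      obtain ⟨hs, hs'⟩ := ha
      obtain ⟨ht, ht'⟩ := ha'
      rw [map_add, add_mul]
      exact ⟨_, add _ _ hs ht hs' ht'⟩
    | @homogeneous n a =>
      exact ⟨mul_mem (inl_mem_horLoc _) (fib_mem_horLoc _), mul n a h a.2 _⟩

lemma skewOf_mem_horLoc (t : A ⊗[ℂ] C) : skewOf Γ Λ t ∈ horLoc Γ Λ := by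
  induction t with
  | zero => simp
  | add s t hs ht => rw [map_add]; exact add_mem hs ht
  | tmul a h =>
    change skewTmul Γ Λ (Γ.of a) (Λ.of h) ∈ _
    rw [← inl_mul_fib]
    exact mul_mem (inl_mem_horLoc _) (fib_mem_horLoc _)

/-! ### Degrees -/

lemma skewTmul_smul_left (r : ℂ) (a : Γ.carrier) (b : Λ.carrier) :
    skewTmul Γ Λ (r • a) b = r • skewTmul Γ Λ a b := by
  rw [← map_smul, TensorProduct.smul_tmul']

lemma skewTmul_smul_right (r : ℂ) (a : Γ.carrier) (b : Λ.carrier) :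
    skewTmul Γ Λ a (r • b) = r • skewTmul Γ Λ a b := by
  rw [← map_smul, ← TensorProduct.tmul_smul]

lemma skewTmul_add_right (a : Γ.carrier) (b b' : Λ.carrier) :
    skewTmul Γ Λ a (b + b') = skewTmul Γ Λ a b + skewTmul Γ Λ a b' := by
  simp [skewTmul, TensorProduct.tmul_add]

lemma skewTmul_mem {p q : ℕ} {a : Γ.carrier} (ha : a ∈ Γ.gr p) {b : Λ.carrier} (hb : b ∈ Λ.gr q) :
    skewTmul Γ Λ a b ∈ skewGr Γ Λ (p + q) :=
  Submodule.subset_span ⟨p, q, rfl, a, ha, b, hb, rfl⟩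

-- Scalars are absorbed into the left factor, so sums of homogeneous tensors suffice.
@[elab_as_elim]
lemma skewGr_induction {n : ℕ} {motive : (x : Skew Γ Λ) → x ∈ skewGr Γ Λ n → Prop}
    (zero : motive 0 (zero_mem _))
    (tmul : ∀ (p q : ℕ) (a : Γ.carrier) (b : Λ.carrier) (_ : p + q = n) (_ : a ∈ Γ.gr p)
      (_ : b ∈ Λ.gr q) (hx : skewTmul Γ Λ a b ∈ _), motive (skewTmul Γ Λ a b) hx)
    (add : ∀ x y hx hy, motive x hx → motive y hy → motive (x + y) (add_mem hx hy))
    {x : Skew Γ Λ} (hx : x ∈ skewGr Γ Λ n) : motive x hx := by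
  have hx' : x ∈ Submodule.span ℂ {z | ∃ p q : ℕ, p + q = n ∧ ∃ x ∈ Γ.gr p, ∃ y ∈ Λ.gr q,
    z = skewTmul Γ Λ x y} := hx
  suffices h : ∃ hx, motive x hx from h.2
  clear hx
  induction hx' using Submodule.closure_induction with
  | zero => exact ⟨_, zero⟩
  | add x y _ _ hx hy =>
    obtain ⟨hx, hx'⟩ := hx
    obtain ⟨hy, hy'⟩ := hy
    exact ⟨_, add x y hx hy hx' hy'⟩
  | smul_mem r x h =>
    obtain ⟨p, q, rfl, a, ha, b, hb, rfl⟩ := h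
    rw [← skewTmul_smul_left]
    exact ⟨skewTmul_mem (Submodule.smul_mem _ r ha) hb,
      tmul p q _ b rfl (Submodule.smul_mem _ r ha) hb _⟩

lemma skewGr_mul {m n : ℕ} {x y : Skew Γ Λ} (hx : x ∈ skewGr Γ Λ m) (hy : y ∈ skewGr Γ Λ n) :
    x * y ∈ skewGr Γ Λ (m + n) := by
  induction hx using skewGr_induction with
  | zero => simp
  | add x x' _ _ hx hx' => rw [add_mul]; exact add_mem hx hx'
  | tmul p q a b hpq ha hb _ =>
    induction hy using skewGr_induction with
    | zero => simp
    | add y y' _ _ hy hy' => rw [mul_add]; exact add_mem hy hy'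
    | tmul p' q' a' b' hpq' ha' hb' _ =>
      rw [skewTmul_mul a hb ha' b']
      refine Submodule.smul_mem _ _ ?_
      have := skewTmul_mem (SetLike.GradedMul.mul_mem ha ha') (SetLike.GradedMul.mul_mem hb hb')
      rwa [show p + p' + (q + q') = m + n by omega] at this

lemma inl_mem_skewGr {n : ℕ} {a : Γ.carrier} (ha : a ∈ Γ.gr n) : inl Γ Λ a ∈ skewGr Γ Λ n :=
  skewTmul_mem (q := 0) ha Λ.one_mem_gr

lemma fib_mem_skewGr (h : C) : fib Γ Λ h ∈ skewGr Γ Λ 0 :=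
  skewTmul_mem (p := 0) (q := 0) Γ.one_mem_gr (Λ.of_mem h)

lemma skewOf_mem_skewGr (t : A ⊗[ℂ] C) : skewOf Γ Λ t ∈ skewGr Γ Λ 0 := by
  induction t with
  | zero => simp
  | add s t hs ht => rw [map_add]; exact add_mem hs ht
  | tmul a h => exact skewTmul_mem (p := 0) (q := 0) (Γ.of_mem a) (Λ.of_mem h)

lemma skewD_mem {n : ℕ} {x : Skew Γ Λ} (hx : x ∈ skewGr Γ Λ n) :
    skewD Γ Λ x ∈ skewGr Γ Λ (n + 1) := by
  induction hx using skewGr_induction with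
  | zero => simp
  | add x x' _ _ hx hx' => rw [map_add]; exact add_mem hx hx'
  | tmul p q a b hpq ha hb _ =>
    rw [skewD_tmul, Γ.parity_of_mem ha]
    refine add_mem ?_ ?_
    · have := skewTmul_mem (Γ.d_mem ha) hb
      rwa [show p + 1 + q = n + 1 by omega] at this
    · have := skewTmul_mem (Submodule.smul_mem _ ((-1 : ℂ) ^ p) ha) (Λ.d_mem hb)
      rwa [show p + (q + 1) = n + 1 by omega] at this

/-- The differential of `Γ(A) ⊗̂ Γ(C)` is a graded derivation. -/
lemma skewD_mul {n : ℕ} {x : Skew Γ Λ} (hx : x ∈ skewGr Γ Λ n) (y : Skew Γ Λ) :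
    skewD Γ Λ (x * y) = skewD Γ Λ x * y + (-1 : ℂ) ^ n • (x * skewD Γ Λ y) := by
  induction hx using skewGr_induction with
  | zero => simp
  | add x x' _ _ hx hx' =>
    rw [add_mul, map_add, hx, hx', map_add, add_mul, add_mul, smul_add]
    abel
  | tmul p q a b hpq ha hb _ =>
    induction y using skew_hom_induction with
    | zero => simp
    | add y y' hy hy' =>
      rw [mul_add, map_add, hy, hy', map_add, mul_add, mul_add, smul_add]
      abel
    | tmul p' q' a' b' ha' hb' =>
      rw [skewTmul_mul a hb ha' b', map_smul, skewD_tmul, skewD_tmul, skewD_tmul, add_mul, mul_add,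
        Γ.parity_of_mem (SetLike.GradedMul.mul_mem ha ha'), Γ.parity_of_mem ha,
        Γ.parity_of_mem ha', skewTmul_smul_left, skewTmul_smul_left, skewTmul_smul_left,
        smul_mul_assoc, mul_smul_comm,
        skewTmul_mul _ hb ha' b', skewTmul_mul _ (Λ.d_mem hb) ha' b',
        skewTmul_mul _ hb (Γ.d_mem ha'), skewTmul_mul _ hb ha' (Λ.d b'),
        Γ.leibniz ha, Λ.leibniz hb, skewTmul_add_left, skewTmul_add_right,
        skewTmul_smul_left, skewTmul_smul_right]
      subst hpq
      simp only [smul_add, smul_smul, ← pow_add]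
      -- Signs for the terms containing `db`, `da'` and `db'`. The outer two exponents agree as
      -- integers; the middle ones differ by `2q` and agree only modulo two.
      have e1 : p + (q + 1) * p' = q * p' + (p + p') := by ring
      have e2 : (-1 : ℂ) ^ (p + q + q * (p' + 1)) = (-1 : ℂ) ^ (q * p' + p) := by
        rw [show p + q + q * (p' + 1) = (q * p' + p) + 2 * q by ring, pow_add _ _ (2 * q), pow_mul]
        simp
      have e3 : p + q + (p' + q * p') = q * p' + (p + p' + q) := by ring
      rw [e1, e2, e3]
      abel

variable (Γ Λ) in
/-- The linear map with `x ↦ (-1)^n x` for `x` of total degree `n`. -/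
def parityLoc : Skew Γ Λ →ₗ[ℂ] Skew Γ Λ :=
  (skewEquiv Γ Λ).toLinearMap ∘ₗ TensorProduct.map Γ.parity Λ.parity ∘ₗ
    (skewEquiv Γ Λ).symm.toLinearMap

lemma parityLoc_tmul (a : Γ.carrier) (b : Λ.carrier) :
    parityLoc Γ Λ (skewTmul Γ Λ a b) = skewTmul Γ Λ (Γ.parity a) (Λ.parity b) := by
  simp [parityLoc, skewTmul]

lemma parityLoc_of_mem {n : ℕ} {x : Skew Γ Λ} (hx : x ∈ skewGr Γ Λ n) :
    parityLoc Γ Λ x = (-1 : ℂ) ^ n • x := by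
  induction hx using skewGr_induction with
  | zero => simp
  | add x x' _ _ hx hx' => rw [map_add, hx, hx', smul_add]
  | tmul p q a b hpq ha hb _ =>
    rw [parityLoc_tmul, Γ.parity_of_mem ha, Λ.parity_of_mem hb, skewTmul_smul_left,
      skewTmul_smul_right, smul_smul, ← pow_add, hpq]

lemma parityLoc_inl_mul_fib (a : Γ.carrier) (h : C) :
    parityLoc Γ Λ (inl Γ Λ a * fib Γ Λ h) = inl Γ Λ (Γ.parity a) * fib Γ Λ h := by
  rw [inl_mul_fib, parityLoc_tmul, Λ.parity_of_mem (Λ.of_mem h), pow_zero, one_smul, inl_mul_fib]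

lemma parityLoc_inl_mul {n : ℕ} {a : Γ.carrier} (ha : a ∈ Γ.gr n) (x : Skew Γ Λ) :
    parityLoc Γ Λ (inl Γ Λ a * x) = (-1 : ℂ) ^ n • (inl Γ Λ a * parityLoc Γ Λ x) := by
  induction x using skew_hom_induction with
  | zero => simp
  | add x y hx hy => simp only [map_add, mul_add, hx, hy, smul_add]
  | tmul i j a' b ha' _ =>
    rw [inl_mul_skewTmul, parityLoc_tmul, parityLoc_tmul, inl_mul_skewTmul,
      Γ.parity_of_mem (SetLike.GradedMul.mul_mem ha ha'), Γ.parity_of_mem ha', mul_smul_comm,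
      skewTmul_smul_left, skewTmul_smul_left, smul_smul, pow_add]

lemma skewD_inl (a : Γ.carrier) : skewD Γ Λ (inl Γ Λ a) = inl Γ Λ (Γ.d a) := by
  rw [inl_eq, skewD_tmul, Λ.d_one, inl_eq]
  simp [skewTmul]

lemma parity_one : Γ.parity 1 = 1 := by
  rw [Γ.parity_of_mem Γ.one_mem_gr, pow_zero, one_smul]

lemma skewD_inr (b : Λ.carrier) : skewD Γ Λ (inr Γ Λ b) = inr Γ Λ (Λ.d b) := by
  rw [inr_eq, skewD_tmul, Γ.d_one, inr_eq, parity_one]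
  simp [skewTmul]

lemma skewD_one : skewD Γ Λ 1 = 0 := by
  rw [← map_one (inl Γ Λ), skewD_inl, Γ.d_one, map_zero]

lemma skewD_inl_mul_fib (a : Γ.carrier) (h : C) :
    skewD Γ Λ (inl Γ Λ a * fib Γ Λ h) =
      inl Γ Λ (Γ.d a) * fib Γ Λ h + inl Γ Λ (Γ.parity a) * inr Γ Λ (Λ.d (Λ.of h)) := by
  rw [inl_mul_fib, skewD_tmul, inl_mul_fib, inl_mul_inr]

/-- The skew sign from moving the one-form `1 ⊗ dh` past `a`. It explains why the right formula `dγ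
+ ∑ ω(γ₁)γ₀` needs no factor `(-1)^n`. -/
lemma inr_d_mul_inl (a : Γ.carrier) (h : C) :
    inr Γ Λ (Λ.d (Λ.of h)) * inl Γ Λ a = inl Γ Λ (Γ.parity a) * inr Γ Λ (Λ.d (Λ.of h)) := by
  induction a using DirectSum.Decomposition.inductionOn Γ.gr with
  | zero => simp
  | add a a' ha ha' => simp only [map_add, mul_add, add_mul, ha, ha']
  | @homogeneous n a =>
    rw [inl_mul_inr, inr_eq, inl_eq, skewTmul_mul _ (Λ.d_mem (Λ.of_mem h)) a.2,
      Γ.parity_of_mem a.2, skewTmul_smul_left]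
    simp

/-! ### The vertical part -/

variable (Γ Λ) in
/-- The projection `1 - hor_c` onto the vertical part. -/
def vertC : Skew Γ Λ →ₗ[ℂ] Skew Γ Λ := LinearMap.id - horC Γ Λ

lemma vertC_tmul (a : Γ.carrier) (b : Λ.carrier) :
    vertC Γ Λ (skewTmul Γ Λ a b) = skewTmul Γ Λ a (b - Λ.projZero b) := by
  simp [vertC, horC, skewTmul, TensorProduct.tmul_sub]

lemma projZero_mem (b : Λ.carrier) : Λ.projZero b ∈ Λ.gr 0 := by
  simp [DifferentialCalculus.projZero, GradedAlgebra.proj_apply]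

lemma projZero_of_mem {b : Λ.carrier} (hb : b ∈ Λ.gr 0) : Λ.projZero b = b := by
  rw [DifferentialCalculus.projZero, GradedAlgebra.proj_apply,
    DirectSum.decompose_of_mem_same _ hb]

lemma projZero_of_mem_succ {n : ℕ} {b : Λ.carrier} (hb : b ∈ Λ.gr (n + 1)) :
    Λ.projZero b = 0 := by
  rw [DifferentialCalculus.projZero, GradedAlgebra.proj_apply,
    DirectSum.decompose_of_mem_ne _ hb (Nat.succ_ne_zero n)]

lemma projZero_of_mul (h : C) (b : Λ.carrier) :
    Λ.projZero (Λ.of h * b) = Λ.of h * Λ.projZero b := by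
  simp only [DifferentialCalculus.projZero, GradedAlgebra.proj_apply]
  exact DirectSum.coe_decompose_mul_of_left_mem_zero Λ.gr (Λ.of_mem h)

lemma projZero_mul_of (h : C) (b : Λ.carrier) :
    Λ.projZero (b * Λ.of h) = Λ.projZero b * Λ.of h := by
  simp only [DifferentialCalculus.projZero, GradedAlgebra.proj_apply]
  exact DirectSum.coe_decompose_mul_of_right_mem_zero Λ.gr (Λ.of_mem h)

lemma horC_mem (x : Skew Γ Λ) : horC Γ Λ x ∈ horLoc Γ Λ := by
  induction x using skew_hom_induction with
  | zero => simp
  | add x y hx hy => rw [map_add]; exact add_mem hx hy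
  | tmul i j a b _ _ =>
    have h : Λ.projZero b ∈ LinearMap.range Λ.of.toLinearMap := by
      rw [Λ.range_of]; exact projZero_mem b
    obtain ⟨c, hc⟩ := h
    refine (mem_horLoc _ _).2 ⟨a ⊗ₜ c, ?_⟩
    simp only [TensorProduct.map_tmul, hc]
    simp [horC, skewTmul]

/-- Replaces horizontality by a linear equation. It rests on the degree zero part of the second
factor being exactly the image of `Λ.of`. -/
lemma vertC_eq_zero_iff {x : Skew Γ Λ} : vertC Γ Λ x = 0 ↔ x ∈ horLoc Γ Λ := by
  constructor
  · intro h
    have h' : x = horC Γ Λ x := sub_eq_zero.1 h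
    rw [h']
    exact horC_mem x
  · intro hx
    induction hx using horLoc_induction with
    | zero => simp
    | add x y _ _ hx hy => rw [map_add, hx, hy, add_zero]
    | mul n a h ha _ =>
      rw [inl_mul_fib, vertC_tmul, projZero_of_mem (Λ.of_mem h), sub_self]
      simp [skewTmul]

lemma vertC_inr_d (h : C) : vertC Γ Λ (inr Γ Λ (Λ.d (Λ.of h))) = inr Γ Λ (Λ.d (Λ.of h)) := by
  rw [inr_eq, vertC_tmul, projZero_of_mem_succ (Λ.d_mem (Λ.of_mem h)), sub_zero]

lemma vertC_inl_mul (a : Γ.carrier) (x : Skew Γ Λ) :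
    vertC Γ Λ (inl Γ Λ a * x) = inl Γ Λ a * vertC Γ Λ x := by
  induction x using skew_hom_induction with
  | zero => simp
  | add x y hx hy => rw [mul_add, map_add, hx, hy, map_add, mul_add]
  | tmul i j a' b _ _ => rw [inl_mul_skewTmul, vertC_tmul, vertC_tmul, inl_mul_skewTmul]

lemma vertC_fib_mul (h : C) (x : Skew Γ Λ) :
    vertC Γ Λ (fib Γ Λ h * x) = fib Γ Λ h * vertC Γ Λ x := by
  induction x using skew_hom_induction with
  | zero => simp
  | add x y hx hy => rw [mul_add, map_add, hx, hy, map_add, mul_add]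
  | tmul i j a' b _ _ =>
    rw [fib_mul_skewTmul, vertC_tmul, vertC_tmul, fib_mul_skewTmul, projZero_of_mul, mul_sub]

lemma vertC_mul_fib (h : C) (x : Skew Γ Λ) :
    vertC Γ Λ (x * fib Γ Λ h) = vertC Γ Λ x * fib Γ Λ h := by
  induction x using skew_hom_induction with
  | zero => simp
  | add x y hx hy => rw [add_mul, map_add, hx, hy, map_add, add_mul]
  | tmul i j a' b _ _ =>
    rw [skewTmul_mul_fib, vertC_tmul, vertC_tmul, skewTmul_mul_fib, projZero_mul_of, sub_mul]

lemma vertC_mul_inl (a : Γ.carrier) (x : Skew Γ Λ) :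
    vertC Γ Λ (x * inl Γ Λ a) = vertC Γ Λ x * inl Γ Λ a := by
  induction a using DirectSum.Decomposition.inductionOn Γ.gr with
  | zero => simp
  | add a a' ha ha' => simp only [map_add, mul_add, ha, ha']
  | @homogeneous n a =>
    induction x using skew_hom_induction with
    | zero => simp
    | add x y hx hy => rw [add_mul, map_add, hx, hy, map_add, add_mul]
    | tmul i j a' b _ hb =>
      rw [inl_eq, skewTmul_mul a' hb a.2, map_smul, vertC_tmul, vertC_tmul, mul_one]
      -- The vertical projection is zero on tensors whose second factor has degree zero and the
      -- identity on those of positive degree; multiplying by `a ⊗ 1` leaves that degree unchanged.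
      rcases j with _ | j
      · rw [projZero_of_mem hb, sub_self]
        simp [skewTmul]
      · rw [projZero_of_mem_succ hb, sub_zero, skewTmul_mul a' hb a.2, mul_one]

end Skew


/-! ### The coaction on the local algebras -/

section CovariantLocal

variable {A : Type*} [Ring A] [Algebra ℂ A] {H : Type*} [Ring H] [HopfAlgebra ℂ H]
variable (Γ : DifferentialCalculus A) (Λ : RightCovariantCalculus H)

/-- The coaction on `Γ(A) ⊗̂ Γ(H)` as a homomorphism of algebras. -/
def coactLocHom : Skew Γ Λ.toDifferentialCalculus →ₐ[ℂ]
    Skew Γ Λ.toDifferentialCalculus ⊗[ℂ] H :=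
  AlgHom.ofLinearMap (coactLoc Γ Λ)
    (by simpa only [map_one] using coactLoc_algebraMap (Γ := Γ) (Λ := Λ) 1)
    coactLoc_mul

variable {Γ Λ}

local notation "Lc" => Skew Γ Λ.toDifferentialCalculus

lemma coactLoc_inl (a : Γ.carrier) :
    coactLoc Γ Λ (inl Γ Λ.toDifferentialCalculus a) = inl Γ Λ.toDifferentialCalculus a ⊗ₜ 1 := by
  rw [inl_eq, coactLoc_tmul, map_one, Algebra.TensorProduct.one_def, leftInsert_tmul]

lemma coactLoc_comp_fib :
    coactLoc Γ Λ ∘ₗ (fib Γ Λ.toDifferentialCalculus).toLinearMap =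
      LinearMap.rTensor H (fib Γ Λ.toDifferentialCalculus).toLinearMap ∘ₗ
        Coalgebra.comul (R := ℂ) := by
  ext h
  simp only [LinearMap.comp_apply, AlgHom.toLinearMap_apply]
  rw [fib_eq, coactLoc_tmul, Λ.coact_of]
  generalize Coalgebra.comul (R := ℂ) h = t
  induction t with
  | zero => simp
  | tmul x y => rfl
  | add s t hs ht => simp only [map_add, hs, ht]

lemma coactLoc_fib (h : H) :
    coactLoc Γ Λ (fib Γ Λ.toDifferentialCalculus h) =
      LinearMap.rTensor H (fib Γ Λ.toDifferentialCalculus).toLinearMap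
        (Coalgebra.comul (R := ℂ) h) :=
  LinearMap.congr_fun coactLoc_comp_fib h

lemma coactLoc_inr_d (h : H) :
    coactLoc Γ Λ (inr Γ Λ.toDifferentialCalculus (Λ.d (Λ.of h))) =
      LinearMap.rTensor H ((inr Γ Λ.toDifferentialCalculus).toLinearMap ∘ₗ Λ.d ∘ₗ
        Λ.of.toLinearMap) (Coalgebra.comul (R := ℂ) h) := by
  rw [inr_eq, coactLoc_tmul, Λ.coact_d_of]
  generalize Coalgebra.comul (R := ℂ) h = t
  induction t with
  | zero => simp
  | tmul x y => rfl
  | add s t hs ht => simp only [map_add, hs, ht]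

/-- The differential commutes with the coaction on horizontal elements. -/
lemma coactLoc_skewD {x : Lc} (hx : x ∈ horLoc Γ Λ.toDifferentialCalculus) :
    coactLoc Γ Λ (skewD Γ Λ.toDifferentialCalculus x) =
      LinearMap.rTensor H (skewD Γ Λ.toDifferentialCalculus) (coactLoc Γ Λ x) := by
  induction hx using horLoc_induction with
  | zero => simp
  | add x y _ _ hx hy => simp only [map_add, hx, hy]
  | mul n a h _ _ =>
    rw [skewD_inl_mul_fib, map_add, coactLoc_mul, coactLoc_mul, coactLoc_mul, coactLoc_inr_d,
      coactLoc_fib, coactLoc_inl, coactLoc_inl, coactLoc_inl]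
    generalize Coalgebra.comul (R := ℂ) h = t
    induction t with
    | zero => simp
    | tmul x y =>
      simp only [LinearMap.rTensor_tmul, AlgHom.toLinearMap_apply, LinearMap.comp_apply,
        Algebra.TensorProduct.tmul_mul_tmul, one_mul, skewD_inl_mul_fib, TensorProduct.add_tmul]
    | add s t hs ht =>
      simp only [map_add, mul_add] at *
      rw [← hs, ← ht]
      abel

lemma coactLoc_parityLoc {x : Lc} (hx : x ∈ horLoc Γ Λ.toDifferentialCalculus) :
    coactLoc Γ Λ (parityLoc Γ Λ.toDifferentialCalculus x) =
      LinearMap.rTensor H (parityLoc Γ Λ.toDifferentialCalculus) (coactLoc Γ Λ x) := by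
  induction hx using horLoc_induction with
  | zero => simp
  | add x y _ _ hx hy => simp only [map_add, hx, hy]
  | mul n a h _ _ =>
    rw [parityLoc_inl_mul_fib, coactLoc_mul, coactLoc_mul, coactLoc_fib, coactLoc_inl, coactLoc_inl]
    generalize Coalgebra.comul (R := ℂ) h = t
    induction t with
    | zero => simp
    | tmul x y =>
      simp only [LinearMap.rTensor_tmul, AlgHom.toLinearMap_apply,
        Algebra.TensorProduct.tmul_mul_tmul, one_mul, parityLoc_inl_mul_fib]
    | add s t hs ht => simp only [map_add, mul_add, hs, ht]

lemma parityLoc_mem_horLoc {x : Lc} (hx : x ∈ horLoc Γ Λ.toDifferentialCalculus) :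
    parityLoc Γ Λ.toDifferentialCalculus x ∈ horLoc Γ Λ.toDifferentialCalculus := by
  induction hx using horLoc_induction with
  | zero => simp
  | add x y _ _ hx hy => rw [map_add]; exact add_mem hx hy
  | mul n a h _ _ =>
    rw [parityLoc_inl_mul_fib]
    exact mul_mem (inl_mem_horLoc _) (fib_mem_horLoc _)

/-! ### Convolution with a form -/

/-- The map `x ↦ ∑ x₀ ω(x₁)`. -/
def convLoc (ω : H →ₗ[ℂ] Lc) : Lc →ₗ[ℂ] Lc :=
  LinearMap.mul' ℂ _ ∘ₗ LinearMap.lTensor _ ω ∘ₗ coactLoc Γ Λ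

/-- The map `x ↦ ∑ ω(x₁) x₀`. -/
def convOpLoc (ω : H →ₗ[ℂ] Lc) : Lc →ₗ[ℂ] Lc :=
  LinearMap.mul' ℂ _ ∘ₗ (TensorProduct.comm ℂ Lc Lc).toLinearMap ∘ₗ
    LinearMap.lTensor _ ω ∘ₗ coactLoc Γ Λ

/-- The element `a ⊗ 1` is coinvariant, so it passes through the coaction. Hence on horizontal
elements `convLoc ω` is determined by the convolution of `h ↦ 1 ⊗ h` with `ω`. -/
lemma convLoc_inl_mul (ω : H →ₗ[ℂ] Lc) (a : Γ.carrier) (x : Lc) :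
    convLoc ω (inl Γ Λ.toDifferentialCalculus a * x) =
      inl Γ Λ.toDifferentialCalculus a * convLoc ω x := by
  simp only [convLoc, LinearMap.comp_apply, coactLoc_mul, coactLoc_inl]
  generalize coactLoc Γ Λ x = t
  induction t with
  | zero => simp
  | tmul x y => simp [mul_assoc]
  | add s t hs ht => simp only [map_add, mul_add, hs, ht]

lemma convOpLoc_mul_inl (ω : H →ₗ[ℂ] Lc) (a : Γ.carrier) (x : Lc) :
    convOpLoc ω (x * inl Γ Λ.toDifferentialCalculus a) =
      convOpLoc ω x * inl Γ Λ.toDifferentialCalculus a := by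
  simp only [convOpLoc, LinearMap.comp_apply, coactLoc_mul, coactLoc_inl]
  generalize coactLoc Γ Λ x = t
  induction t with
  | zero => simp
  | tmul x y => simp [mul_assoc]
  | add s t hs ht => simp only [map_add, add_mul, hs, ht]

lemma convLoc_fib (ω : H →ₗ[ℂ] Lc) (h : H) :
    convLoc ω (fib Γ Λ.toDifferentialCalculus h) =
      conv (fib Γ Λ.toDifferentialCalculus).toLinearMap ω h := by
  simp only [convLoc, conv, LinearMap.comp_apply, coactLoc_fib]
  rw [← LinearMap.comp_apply (LinearMap.lTensor _ ω), LinearMap.lTensor_comp_rTensor]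

lemma convOpLoc_fib (ω : H →ₗ[ℂ] Lc) (h : H) :
    convOpLoc ω (fib Γ Λ.toDifferentialCalculus h) =
      convOp (fib Γ Λ.toDifferentialCalculus).toLinearMap ω h := by
  simp only [convOpLoc, convOp, LinearMap.comp_apply, coactLoc_fib]
  rw [← LinearMap.comp_apply (LinearMap.lTensor _ ω), LinearMap.lTensor_comp_rTensor]

lemma convLoc_inl_mul_fib (ω : H →ₗ[ℂ] Lc) (a : Γ.carrier) (h : H) :
    convLoc ω (inl Γ Λ.toDifferentialCalculus a * fib Γ Λ.toDifferentialCalculus h) =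
      inl Γ Λ.toDifferentialCalculus a *
        conv (fib Γ Λ.toDifferentialCalculus).toLinearMap ω h := by
  rw [convLoc_inl_mul, convLoc_fib]

lemma convOpLoc_inl_mul_fib (ω : H →ₗ[ℂ] Lc) (a : Γ.carrier) (h : H) :
    convOpLoc ω (inl Γ Λ.toDifferentialCalculus a * fib Γ Λ.toDifferentialCalculus h) =
      convOp (fib Γ Λ.toDifferentialCalculus).toLinearMap ω h *
        inl Γ Λ.toDifferentialCalculus a := by
  rw [← fib_mul_inl, convOpLoc_mul_inl, convOpLoc_fib]

lemma convLoc_one {ω : H →ₗ[ℂ] Lc} (hω : ω 1 = 0) : convLoc ω 1 = 0 := by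
  rw [← map_one (fib Γ Λ.toDifferentialCalculus), convLoc_fib]
  simp [conv, Algebra.TensorProduct.one_def, hω]

lemma convOpLoc_one {ω : H →ₗ[ℂ] Lc} (hω : ω 1 = 0) : convOpLoc ω 1 = 0 := by
  rw [← map_one (fib Γ Λ.toDifferentialCalculus), convOpLoc_fib]
  simp [convOp, Algebra.TensorProduct.one_def, hω]

/-- The coaction on `Γ(A) ⊗̂ Γ(H)` preserves degrees. -/
lemma coactLoc_mem_skewGr {n : ℕ} {x : Lc} (hx : x ∈ skewGr Γ Λ.toDifferentialCalculus n) :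
    coactLoc Γ Λ x ∈ LinearMap.range
      (LinearMap.rTensor H (skewGr Γ Λ.toDifferentialCalculus n).subtype) := by
  induction hx using skewGr_induction with
  | zero => simp
  | add x y _ _ hx hy => rw [map_add]; exact add_mem hx hy
  | tmul p q a b hpq ha hb _ =>
    rw [coactLoc_tmul]
    obtain ⟨t, ht⟩ := coact_mem hb
    rw [← ht]
    clear ht
    induction t with
    | zero => simp
    | tmul y h => exact ⟨⟨_, hpq ▸ skewTmul_mem ha y.2⟩ ⊗ₜ h, rfl⟩
    | add s t hs ht => rw [map_add, map_add]; exact add_mem hs ht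

lemma convLoc_mem_skewGr {m n : ℕ} {ω : H →ₗ[ℂ] Lc}
    (hω : ∀ h, ω h ∈ skewGr Γ Λ.toDifferentialCalculus m) {x : Lc}
    (hx : x ∈ skewGr Γ Λ.toDifferentialCalculus n) :
    convLoc ω x ∈ skewGr Γ Λ.toDifferentialCalculus (n + m) := by
  obtain ⟨t, ht⟩ := coactLoc_mem_skewGr hx
  simp only [convLoc, LinearMap.comp_apply, ← ht]
  clear ht
  induction t with
  | zero => simp
  | tmul y h => simpa using skewGr_mul y.2 (hω h)
  | add s t hs ht => simp only [map_add]; exact add_mem hs ht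

lemma convOpLoc_mem_skewGr {m n : ℕ} {ω : H →ₗ[ℂ] Lc}
    (hω : ∀ h, ω h ∈ skewGr Γ Λ.toDifferentialCalculus m) {x : Lc}
    (hx : x ∈ skewGr Γ Λ.toDifferentialCalculus n) :
    convOpLoc ω x ∈ skewGr Γ Λ.toDifferentialCalculus (n + m) := by
  obtain ⟨t, ht⟩ := coactLoc_mem_skewGr hx
  simp only [convOpLoc, LinearMap.comp_apply, ← ht]
  clear ht
  induction t with
  | zero => simp
  | tmul y h => simpa [add_comm n m] using skewGr_mul (hω h) y.2
  | add s t hs ht => simp only [map_add]; exact add_mem hs ht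

/-! ### Covariance of the convolution with a form -/

lemma coactLoc_comp_conv (f g : H →ₗ[ℂ] Lc) :
    coactLoc Γ Λ ∘ₗ conv f g = conv (coactLoc Γ Λ ∘ₗ f) (coactLoc Γ Λ ∘ₗ g) :=
  comp_conv (coactLocHom Γ Λ) f g

lemma coactLoc_comp_convOp (f g : H →ₗ[ℂ] Lc) :
    coactLoc Γ Λ ∘ₗ convOp f g = convOp (coactLoc Γ Λ ∘ₗ f) (coactLoc Γ Λ ∘ₗ g) :=
  comp_convOp (coactLocHom Γ Λ) f g

/-- A form `ω` is equivariant for the left adjoint coaction if and only if its convolution with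
`h ↦ 1 ⊗ h` is equivariant for the comultiplication. -/
lemma coactLoc_comp_eq_adL_iff (ω : H →ₗ[ℂ] Lc) :
    coactLoc Γ Λ ∘ₗ ω = LinearMap.rTensor H ω ∘ₗ adL H ↔
      coactLoc Γ Λ ∘ₗ conv (fib Γ Λ.toDifferentialCalculus).toLinearMap ω =
        LinearMap.rTensor H (conv (fib Γ Λ.toDifferentialCalculus).toLinearMap ω) ∘ₗ
          Coalgebra.comul (R := ℂ) := by
  -- Both sides of the second equation become convolutions with the same left factor `coactLoc ∘
  -- fib`. This is an algebra homomorphism, so it cancels.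
  rw [← conv_rTensor_adL, ← coactLoc_comp_fib, coactLoc_comp_conv]
  exact (conv_left_injective
    ((coactLocHom Γ Λ).comp (fib Γ Λ.toDifferentialCalculus))).eq_iff.symm

lemma coactLoc_comp_eq_adR_iff (hS : Function.Bijective (HopfAlgebra.antipode ℂ : H →ₗ[ℂ] H))
    (ω : H →ₗ[ℂ] Lc) :
    coactLoc Γ Λ ∘ₗ ω = LinearMap.rTensor H ω ∘ₗ adR H hS ↔
      coactLoc Γ Λ ∘ₗ convOp (fib Γ Λ.toDifferentialCalculus).toLinearMap ω =
        LinearMap.rTensor H (convOp (fib Γ Λ.toDifferentialCalculus).toLinearMap ω) ∘ₗ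
          Coalgebra.comul (R := ℂ) := by
  rw [← convOp_rTensor_adR hS, ← coactLoc_comp_fib, coactLoc_comp_convOp]
  exact (convOp_left_injective hS
    ((coactLocHom Γ Λ).comp (fib Γ Λ.toDifferentialCalculus))).eq_iff.symm

/-- On `a ⊗ h` the coinvariant `a` factors out, and what remains is the convolution of `h ↦ 1 ⊗ h`
with `ω`, which intertwines the coaction with `Δ`. -/
lemma coactLoc_convLoc {ω : H →ₗ[ℂ] Lc}
    (hω : ∀ h, coactLoc Γ Λ (ω h) = LinearMap.rTensor H ω (adL H h)) {x : Lc}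
    (hx : x ∈ horLoc Γ Λ.toDifferentialCalculus) :
    coactLoc Γ Λ (convLoc ω x) = LinearMap.rTensor H (convLoc ω) (coactLoc Γ Λ x) := by
  have key := (coactLoc_comp_eq_adL_iff ω).1 (LinearMap.ext hω)
  induction hx using horLoc_induction with
  | zero => simp
  | add x y _ _ hx hy => simp only [map_add, hx, hy]
  | mul n a h _ _ =>
    rw [convLoc_inl_mul_fib, coactLoc_mul, coactLoc_mul, coactLoc_inl, coactLoc_fib]
    refine (congrArg _ (LinearMap.congr_fun key h)).trans ?_
    rw [LinearMap.comp_apply]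
    generalize Coalgebra.comul (R := ℂ) h = t
    induction t with
    | zero => simp
    | tmul x y =>
      simp only [LinearMap.rTensor_tmul, AlgHom.toLinearMap_apply,
        Algebra.TensorProduct.tmul_mul_tmul, one_mul, convLoc_inl_mul_fib]
    | add s t hs ht => simp only [map_add, mul_add, hs, ht]

lemma coactLoc_convOpLoc {hS : Function.Bijective (HopfAlgebra.antipode ℂ : H →ₗ[ℂ] H)}
    {ω : H →ₗ[ℂ] Lc}
    (hω : ∀ h, coactLoc Γ Λ (ω h) = LinearMap.rTensor H ω (adR H hS h)) {x : Lc}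
    (hx : x ∈ horLoc Γ Λ.toDifferentialCalculus) :
    coactLoc Γ Λ (convOpLoc ω x) = LinearMap.rTensor H (convOpLoc ω) (coactLoc Γ Λ x) := by
  have key := (coactLoc_comp_eq_adR_iff hS ω).1 (LinearMap.ext hω)
  induction hx using horLoc_induction with
  | zero => simp
  | add x y _ _ hx hy => simp only [map_add, hx, hy]
  | mul n a h _ _ =>
    rw [convOpLoc_inl_mul_fib, coactLoc_mul, coactLoc_mul, coactLoc_inl, coactLoc_fib]
    refine (congrArg (· * _) (LinearMap.congr_fun key h)).trans ?_
    rw [LinearMap.comp_apply]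
    generalize Coalgebra.comul (R := ℂ) h = t
    induction t with
    | zero => simp
    | tmul x y =>
      simp only [LinearMap.rTensor_tmul, AlgHom.toLinearMap_apply,
        Algebra.TensorProduct.tmul_mul_tmul, one_mul, mul_one, convOpLoc_inl_mul_fib]
    | add s t hs ht => simp only [map_add, mul_add, add_mul, hs, ht]

/-! ### The vertical part of the convolution with a form -/

/-- The map `h ↦ 1 ⊗ dh`. -/
def fibD : H →ₗ[ℂ] Lc := (inr Γ Λ.toDifferentialCalculus).toLinearMap ∘ₗ Λ.d ∘ₗ Λ.of.toLinearMap

lemma vertC_comp_conv (f : H →ₗ[ℂ] Lc) (T : H →ₗ[ℂ] H) :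
    vertC Γ Λ.toDifferentialCalculus ∘ₗ
        conv ((fib Γ Λ.toDifferentialCalculus).toLinearMap ∘ₗ T) f =
      conv ((fib Γ Λ.toDifferentialCalculus).toLinearMap ∘ₗ T)
        (vertC Γ Λ.toDifferentialCalculus ∘ₗ f) := by
  ext h
  refine comp_conv_of_mul (f := (fib Γ Λ.toDifferentialCalculus).toLinearMap ∘ₗ T) (g := f)
    (f' := (fib Γ Λ.toDifferentialCalculus).toLinearMap ∘ₗ T)
    (g' := vertC Γ Λ.toDifferentialCalculus ∘ₗ f) (vertC Γ Λ.toDifferentialCalculus)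
    LinearMap.id (fun x y => ?_) h
  simp only [LinearMap.comp_apply, AlgHom.toLinearMap_apply, LinearMap.id_apply]
  exact vertC_fib_mul (T x) (f y)

lemma vertC_comp_convOp (f : H →ₗ[ℂ] Lc) (T : H →ₗ[ℂ] H) :
    vertC Γ Λ.toDifferentialCalculus ∘ₗ
        convOp ((fib Γ Λ.toDifferentialCalculus).toLinearMap ∘ₗ T) f =
      convOp ((fib Γ Λ.toDifferentialCalculus).toLinearMap ∘ₗ T)
        (vertC Γ Λ.toDifferentialCalculus ∘ₗ f) := by
  ext h
  refine comp_convOp_of_mul (f := (fib Γ Λ.toDifferentialCalculus).toLinearMap ∘ₗ T) (g := f)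
    (f' := (fib Γ Λ.toDifferentialCalculus).toLinearMap ∘ₗ T)
    (g' := vertC Γ Λ.toDifferentialCalculus ∘ₗ f) (vertC Γ Λ.toDifferentialCalculus)
    LinearMap.id (fun x y => ?_) h
  simp only [LinearMap.comp_apply, AlgHom.toLinearMap_apply, LinearMap.id_apply]
  exact vertC_mul_fib (T x) (f y)

lemma inr_comp_vertL :
    (inr Γ Λ.toDifferentialCalculus).toLinearMap ∘ₗ vertL Λ =
      conv ((fib Γ Λ.toDifferentialCalculus).toLinearMap ∘ₗ HopfAlgebra.antipode ℂ) fibD :=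
  comp_conv _ _ _

lemma inr_comp_vertR (hS : Function.Bijective (HopfAlgebra.antipode ℂ : H →ₗ[ℂ] H)) :
    (inr Γ Λ.toDifferentialCalculus).toLinearMap ∘ₗ vertR Λ hS =
      convOp ((fib Γ Λ.toDifferentialCalculus).toLinearMap ∘ₗ antipodeInv H hS) fibD :=
  comp_convOp _ _ _

/-- The vertical part of a form `ω` is `-∑ 1 ⊗ S(h₁)dh₂` if and only if the vertical part of its
convolution with `h ↦ 1 ⊗ h` is `-1 ⊗ dh`. -/
lemma vertC_comp_eq_vertL_iff (ω : H →ₗ[ℂ] Lc) :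
    vertC Γ Λ.toDifferentialCalculus ∘ₗ ω =
        -((inr Γ Λ.toDifferentialCalculus).toLinearMap ∘ₗ vertL Λ) ↔
      vertC Γ Λ.toDifferentialCalculus ∘ₗ conv (fib Γ Λ.toDifferentialCalculus).toLinearMap ω =
        -fibD := by
  have h1 := vertC_comp_conv ω LinearMap.id
  rw [LinearMap.comp_id] at h1
  -- Convolving `∑ S(h₁)dh₂` with `h ↦ 1 ⊗ h` returns `1 ⊗ dh`. Negatives are written as `0 - ·` so
  -- that `conv_sub` and `conv_zero` apply.
  rw [h1, inr_comp_vertL, ← (conv_left_injective (fib Γ Λ.toDifferentialCalculus)).eq_iff,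
    ← zero_sub, ← zero_sub fibD, conv_sub, conv_zero, conv_cancel_antipode]

lemma vertC_comp_eq_vertR_iff (hS : Function.Bijective (HopfAlgebra.antipode ℂ : H →ₗ[ℂ] H))
    (ω : H →ₗ[ℂ] Lc) :
    vertC Γ Λ.toDifferentialCalculus ∘ₗ ω =
        -((inr Γ Λ.toDifferentialCalculus).toLinearMap ∘ₗ vertR Λ hS) ↔
      vertC Γ Λ.toDifferentialCalculus ∘ₗ convOp (fib Γ Λ.toDifferentialCalculus).toLinearMap ω =
        -fibD := by
  have h1 := vertC_comp_convOp ω LinearMap.id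
  rw [LinearMap.comp_id] at h1
  rw [h1, inr_comp_vertR hS, ← (convOp_left_injective hS (fib Γ Λ.toDifferentialCalculus)).eq_iff,
    ← zero_sub, ← zero_sub fibD, convOp_sub, convOp_zero, convOp_cancel_antipodeInv]

lemma vertC_skewD_inl_mul_fib (a : Γ.carrier) (h : H) :
    vertC Γ Λ.toDifferentialCalculus (skewD Γ Λ.toDifferentialCalculus
        (inl Γ Λ.toDifferentialCalculus a * fib Γ Λ.toDifferentialCalculus h)) =
      inl Γ Λ.toDifferentialCalculus (Γ.parity a) * fibD h := by
  rw [skewD_inl_mul_fib, map_add, vertC_eq_zero_iff.2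
    (mul_mem (inl_mem_horLoc _) (fib_mem_horLoc _)), vertC_inl_mul, vertC_inr_d, zero_add]
  rfl

/-- For `a` of degree `n`, the vertical part of `d(a ⊗ h)` is `(-1)^n a ⊗ dh`, and the convolution
term contributes its negative. -/
lemma skewD_add_convLoc_mem_horLoc {ω : H →ₗ[ℂ] Lc}
    (hω : ∀ h, vertC Γ Λ.toDifferentialCalculus (ω h) =
      -inr Γ Λ.toDifferentialCalculus (vertL Λ h)) {x : Lc}
    (hx : x ∈ horLoc Γ Λ.toDifferentialCalculus) :
    skewD Γ Λ.toDifferentialCalculus x + convLoc ω (parityLoc Γ Λ.toDifferentialCalculus x) ∈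
      horLoc Γ Λ.toDifferentialCalculus := by
  have key := (vertC_comp_eq_vertL_iff ω).1 (LinearMap.ext hω)
  induction hx using horLoc_induction with
  | zero => simp
  | add x y _ _ hx hy =>
    simp only [map_add]
    convert add_mem hx hy using 1
    abel
  | mul n a h _ _ =>
    rw [← vertC_eq_zero_iff, map_add, vertC_skewD_inl_mul_fib, parityLoc_inl_mul_fib,
      convLoc_inl_mul_fib, vertC_inl_mul]
    refine (congrArg (fun z => _ + _ * z) (LinearMap.congr_fun key h)).trans ?_
    simp

/-- Here the convolution term contributes `-(1 ⊗ dh)(a ⊗ 1)`. Moving `a` to the left creates the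
sign that `parityLoc` supplies in the left case. -/
lemma skewD_add_convOpLoc_mem_horLoc
    {hS : Function.Bijective (HopfAlgebra.antipode ℂ : H →ₗ[ℂ] H)} {ω : H →ₗ[ℂ] Lc}
    (hω : ∀ h, vertC Γ Λ.toDifferentialCalculus (ω h) =
      -inr Γ Λ.toDifferentialCalculus (vertR Λ hS h)) {x : Lc}
    (hx : x ∈ horLoc Γ Λ.toDifferentialCalculus) :
    skewD Γ Λ.toDifferentialCalculus x + convOpLoc ω x ∈
      horLoc Γ Λ.toDifferentialCalculus := by
  have key := (vertC_comp_eq_vertR_iff hS ω).1 (LinearMap.ext hω)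
  induction hx using horLoc_induction with
  | zero => simp
  | add x y _ _ hx hy =>
    simp only [map_add]
    convert add_mem hx hy using 1
    abel
  | mul n a h _ _ =>
    rw [← vertC_eq_zero_iff, map_add, vertC_skewD_inl_mul_fib, convOpLoc_inl_mul_fib,
      vertC_mul_inl]
    refine (congrArg (fun z => _ + z * _) (LinearMap.congr_fun key h)).trans ?_
    simp [fibD, inr_d_mul_inl]

end CovariantLocal

/-! ### Lifting along surjections -/

/-- Used to map both local algebras to the common quotient of `Γ(P)` by the sum of the two kernels.
-/
lemma exists_algHom_lift {R S T : Type*} [Ring R] [Algebra ℂ R] [Ring S] [Algebra ℂ S] [Ring T]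
    [Algebra ℂ T] (f : R →ₐ[ℂ] S) (hf : Function.Surjective f) (g : R →ₐ[ℂ] T)
    (h : ∀ x, f x = 0 → g x = 0) : ∃ k : S →ₐ[ℂ] T, ∀ x, k (f x) = g x := by
  have hlift : ∀ x, g (Function.surjInv hf (f x)) = g x := fun x => by
    rw [← sub_eq_zero, ← map_sub]
    exact h _ (by rw [map_sub, Function.surjInv_eq hf, sub_self])
  refine ⟨AlgHom.ofLinearMap
    { toFun := fun y => g (Function.surjInv hf y)
      map_add' := fun x y => ?_
      map_smul' := fun r x => ?_ } ?_ fun x y => ?_, hlift⟩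
  · obtain ⟨x, rfl⟩ := hf x
    obtain ⟨y, rfl⟩ := hf y
    rw [← map_add, hlift, hlift, hlift, map_add]
  · obtain ⟨x, rfl⟩ := hf x
    rw [← map_smul, hlift, hlift, map_smul, RingHom.id_apply]
  · change g (Function.surjInv hf 1) = 1
    rw [← map_one f, hlift, map_one]
  · obtain ⟨x, rfl⟩ := hf x
    obtain ⟨y, rfl⟩ := hf y
    change g (Function.surjInv hf _) = g (Function.surjInv hf _) * g (Function.surjInv hf _)
    rw [← map_mul, hlift, hlift, hlift, map_mul]

instance isTwoSided_sup {R : Type*} [Ring R] (K L : Ideal R) [K.IsTwoSided] [L.IsTwoSided] :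
    (K ⊔ L).IsTwoSided where
  mul_mem_of_left {a} b ha := by
    obtain ⟨x, hx, y, hy, rfl⟩ := Submodule.mem_sup.1 ha
    rw [add_mul]
    exact Submodule.add_mem_sup (Ideal.mul_mem_right b K hx) (Ideal.mul_mem_right b L hy)

/-! ### Compatibility of local maps in a common quotient -/

section Glueing

variable {H P R L₁ L₂ : Type*} [Ring H] [HopfAlgebra ℂ H] [Ring P] [Algebra ℂ P] [Ring R]
  [Algebra ℂ R] [Ring L₁] [Algebra ℂ L₁] [Ring L₂] [Algebra ℂ L₂]

lemma map_sub_right {A V : Type*} [Ring A] [Algebra ℂ A] [AddCommGroup V] [Module ℂ V]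
    (μ : A ⊗[ℂ] A →ₗ[ℂ] V) (f : P →ₗ[ℂ] A) (g g' : H →ₗ[ℂ] A) (t : P ⊗[ℂ] H) :
    μ (TensorProduct.map f (g - g') t) =
      μ (TensorProduct.map f g t) - μ (TensorProduct.map f g' t) := by
  induction t with
  | zero => simp
  | tmul x y => simp [TensorProduct.tmul_sub]
  | add s t hs ht => simp only [map_add, hs, ht]; abel

/-- Linear maps from `H` to two quotients of an algebra `R` are compatible if their convolutions
with the elements of a comodule `P` over `R` are. -/
lemma compatible_of_mul {o : P →ₐ[ℂ] R} {δ : P →ₗ[ℂ] P ⊗[ℂ] H} {χ₁ : R →ₐ[ℂ] L₁} {χ₂ : R →ₐ[ℂ] L₂}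
    (h₁ : Function.Surjective χ₁) (h₂ : Function.Surjective χ₂) (j : H →ₐ[ℂ] L₁)
    (hj : ∀ h, ∃ p, LinearMap.rTensor H (χ₁.comp o).toLinearMap (δ p) =
      LinearMap.rTensor H j.toLinearMap (Coalgebra.comul (R := ℂ) h))
    {ω₁ : H →ₗ[ℂ] L₁} {ω₂ : H →ₗ[ℂ] L₂}
    (hω : ∀ p, ∃ x y,
      χ₁ x = LinearMap.mul' ℂ L₁ (TensorProduct.map (χ₁.comp o).toLinearMap ω₁ (δ p)) ∧
      χ₂ y = LinearMap.mul' ℂ L₂ (TensorProduct.map (χ₂.comp o).toLinearMap ω₂ (δ p)) ∧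
      x - y ∈ RingHom.ker χ₁ ⊔ RingHom.ker χ₂) (h : H) :
    ∃ x y, χ₁ x = ω₁ h ∧ χ₂ y = ω₂ h ∧ x - y ∈ RingHom.ker χ₁ ⊔ RingHom.ker χ₂ := by
  set K := RingHom.ker χ₁ ⊔ RingHom.ker χ₂ with hK
  let q := Ideal.Quotient.mkₐ ℂ K
  obtain ⟨q₁, hq₁⟩ := exists_algHom_lift χ₁ h₁ q fun x hx =>
    Ideal.Quotient.eq_zero_iff_mem.2 (Submodule.mem_sup_left hx)
  obtain ⟨q₂, hq₂⟩ := exists_algHom_lift χ₂ h₂ q fun x hx =>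
    Ideal.Quotient.eq_zero_iff_mem.2 (Submodule.mem_sup_right hx)
  -- The obstruction to compatibility: `ω₁ h` and `ω₂ h` are compatible exactly when `ε h = 0`.
  set ε := q₁.toLinearMap ∘ₗ ω₁ - q₂.toLinearMap ∘ₗ ω₂ with hε
  -- By `hω`, the two convolutions with `p` have the same image in the quotient, so `∑ q(p₀)ε(p₁) =
  -- 0`.
  have hzero : ∀ p, LinearMap.mul' ℂ _ (TensorProduct.map (q.comp o).toLinearMap ε (δ p)) = 0 := by
    intro p
    obtain ⟨x, y, hx, hy, hxy⟩ := hω p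
    have e : q x = q y := Ideal.Quotient.eq.2 hxy
    rw [hε, map_sub_right, sub_eq_zero]
    convert e using 1
    · rw [← hq₁, hx]
      generalize δ p = t
      induction t with
      | zero => simp
      | tmul x y => simp [hq₁]
      | add s t hs ht => simp only [map_add, hs, ht]
    · rw [← hq₂, hy]
      generalize δ p = t
      induction t with
      | zero => simp
      | tmul x y => simp [hq₂]
      | add s t hs ht => simp only [map_add, hs, ht]
  -- The map `q` restricted to `P` factors through `χ₁`, so only the first local image of `p`
  -- matters; by `hj` it can be made to coact like `h`.
  have hconv : conv (q₁.comp j).toLinearMap ε = 0 := by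
    ext h
    obtain ⟨p, hp⟩ := hj h
    rw [LinearMap.zero_apply, ← hzero p]
    calc conv (q₁.comp j).toLinearMap ε h
        = LinearMap.mul' ℂ _ (TensorProduct.map q₁.toLinearMap ε
            (LinearMap.rTensor H j.toLinearMap (Coalgebra.comul (R := ℂ) h))) := by
          rw [← LinearMap.comp_apply (TensorProduct.map _ _), LinearMap.map_comp_rTensor]
          rfl
      _ = _ := by
          rw [← hp, ← LinearMap.comp_apply (TensorProduct.map _ _), LinearMap.map_comp_rTensor]
          congr 3
          ext x
          exact hq₁ (o x)
  have hε0 : ε = 0 := conv_left_injective _ (hconv.trans (conv_zero _).symm)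
  obtain ⟨x, hx⟩ := h₁ (ω₁ h)
  obtain ⟨y, hy⟩ := h₂ (ω₂ h)
  refine ⟨x, y, hx, hy, Ideal.Quotient.eq.1 ?_⟩
  change q x = q y
  rw [← hq₁, ← hq₂, hx, hy, ← sub_eq_zero]
  exact LinearMap.congr_fun hε0 h

lemma compatible_of_mul_op (hS : Function.Bijective (HopfAlgebra.antipode ℂ : H →ₗ[ℂ] H))
    {o : P →ₐ[ℂ] R} {δ : P →ₗ[ℂ] P ⊗[ℂ] H} {χ₁ : R →ₐ[ℂ] L₁} {χ₂ : R →ₐ[ℂ] L₂}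
    (h₁ : Function.Surjective χ₁) (h₂ : Function.Surjective χ₂) (j : H →ₐ[ℂ] L₁)
    (hj : ∀ h, ∃ p, LinearMap.rTensor H (χ₁.comp o).toLinearMap (δ p) =
      LinearMap.rTensor H j.toLinearMap (Coalgebra.comul (R := ℂ) h))
    {ω₁ : H →ₗ[ℂ] L₁} {ω₂ : H →ₗ[ℂ] L₂}
    (hω : ∀ p, ∃ x y,
      χ₁ x = LinearMap.mul' ℂ L₁ (TensorProduct.comm ℂ L₁ L₁
        (TensorProduct.map (χ₁.comp o).toLinearMap ω₁ (δ p))) ∧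
      χ₂ y = LinearMap.mul' ℂ L₂ (TensorProduct.comm ℂ L₂ L₂
        (TensorProduct.map (χ₂.comp o).toLinearMap ω₂ (δ p))) ∧
      x - y ∈ RingHom.ker χ₁ ⊔ RingHom.ker χ₂) (h : H) :
    ∃ x y, χ₁ x = ω₁ h ∧ χ₂ y = ω₂ h ∧ x - y ∈ RingHom.ker χ₁ ⊔ RingHom.ker χ₂ := by
  set K := RingHom.ker χ₁ ⊔ RingHom.ker χ₂ with hK
  let q := Ideal.Quotient.mkₐ ℂ K
  obtain ⟨q₁, hq₁⟩ := exists_algHom_lift χ₁ h₁ q fun x hx =>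
    Ideal.Quotient.eq_zero_iff_mem.2 (Submodule.mem_sup_left hx)
  obtain ⟨q₂, hq₂⟩ := exists_algHom_lift χ₂ h₂ q fun x hx =>
    Ideal.Quotient.eq_zero_iff_mem.2 (Submodule.mem_sup_right hx)
  set ε := q₁.toLinearMap ∘ₗ ω₁ - q₂.toLinearMap ∘ₗ ω₂ with hε
  -- Multiplication in reversed order; otherwise the argument is that of `compatible_of_mul`, with
  -- `S⁻¹` in place of `S` in the final cancellation.
  let μ : (R ⧸ K) ⊗[ℂ] (R ⧸ K) →ₗ[ℂ] R ⧸ K :=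
    LinearMap.mul' ℂ _ ∘ₗ (TensorProduct.comm ℂ (R ⧸ K) (R ⧸ K)).toLinearMap
  have hzero : ∀ p, μ (TensorProduct.map (q.comp o).toLinearMap ε (δ p)) = 0 := by
    intro p
    obtain ⟨x, y, hx, hy, hxy⟩ := hω p
    have e : q x = q y := Ideal.Quotient.eq.2 hxy
    rw [hε, map_sub_right, sub_eq_zero]
    convert e using 1
    · rw [← hq₁, hx]
      generalize δ p = t
      induction t with
      | zero => simp
      | tmul x y => simp [hq₁, μ]
      | add s t hs ht => simp only [map_add, hs, ht]
    · rw [← hq₂, hy]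
      generalize δ p = t
      induction t with
      | zero => simp
      | tmul x y => simp [hq₂, μ]
      | add s t hs ht => simp only [map_add, hs, ht]
  have hconv : convOp (q₁.comp j).toLinearMap ε = 0 := by
    ext h
    obtain ⟨p, hp⟩ := hj h
    rw [LinearMap.zero_apply, ← hzero p]
    calc convOp (q₁.comp j).toLinearMap ε h
        = μ (TensorProduct.map q₁.toLinearMap ε
            (LinearMap.rTensor H j.toLinearMap (Coalgebra.comul (R := ℂ) h))) := by
          rw [← LinearMap.comp_apply (TensorProduct.map _ _), LinearMap.map_comp_rTensor]
          rfl
      _ = _ := by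
          rw [← hp, ← LinearMap.comp_apply (TensorProduct.map _ _), LinearMap.map_comp_rTensor]
          congr 3
          ext x
          exact hq₁ (o x)
  have hε0 : ε = 0 := convOp_left_injective hS _ (hconv.trans (convOp_zero _).symm)
  obtain ⟨x, hx⟩ := h₁ (ω₁ h)
  obtain ⟨y, hy⟩ := h₂ (ω₂ h)
  refine ⟨x, y, hx, hy, Ideal.Quotient.eq.1 ?_⟩
  change q x = q y
  rw [← hq₁, ← hq₂, hx, hy, ← sub_eq_zero]
  exact LinearMap.congr_fun hε0 h

end Glueing

lemma decompose_map {V W : Type*} [AddCommGroup V] [Module ℂ V] [AddCommGroup W] [Module ℂ W]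
    (𝒱 : ℕ → Submodule ℂ V) (𝒲 : ℕ → Submodule ℂ W) [DirectSum.Decomposition 𝒱]
    [DirectSum.Decomposition 𝒲] (f : V →ₗ[ℂ] W) (hf : ∀ n x, x ∈ 𝒱 n → f x ∈ 𝒲 n) (n : ℕ) (x : V) :
    f (DirectSum.decompose 𝒱 x n) = DirectSum.decompose 𝒲 (f x) n := by
  induction x using DirectSum.Decomposition.inductionOn 𝒱 with
  | zero => simp
  | add x y hx hy => simp [DirectSum.decompose_add, hx, hy]
  | @homogeneous m x =>
    by_cases h : m = n
    · subst h
      rw [DirectSum.decompose_of_mem_same _ x.2, DirectSum.decompose_of_mem_same _ (hf _ _ x.2)]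
    · rw [DirectSum.decompose_of_mem_ne _ x.2 h, DirectSum.decompose_of_mem_ne _ (hf _ _ x.2) h,
        map_zero]

/-! ### Lifting local elements to global forms -/

namespace DifferentialStructure

variable {I P B H : Type*} [Ring P] [Algebra ℂ P] [Ring B] [Algebra ℂ B] [Ring H] [HopfAlgebra ℂ H]
variable {E : LocallyTrivialBundle I P B H} (S : DifferentialStructure E)

/-- The inclusion `Γ(B_i) → Γ(B_i) ⊗̂ Γ(H)`. -/
abbrev inlAt (i : I) : (S.ΓB i).carrier →ₐ[ℂ] S.Loc i := inl (S.ΓB i) S.ΓH.toDifferentialCalculus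

/-- The inclusion `H → Γ(B_i) ⊗̂ Γ(H)`. -/
abbrev fibAt (i : I) : H →ₐ[ℂ] S.Loc i := fib (S.ΓB i) S.ΓH.toDifferentialCalculus

lemma skewOf_one_tmul (i : I) (h : H) :
    skewOf (S.ΓB i) S.ΓH.toDifferentialCalculus (1 ⊗ₜ h) = S.fibAt i h := by
  simp [skewOf, fib_eq, skewTmul]

lemma skewOf_tmul_one (i : I) (b : B ⧸ E.J i) :
    skewOf (S.ΓB i) S.ΓH.toDifferentialCalculus (b ⊗ₜ 1) = S.inlAt i ((S.ΓB i).of b) := by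
  simp [skewOf, inl_eq, skewTmul]

lemma πΓ_surjective (i : I) : Function.Surjective (S.πΓ i) := by
  rw [← AlgHom.range_eq_top, ← top_le_iff, ← (S.ΓB i).generated, Algebra.adjoin_le_iff]
  rintro _ (⟨b, rfl⟩ | ⟨b, rfl⟩)
  · obtain ⟨b, rfl⟩ := Ideal.Quotient.mk_surjective b
    exact ⟨S.ΓBase.of b, S.πΓ_of i b⟩
  · obtain ⟨b, rfl⟩ := Ideal.Quotient.mk_surjective b
    refine ⟨S.ΓBase.d (S.ΓBase.of b), ?_⟩
    change S.πΓ i _ = _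
    rw [S.πΓ_d, S.πΓ_of]

/-- The range is a subalgebra closed under the differential and contains `B_i ⊗ H`. It therefore
contains the generators of both tensor factors, hence all products of the two. -/
lemma χΓ_surjective (i : I) : Function.Surjective (S.χΓ i) := by
  rw [← AlgHom.range_eq_top]
  have hof : ∀ t, skewOf (S.ΓB i) S.ΓH.toDifferentialCalculus t ∈ (S.χΓ i).range := fun t => by
    obtain ⟨x, rfl⟩ := E.χ_surjective i t
    exact ⟨S.ΓP.of x, S.χΓ_of i x⟩
  have hd : ∀ x ∈ (S.χΓ i).range, skewD (S.ΓB i) S.ΓH.toDifferentialCalculus x ∈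
      (S.χΓ i).range := by
    rintro _ ⟨x, rfl⟩
    exact ⟨S.ΓP.d x, S.χΓ_d i x⟩
  have hl : (⊤ : Subalgebra ℂ (S.ΓB i).carrier) ≤ (S.χΓ i).range.comap (S.inlAt i) := by
    rw [← (S.ΓB i).generated, Algebra.adjoin_le_iff]
    have h0 : ∀ b, S.inlAt i ((S.ΓB i).of b) ∈ (S.χΓ i).range := fun b => by
      rw [← skewOf_tmul_one]; exact hof _
    rintro _ (⟨b, rfl⟩ | ⟨b, rfl⟩)
    · exact h0 b
    · have := hd _ (h0 b)
      rwa [skewD_inl] at this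
  have hr : (⊤ : Subalgebra ℂ S.ΓH.carrier) ≤
      (S.χΓ i).range.comap (inr (S.ΓB i) S.ΓH.toDifferentialCalculus) := by
    rw [← S.ΓH.generated, Algebra.adjoin_le_iff]
    have h0 : ∀ h, inr (S.ΓB i) S.ΓH.toDifferentialCalculus (S.ΓH.of h) ∈ (S.χΓ i).range :=
      fun h => by
        have := hof (1 ⊗ₜ h)
        rwa [skewOf_one_tmul] at this
    rintro _ (⟨b, rfl⟩ | ⟨b, rfl⟩)
    · exact h0 b
    · have := hd _ (h0 b)
      rwa [skewD_inr] at this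
  rw [eq_top_iff]
  intro x _
  induction x using skew_hom_induction with
  | zero => exact zero_mem _
  | add x y hx hy => exact add_mem (hx trivial) (hy trivial)
  | tmul _ _ a b _ _ =>
    rw [← inl_mul_inr]
    exact mul_mem (hl (Algebra.mem_top (x := a))) (hr (Algebra.mem_top (x := b)))

/-- The local images of one form in `Γ(B)` are automatically compatible. Since `πΓ i` preserves
degrees, the degree `n` component of any preimage of `a` still maps to `a`. -/
lemma exists_base_form (i : I) {n : ℕ} {a : (S.ΓB i).carrier} (ha : a ∈ (S.ΓB i).gr n) :
    ∃ ρ : S.gammaCBase, ρ.1 ∈ S.gradeBase n ∧ ρ.1 i = a := by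
  obtain ⟨x, hx⟩ := S.πΓ_surjective i a
  refine ⟨⟨fun j => S.πΓ j (DirectSum.decompose S.ΓBase.gr x n), ?_⟩, fun j _ => ?_, ?_⟩
  · exact (mem_coveringCompletion _ _).2 fun j k => ⟨_, rfl, rfl⟩
  · exact S.πΓ_mem j n _ (Subtype.prop _)
  · refine (decompose_map S.ΓBase.gr (S.ΓB i).gr (S.πΓ i).toLinearMap (S.πΓ_mem i) n x).trans ?_
    rw [AlgHom.toLinearMap_apply, hx, DirectSum.decompose_of_mem_same _ ha]

/-- The embedding of `P` into `hor Γ_c(P)`. -/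
def ofTotal : P →ₗ[ℂ] S.hor where
  toFun p := ⟨fun i => S.χΓ i (S.ΓP.of p), (mem_coveringCompletion _ _).2 fun _ _ => ⟨_, rfl, rfl⟩,
    fun i _ => by
      change S.χΓ i (S.ΓP.of p) ∈ horLoc _ _
      rw [S.χΓ_of]
      exact skewOf_mem_horLoc _⟩
  map_add' p q := Subtype.ext (funext fun i => by
    change S.χΓ i (S.ΓP.of (p + q)) = S.χΓ i (S.ΓP.of p) + S.χΓ i (S.ΓP.of q)
    rw [map_add, map_add])
  map_smul' r p := Subtype.ext (funext fun i => by
    change S.χΓ i (S.ΓP.of (r • p)) = r • S.χΓ i (S.ΓP.of p)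
    rw [map_smul, map_smul])

lemma ofTotal_apply (p : P) (i : I) : (S.ofTotal p).1 i = S.χΓ i (S.ΓP.of p) := rfl

lemma ofTotal_mem_gradeTot (p : P) : (S.ofTotal p).1 ∈ S.gradeTot 0 := fun i _ => by
  rw [ofTotal_apply, S.χΓ_of]
  exact skewOf_mem_skewGr _

/-- Horizontal lifts of the elements `1 ⊗ h` of a local algebra. -/
lemma exists_fib_lift (i : I) : ∃ σ : H →ₗ[ℂ] P, ∀ h, (S.ofTotal (σ h)).1 i = S.fibAt i h := by
  -- A linear section over the field `ℂ` makes the lift linear in `h`, so it can be tensored with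
  -- `H` later.
  obtain ⟨s, hs⟩ := (E.χ i).toLinearMap.exists_rightInverse_of_surjective
    (LinearMap.range_eq_top.2 (E.χ_surjective i))
  refine ⟨s ∘ₗ TensorProduct.mk ℂ (B ⧸ E.J i) H 1, fun h => ?_⟩
  rw [ofTotal_apply, S.χΓ_of, ← skewOf_one_tmul]
  exact congrArg _ (LinearMap.congr_fun hs (1 ⊗ₜ h))

/-- The `i`-th component of a horizontal form. -/
abbrev evalHor (i : I) : S.hor →ₗ[ℂ] S.Loc i := LinearMap.proj i ∘ₗ S.hor.val.toLinearMap

/-- The `i`-th component of an element of `Γ_c(P)`. -/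
abbrev evalC (i : I) : S.gammaC →ₗ[ℂ] S.Loc i := LinearMap.proj i ∘ₗ S.gammaC.val.toLinearMap

lemma mem_horLoc_of_hor (γ : S.hor) (i : I) :
    γ.1 i ∈ horLoc (S.ΓB i) S.ΓH.toDifferentialCalculus := γ.2.2 i trivial

/-- The form `γ ↦ (-1)^n γ` for `γ` of degree `n`. -/
def parityHor : S.hor →ₗ[ℂ] S.hor where
  toFun γ := ⟨fun i => parityLoc (S.ΓB i) S.ΓH.toDifferentialCalculus (γ.1 i), by
    refine ⟨(mem_coveringCompletion _ _).2 fun i j => ?_, fun i _ =>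
      parityLoc_mem_horLoc (S.mem_horLoc_of_hor γ i)⟩
    obtain ⟨x, hi, hj⟩ := (mem_coveringCompletion _ _).1 γ.2.1 i j
    -- The maps `χΓ k` preserve degrees and so commute with the sign operator; hence a common
    -- preimage of two components is carried to one of their sign changes.
    have key : ∀ k, S.χΓ k (S.ΓP.parity x) =
        parityLoc (S.ΓB k) S.ΓH.toDifferentialCalculus (S.χΓ k x) := by
      intro k
      clear hi hj
      induction x using DirectSum.Decomposition.inductionOn S.ΓP.gr with
      | zero => simp
      | add x y hx hy => simp only [map_add, hx, hy]
      | @homogeneous n x =>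
        rw [S.ΓP.parity_of_mem x.2, map_smul, parityLoc_of_mem (S.χΓ_mem k n _ x.2)]
    exact ⟨S.ΓP.parity x, by rw [key, hi], by rw [key, hj]⟩⟩
  map_add' γ γ' := Subtype.ext (funext fun i => map_add _ (γ.1 i) (γ'.1 i))
  map_smul' r γ := Subtype.ext (funext fun i => map_smul _ r (γ.1 i))

lemma parityHor_apply (γ : S.hor) (i : I) : (S.parityHor γ).1 i =
    parityLoc (S.ΓB i) S.ΓH.toDifferentialCalculus (γ.1 i) := rfl

lemma parityHor_of_mem {n : ℕ} {γ : S.hor} (hγ : γ.1 ∈ S.gradeTot n) :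
    S.parityHor γ = (-1 : ℂ) ^ n • γ :=
  Subtype.ext (funext fun i => parityLoc_of_mem (hγ i trivial))

lemma coactLoc_χΓ_of (i : I) (p : P) :
    coactLoc (S.ΓB i) S.ΓH (S.χΓ i (S.ΓP.of p)) =
      LinearMap.rTensor H ((S.χΓ i).comp S.ΓP.of).toLinearMap (E.coact p) := by
  rw [S.χΓ_of, coactLoc_skewOf, ← E.χ_coact, LinearEquiv.symm_apply_apply,
    ← LinearMap.comp_apply, ← LinearMap.rTensor_comp]
  congr 2
  ext y
  simp [S.χΓ_of]

/-! ### Glueing local forms -/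

section Glueing

variable {S}

lemma exists_coact_eq_comul (i : I) (h : H) : ∃ p,
    LinearMap.rTensor H ((S.χΓ i).comp S.ΓP.of).toLinearMap (E.coact p) =
      LinearMap.rTensor H (S.fibAt i).toLinearMap (Coalgebra.comul (R := ℂ) h) := by
  obtain ⟨σ, hσ⟩ := S.exists_fib_lift i
  exact ⟨σ h, by rw [← coactLoc_χΓ_of, ← ofTotal_apply, hσ, coactLoc_fib]⟩

lemma convLoc_χΓ_of (i : I) (ω : H →ₗ[ℂ] S.Loc i) (p : P) :
    convLoc ω (S.χΓ i (S.ΓP.of p)) = LinearMap.mul' ℂ _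
      (TensorProduct.map ((S.χΓ i).comp S.ΓP.of).toLinearMap ω (E.coact p)) := by
  simp only [convLoc, LinearMap.comp_apply, coactLoc_χΓ_of]
  rw [← LinearMap.comp_apply (LinearMap.lTensor _ ω), LinearMap.lTensor_comp_rTensor]

lemma convOpLoc_χΓ_of (i : I) (ω : H →ₗ[ℂ] S.Loc i) (p : P) :
    convOpLoc ω (S.χΓ i (S.ΓP.of p)) = LinearMap.mul' ℂ _ (TensorProduct.comm ℂ _ _
      (TensorProduct.map ((S.χΓ i).comp S.ΓP.of).toLinearMap ω (E.coact p))) := by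
  simp only [convOpLoc, LinearMap.comp_apply, coactLoc_χΓ_of]
  rw [← LinearMap.comp_apply (LinearMap.lTensor _ ω), LinearMap.lTensor_comp_rTensor]
  rfl

/-- Local forms are compatible if their convolutions with the elements of `P` are. -/
lemma mem_gammaC_of_convLoc {ω : ∀ i, H →ₗ[ℂ] S.Loc i}
    (hω : ∀ p : P, (fun i => convLoc (ω i) (S.χΓ i (S.ΓP.of p)) : S.Tot) ∈ S.gammaC) (h : H) :
    (fun i => ω i h : S.Tot) ∈ S.gammaC := by
  intro i j
  refine compatible_of_mul (δ := E.coact.toLinearMap) (S.χΓ_surjective i) (S.χΓ_surjective j)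
    (S.fibAt i) (exists_coact_eq_comul i) (fun p => ?_) h
  obtain ⟨x, y, hx, hy, hxy⟩ := hω p i j
  exact ⟨x, y, hx.trans (convLoc_χΓ_of i _ p), hy.trans (convLoc_χΓ_of j _ p), hxy⟩

lemma mem_gammaC_of_convOpLoc (hS : Function.Bijective (HopfAlgebra.antipode ℂ : H →ₗ[ℂ] H))
    {ω : ∀ i, H →ₗ[ℂ] S.Loc i}
    (hω : ∀ p : P, (fun i => convOpLoc (ω i) (S.χΓ i (S.ΓP.of p)) : S.Tot) ∈ S.gammaC) (h : H) :
    (fun i => ω i h : S.Tot) ∈ S.gammaC := by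
  intro i j
  refine compatible_of_mul_op hS (δ := E.coact.toLinearMap) (S.χΓ_surjective i)
    (S.χΓ_surjective j) (S.fibAt i) (exists_coact_eq_comul i) (fun p => ?_) h
  obtain ⟨x, y, hx, hy, hxy⟩ := hω p i j
  exact ⟨x, y, hx.trans (convOpLoc_χΓ_of i _ p), hy.trans (convOpLoc_χΓ_of j _ p), hxy⟩

end Glueing

variable {S}

lemma gammaC_tensor_ext {s t : S.gammaC ⊗[ℂ] H}
    (h : ∀ i, LinearMap.rTensor H (S.evalC i) s = LinearMap.rTensor H (S.evalC i) t) : s = t :=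
  eq_of_rTensor_eq (f := S.evalC) (fun _ hv => Subtype.ext (funext hv)) h

lemma hor_tensor_ext {s t : S.hor ⊗[ℂ] H}
    (h : ∀ i, LinearMap.rTensor H (S.evalHor i) s = LinearMap.rTensor H (S.evalHor i) t) : s = t :=
  eq_of_rTensor_eq (f := S.evalHor) (fun _ hv => Subtype.ext (funext hv)) h

lemma dTot_apply (x : S.Tot) (i : I) :
    S.dTot x i = skewD (S.ΓB i) S.ΓH.toDifferentialCalculus (x i) := rfl

lemma vertC_evalC {ω : H →ₗ[ℂ] S.gammaC} {v : H →ₗ[ℂ] S.ΓH.carrier} {i : I}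
    (hω : ∀ h, (ω h).1 i - horC _ _ ((ω h).1 i) =
      -skewTmul (S.ΓB i) S.ΓH.toDifferentialCalculus 1 (v h)) (h : H) :
    vertC (S.ΓB i) S.ΓH.toDifferentialCalculus ((S.evalC i ∘ₗ ω) h) =
      -inr (S.ΓB i) S.ΓH.toDifferentialCalculus (v h) := hω h

lemma eq_of_evalC_comp_eq {ω ω' : H →ₗ[ℂ] S.gammaC}
    (h : ∀ i, S.evalC i ∘ₗ ω = S.evalC i ∘ₗ ω') : ω = ω' :=
  LinearMap.ext fun x => Subtype.ext (funext fun i => LinearMap.congr_fun (h i) x)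

variable [Fintype I] [DecidableEq I]

/-! ### Convolution with a global form -/

lemma convL_apply (ω : H →ₗ[ℂ] S.gammaC) (γ : S.hor) (i : I) :
    S.convL ω γ i = convLoc (S.evalC i ∘ₗ ω) (γ.1 i) := by
  simp only [convLoc, convL, LinearMap.comp_apply, ← S.coactHor_spec]
  generalize S.coactHor γ = t
  induction t with
  | zero => simp
  | tmul x y => simp
  | add s t hs ht => simp only [map_add, Pi.add_apply, hs, ht]

lemma convR_apply (ω : H →ₗ[ℂ] S.gammaC) (γ : S.hor) (i : I) :
    S.convR ω γ i = convOpLoc (S.evalC i ∘ₗ ω) (γ.1 i) := by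
  simp only [convOpLoc, convR, LinearMap.comp_apply, ← S.coactHor_spec]
  generalize S.coactHor γ = t
  induction t with
  | zero => simp
  | tmul x y => simp
  | add s t hs ht => simp only [map_add, Pi.add_apply, hs, ht]

lemma convL_mem_gammaC (ω : H →ₗ[ℂ] S.gammaC) (γ : S.hor) : S.convL ω γ ∈ S.gammaC := by
  simp only [convL, LinearMap.comp_apply]
  generalize S.coactHor γ = t
  induction t with
  | zero => simp
  | tmul x y => exact mul_mem x.2.1 (ω y).2
  | add s t hs ht => simp only [map_add]; exact add_mem hs ht

lemma convR_mem_gammaC (ω : H →ₗ[ℂ] S.gammaC) (γ : S.hor) : S.convR ω γ ∈ S.gammaC := by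
  simp only [convR, LinearMap.comp_apply]
  generalize S.coactHor γ = t
  induction t with
  | zero => simp
  | tmul x y => exact mul_mem (ω y).2 x.2.1
  | add s t hs ht => simp only [map_add]; exact add_mem hs ht

/-! ### From pre-connection forms to covariant derivatives -/

/-- An operator acting component by component preserves the kernels automatically, and the other
conditions can be checked in each local algebra. -/
lemma isCovariantOperator_of_local {D : S.hor →ₗ[ℂ] S.hor} (T : ∀ i, S.Loc i →ₗ[ℂ] S.Loc i)
    (hD : ∀ γ i, (D γ).1 i = T i (γ.1 i))
    (hdeg : ∀ i n x, x ∈ skewGr (S.ΓB i) S.ΓH.toDifferentialCalculus n →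
      T i x ∈ skewGr (S.ΓB i) S.ΓH.toDifferentialCalculus (n + 1))
    (hone : ∀ i, T i 1 = 0)
    (hcov : ∀ i x, x ∈ horLoc (S.ΓB i) S.ΓH.toDifferentialCalculus →
      coactLoc (S.ΓB i) S.ΓH (T i x) = LinearMap.rTensor H (T i) (coactLoc (S.ΓB i) S.ΓH x)) :
    S.IsCovariantOperator D where
  degree n γ hγ i _ := by
    rw [hD]
    exact hdeg i n _ (hγ i trivial)
  map_one := Subtype.ext (funext fun i => (hD 1 i).trans (hone i))
  map_ker i γ h := by rw [hD, h, map_zero]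
  covariant γ := hor_tensor_ext fun i => by
    have e : S.evalHor i ∘ₗ D = T i ∘ₗ S.evalHor i := LinearMap.ext fun γ => hD γ i
    rw [S.coactHor_spec, hD, hcov i _ (S.mem_horLoc_of_hor γ i), ← LinearMap.comp_apply,
      ← LinearMap.rTensor_comp, e, LinearMap.rTensor_comp, LinearMap.comp_apply, S.coactHor_spec]

lemma coactLoc_evalC {ω : H →ₗ[ℂ] S.gammaC} {ad : H →ₗ[ℂ] H ⊗[ℂ] H}
    (hω : ∀ h, S.coactC (ω h) = LinearMap.rTensor H ω (ad h)) (i : I) (h : H) :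
    coactLoc (S.ΓB i) S.ΓH ((S.evalC i ∘ₗ ω) h) =
      LinearMap.rTensor H (S.evalC i ∘ₗ ω) (ad h) := by
  rw [LinearMap.rTensor_comp_apply, ← hω, S.coactC_spec]
  rfl

/-- The left covariant derivative of a left pre-connection form. -/
lemma exists_leftCovariantDerivative {ω : H →ₗ[ℂ] S.gammaC} (hω : S.IsLeftPreConnectionForm ω) :
    ∃ D : S.hor →ₗ[ℂ] S.hor, S.IsLeftCovariantDerivative D ∧
      ∀ γ, (D γ).1 = S.dTot γ.1 + S.convL ω (S.parityHor γ) := by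
  let T : ∀ i, S.Loc i →ₗ[ℂ] S.Loc i := fun i =>
    skewD (S.ΓB i) S.ΓH.toDifferentialCalculus +
      convLoc (S.evalC i ∘ₗ ω) ∘ₗ parityLoc (S.ΓB i) S.ΓH.toDifferentialCalculus
  have hT : ∀ (γ : S.hor) i, (S.dTot γ.1 + S.convL ω (S.parityHor γ)) i = T i (γ.1 i) :=
    fun γ i => by rw [Pi.add_apply, convL_apply, dTot_apply, parityHor_apply]; rfl
  let D : S.hor →ₗ[ℂ] S.hor :=
    { toFun := fun γ => ⟨S.dTot γ.1 + S.convL ω (S.parityHor γ),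
        add_mem (S.dTot_mem γ.2.1) (convL_mem_gammaC ω _), fun i _ => by
          rw [hT]
          exact skewD_add_convLoc_mem_horLoc (vertC_evalC (hω.vertical i))
            (S.mem_horLoc_of_hor γ i)⟩
      map_add' := fun γ γ' => Subtype.ext (funext fun i => by
        refine (hT (γ + γ') i).trans ((map_add (T i) (γ.1 i) (γ'.1 i)).trans ?_)
        exact congrArg₂ (· + ·) (hT γ i).symm (hT γ' i).symm)
      map_smul' := fun r γ => Subtype.ext (funext fun i => by
        refine (hT (r • γ) i).trans ((map_smul (T i) r (γ.1 i)).trans ?_)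
        exact congrArg (r • ·) (hT γ i).symm) }
  have hD : ∀ γ i, (D γ).1 i = T i (γ.1 i) := hT
  refine ⟨D, ⟨isCovariantOperator_of_local T hD ?_ ?_ ?_, ?_⟩, fun _ => rfl⟩
  · intro i n x hx
    refine add_mem (skewD_mem hx) ?_
    refine convLoc_mem_skewGr (fun h => hω.degree h i trivial) ?_
    rw [parityLoc_of_mem hx]
    exact Submodule.smul_mem _ _ hx
  · intro i
    have h1 : parityLoc (S.ΓB i) S.ΓH.toDifferentialCalculus 1 = 1 := by
      have h := parityLoc_of_mem (fib_mem_skewGr (Γ := S.ΓB i)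
        (Λ := S.ΓH.toDifferentialCalculus) 1)
      rwa [map_one, pow_zero, one_smul] at h
    change skewD _ _ 1 + convLoc _ (parityLoc _ _ 1) = 0
    rw [h1, skewD_one, convLoc_one, add_zero]
    simp [hω.map_one]
  · intro i x hx
    change coactLoc _ _ (skewD _ _ x + convLoc _ (parityLoc _ _ x)) = _
    rw [map_add, coactLoc_skewD hx, coactLoc_convLoc (coactLoc_evalC hω.covariant i)
      (parityLoc_mem_horLoc hx), coactLoc_parityLoc hx, LinearMap.rTensor_add,
      LinearMap.rTensor_comp]
    rfl
  · intro n ρ α hρ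
    funext i
    rw [hD]
    change skewD _ _ (S.inlAt i (ρ.1 i) * α.1 i) +
      convLoc _ (parityLoc _ _ (S.inlAt i (ρ.1 i) * α.1 i)) =
      skewD _ _ (S.inlAt i (ρ.1 i)) * α.1 i + (-1 : ℂ) ^ n • (S.inlAt i (ρ.1 i) * (D α).1 i)
    rw [hD, skewD_mul (inl_mem_skewGr (hρ i trivial))]
    -- The sign operator produces the `(-1)^n` of the Leibniz rule in the convolution term, and `ρ`
    -- then factors out on the left.
    rw [parityLoc_inl_mul (hρ i trivial), map_smul, convLoc_inl_mul, add_assoc, ← smul_add, ← mul_add]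
    rfl

/-- The right covariant derivative of a right pre-connection form. -/
lemma exists_rightCovariantDerivative
    {hS : Function.Bijective (HopfAlgebra.antipode ℂ : H →ₗ[ℂ] H)}
    {ω : H →ₗ[ℂ] S.gammaC} (hω : S.IsRightPreConnectionForm hS ω) :
    ∃ D : S.hor →ₗ[ℂ] S.hor, S.IsRightCovariantDerivative D ∧
      ∀ γ, (D γ).1 = S.dTot γ.1 + S.convR ω γ := by
  let T : ∀ i, S.Loc i →ₗ[ℂ] S.Loc i := fun i =>
    skewD (S.ΓB i) S.ΓH.toDifferentialCalculus + convOpLoc (S.evalC i ∘ₗ ω)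
  have hT : ∀ (γ : S.hor) i, (S.dTot γ.1 + S.convR ω γ) i = T i (γ.1 i) :=
    fun γ i => by rw [Pi.add_apply, convR_apply, dTot_apply]; rfl
  let D : S.hor →ₗ[ℂ] S.hor :=
    { toFun := fun γ => ⟨S.dTot γ.1 + S.convR ω γ,
        add_mem (S.dTot_mem γ.2.1) (convR_mem_gammaC ω _), fun i _ => by
          rw [hT]
          exact skewD_add_convOpLoc_mem_horLoc (vertC_evalC (hω.vertical i))
            (S.mem_horLoc_of_hor γ i)⟩
      map_add' := fun γ γ' => Subtype.ext (funext fun i => by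
        refine (hT (γ + γ') i).trans ((map_add (T i) (γ.1 i) (γ'.1 i)).trans ?_)
        exact congrArg₂ (· + ·) (hT γ i).symm (hT γ' i).symm)
      map_smul' := fun r γ => Subtype.ext (funext fun i => by
        refine (hT (r • γ) i).trans ((map_smul (T i) r (γ.1 i)).trans ?_)
        exact congrArg (r • ·) (hT γ i).symm) }
  have hD : ∀ γ i, (D γ).1 i = T i (γ.1 i) := hT
  refine ⟨D, ⟨isCovariantOperator_of_local T hD ?_ ?_ ?_, ?_⟩, fun _ => rfl⟩
  · intro i n x hx
    exact add_mem (skewD_mem hx) (convOpLoc_mem_skewGr (fun h => hω.degree h i trivial) hx)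
  · intro i
    change skewD _ _ 1 + convOpLoc _ 1 = 0
    rw [skewD_one, convOpLoc_one, add_zero]
    simp [hω.map_one]
  · intro i x hx
    change coactLoc _ _ (skewD _ _ x + convOpLoc _ x) = _
    rw [map_add, coactLoc_skewD hx, coactLoc_convOpLoc (coactLoc_evalC hω.covariant i) hx,
      LinearMap.rTensor_add]
    rfl
  · intro n ρ α hα
    funext i
    rw [hD]
    change skewD _ _ (α.1 i * S.inlAt i (ρ.1 i)) + convOpLoc _ (α.1 i * S.inlAt i (ρ.1 i)) =
      (D α).1 i * S.inlAt i (ρ.1 i) + (-1 : ℂ) ^ n • (α.1 i * skewD _ _ (S.inlAt i (ρ.1 i)))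
    -- The convolution term is right linear over forms on the base, so only the differential
    -- contributes a sign.
    rw [hD, skewD_mul (hα i trivial), convOpLoc_mul_inl]
    change _ = (skewD _ _ (α.1 i) + convOpLoc _ (α.1 i)) * _ + _
    rw [add_mul]
    abel

/-! ### From covariant derivatives to pre-connection forms -/

/-- The deviation of a covariant derivative from the differential on the elements `1 ⊗ h` of the
local algebras. -/
lemma exists_deviation {D : S.hor →ₗ[ℂ] S.hor} (hD : S.IsCovariantOperator D) (i : I) :
    ∃ (δ : H →ₗ[ℂ] S.Loc i) (σ : H →ₗ[ℂ] S.hor),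
      (∀ h, (σ h).1 ∈ S.gradeTot 0) ∧ (∀ h, (σ h).1 i = S.fibAt i h) ∧
      (∀ h, (D (σ h)).1 i = skewD (S.ΓB i) S.ΓH.toDifferentialCalculus (S.fibAt i h) + δ h) ∧
      (∀ h, δ h ∈ skewGr (S.ΓB i) S.ΓH.toDifferentialCalculus 1) ∧ δ 1 = 0 ∧
      coactLoc (S.ΓB i) S.ΓH ∘ₗ δ = LinearMap.rTensor H δ ∘ₗ Coalgebra.comul (R := ℂ) ∧
      vertC (S.ΓB i) S.ΓH.toDifferentialCalculus ∘ₗ δ = -fibD := by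
  obtain ⟨s, hs⟩ := S.exists_fib_lift i
  let σ : H →ₗ[ℂ] S.hor := S.ofTotal ∘ₗ s
  have hσ : ∀ h, (σ h).1 i = S.fibAt i h := hs
  have hσ0 : ∀ h, (σ h).1 ∈ S.gradeTot 0 := fun h => S.ofTotal_mem_gradeTot _
  let dfib : H →ₗ[ℂ] S.Loc i :=
    skewD (S.ΓB i) S.ΓH.toDifferentialCalculus ∘ₗ (S.fibAt i).toLinearMap
  let Dσ : H →ₗ[ℂ] S.Loc i := S.evalHor i ∘ₗ D ∘ₗ σ
  have hdfib : ∀ h, dfib h = fibD h := fun h => skewD_inr (S.ΓH.of h)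
  refine ⟨Dσ - dfib, σ, hσ0, hσ, fun h => ?_, fun h => ?_, ?_, ?_, ?_⟩
  · rw [LinearMap.sub_apply]
    exact (add_sub_cancel (dfib h) (Dσ h)).symm
  · exact sub_mem (hD.degree 0 _ (hσ0 h) i trivial) (skewD_mem (fib_mem_skewGr h))
  · have h1 : Dσ 1 = 0 := by
      -- The lift `σ 1` need not be `1` globally; the two agree in component `i`, which is enough
      -- for `D`.
      have h := hD.map_ker i (σ 1 - 1) (by
        change (σ 1).1 i - 1 = 0
        rw [hσ, map_one, sub_self])
      rw [map_sub, hD.map_one, sub_zero] at h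
      exact h
    have h2 : dfib 1 = 0 := by
      change skewD _ _ (S.fibAt i 1) = 0
      rw [map_one, skewD_one]
    rw [LinearMap.sub_apply, h1, h2, sub_zero]
  · ext h
    have e1 : coactLoc (S.ΓB i) S.ΓH (dfib h) =
        LinearMap.rTensor H dfib (Coalgebra.comul (R := ℂ) h) := by
      change coactLoc _ _ (skewD _ _ (S.fibAt i h)) = _
      rw [coactLoc_skewD (fib_mem_horLoc h), coactLoc_fib, LinearMap.rTensor_comp]
      rfl
    -- The lift is equivariant only after projection to component `i`. As `D` preserves the kernel
    -- of that projection, `rTensor_eq_of_ker_le` carries the identity through `D ⊗ id`.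
    have e2 : LinearMap.rTensor H (S.evalHor i) (S.coactHor (σ h)) =
        LinearMap.rTensor H (S.evalHor i)
          (LinearMap.rTensor H σ (Coalgebra.comul (R := ℂ) h)) := by
      rw [S.coactHor_spec, hσ, coactLoc_fib, ← LinearMap.rTensor_comp_apply]
      congr 2
      exact LinearMap.ext fun h => (hσ h).symm
    have e3 := rTensor_eq_of_ker_le (g := S.evalHor i ∘ₗ D) (hD.map_ker i) e2
    rw [LinearMap.rTensor_comp_apply, hD.covariant, S.coactHor_spec,
      ← LinearMap.rTensor_comp_apply, LinearMap.comp_assoc] at e3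
    simp only [LinearMap.comp_apply, LinearMap.sub_apply, map_sub, LinearMap.rTensor_sub, e1]
    exact congrArg (· - _) e3
  · ext h
    -- Values of `D` are horizontal, so the whole vertical part of the deviation comes from `-d(1 ⊗
    -- h)`.
    have h1 : vertC (S.ΓB i) S.ΓH.toDifferentialCalculus (Dσ h) = 0 :=
      vertC_eq_zero_iff.2 (S.mem_horLoc_of_hor (D (σ h)) i)
    have h2 : vertC (S.ΓB i) S.ΓH.toDifferentialCalculus (fibD h) = fibD h := vertC_inr_d h
    rw [LinearMap.comp_apply, LinearMap.sub_apply, map_sub, h1, hdfib, h2, zero_sub,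
      LinearMap.neg_apply]

lemma IsCovariantOperator.apply_eq_of_eq {D : S.hor →ₗ[ℂ] S.hor} (hD : S.IsCovariantOperator D)
    {i : I} {γ γ' : S.hor} (h : γ.1 i = γ'.1 i) : (D γ).1 i = (D γ').1 i := by
  have := hD.map_ker i (γ - γ') (sub_eq_zero.2 h)
  rw [map_sub] at this
  exact sub_eq_zero.1 this

/-- Locally `a ⊗ h` lifts to `ι(ρ)σ(h)` with `ρ` on the base. The left Leibniz rule evaluates `D`
there, and linearity covers all horizontal elements. -/
lemma IsLeftCovariantDerivative.apply_eq {D : S.hor →ₗ[ℂ] S.hor}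
    (hD : S.IsLeftCovariantDerivative D) {i : I} {δ : H →ₗ[ℂ] S.Loc i} {σ : H →ₗ[ℂ] S.hor}
    (hσ : ∀ h, (σ h).1 i = S.fibAt i h)
    (hδ : ∀ h, (D (σ h)).1 i =
      skewD (S.ΓB i) S.ΓH.toDifferentialCalculus (S.fibAt i h) + δ h)
    {ω : H →ₗ[ℂ] S.Loc i} (hω : conv (S.fibAt i).toLinearMap ω = δ) (γ : S.hor) :
    (D γ).1 i = skewD (S.ΓB i) S.ΓH.toDifferentialCalculus (γ.1 i) +
      convLoc ω (parityLoc (S.ΓB i) S.ΓH.toDifferentialCalculus (γ.1 i)) := by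
  -- Only component `i` of the form matters, so `γ` may be replaced by any convenient lift of that
  -- component.
  suffices h : ∀ x ∈ horLoc (S.ΓB i) S.ΓH.toDifferentialCalculus, ∃ γ' : S.hor, γ'.1 i = x ∧
      (D γ').1 i = skewD (S.ΓB i) S.ΓH.toDifferentialCalculus x +
        convLoc ω (parityLoc (S.ΓB i) S.ΓH.toDifferentialCalculus x) by
    obtain ⟨γ', h, h'⟩ := h _ (S.mem_horLoc_of_hor γ i)
    rw [hD.toIsCovariantOperator.apply_eq_of_eq h.symm, h']
  intro x hx
  induction hx using horLoc_induction with
  | zero => exact ⟨0, rfl, by simp⟩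
  | add x y _ _ hx hy =>
    obtain ⟨γ, rfl, h⟩ := hx
    obtain ⟨γ', rfl, h'⟩ := hy
    refine ⟨γ + γ', rfl, ?_⟩
    rw [map_add]
    change (D γ).1 i + (D γ').1 i = _
    rw [h, h']
    simp only [map_add]
    abel
  | mul n a h ha _ =>
    obtain ⟨ρ, hρ, rfl⟩ := S.exists_base_form i ha
    refine ⟨S.iotaC ρ * σ h, congrArg (S.inlAt i (ρ.1 i) * ·) (hσ h), ?_⟩
    rw [hD.leibniz n ρ (σ h) hρ]
    change skewD _ _ (S.inlAt i (ρ.1 i)) * (σ h).1 i +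
      (-1 : ℂ) ^ n • (S.inlAt i (ρ.1 i) * (D (σ h)).1 i) = _
    rw [hσ, hδ, parityLoc_inl_mul_fib, (S.ΓB i).parity_of_mem ha, map_smul, smul_mul_assoc,
      map_smul, convLoc_inl_mul_fib, hω, skewD_mul (inl_mem_skewGr ha), add_assoc, ← smul_add,
      ← mul_add]

lemma IsRightCovariantDerivative.apply_eq {D : S.hor →ₗ[ℂ] S.hor}
    (hD : S.IsRightCovariantDerivative D) {i : I} {δ : H →ₗ[ℂ] S.Loc i} {σ : H →ₗ[ℂ] S.hor}
    (hσ0 : ∀ h, (σ h).1 ∈ S.gradeTot 0) (hσ : ∀ h, (σ h).1 i = S.fibAt i h)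
    (hδ : ∀ h, (D (σ h)).1 i =
      skewD (S.ΓB i) S.ΓH.toDifferentialCalculus (S.fibAt i h) + δ h)
    {ω : H →ₗ[ℂ] S.Loc i} (hω : convOp (S.fibAt i).toLinearMap ω = δ) (γ : S.hor) :
    (D γ).1 i = skewD (S.ΓB i) S.ΓH.toDifferentialCalculus (γ.1 i) + convOpLoc ω (γ.1 i) := by
  suffices h : ∀ x ∈ horLoc (S.ΓB i) S.ΓH.toDifferentialCalculus, ∃ γ' : S.hor, γ'.1 i = x ∧
      (D γ').1 i = skewD (S.ΓB i) S.ΓH.toDifferentialCalculus x + convOpLoc ω x by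
    obtain ⟨γ', h, h'⟩ := h _ (S.mem_horLoc_of_hor γ i)
    rw [hD.toIsCovariantOperator.apply_eq_of_eq h.symm, h']
  intro x hx
  induction hx using horLoc_induction with
  | zero => exact ⟨0, rfl, by simp⟩
  | add x y _ _ hx hy =>
    obtain ⟨γ, rfl, h⟩ := hx
    obtain ⟨γ', rfl, h'⟩ := hy
    refine ⟨γ + γ', rfl, ?_⟩
    rw [map_add]
    change (D γ).1 i + (D γ').1 i = _
    rw [h, h']
    simp only [map_add]
    abel
  | mul n a h ha _ =>
    obtain ⟨ρ, hρ, rfl⟩ := S.exists_base_form i ha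
    -- The lift has the base form on the right, as the right Leibniz rule demands; its sign is
    -- trivial because `σ h` has degree zero.
    refine ⟨σ h * S.iotaC ρ,
      (congrArg (· * S.inlAt i (ρ.1 i)) (hσ h)).trans (fib_mul_inl _ _), ?_⟩
    rw [hD.leibniz 0 ρ (σ h) (hσ0 h)]
    change (D (σ h)).1 i * S.inlAt i (ρ.1 i) +
      (-1 : ℂ) ^ 0 • ((σ h).1 i * skewD _ _ (S.inlAt i (ρ.1 i))) = _
    rw [hσ, hδ, convOpLoc_inl_mul_fib, hω, ← fib_mul_inl, skewD_mul (fib_mem_skewGr h), add_mul]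
    abel

/-- The left pre-connection form of a left covariant derivative. -/
lemma exists_leftPreConnectionForm {D : S.hor →ₗ[ℂ] S.hor} (hD : S.IsLeftCovariantDerivative D) :
    ∃ ω : H →ₗ[ℂ] S.gammaC, S.IsLeftPreConnectionForm ω ∧
      ∀ γ, (D γ).1 = S.dTot γ.1 + S.convL ω (S.parityHor γ) := by
  choose δ σ hσ0 hσ hδ hdeg hone hcov hvert using exists_deviation hD.toIsCovariantOperator
  -- The unique solution of `j * w = δ`, where `j h = 1 ⊗ h`.
  let w : ∀ i, H →ₗ[ℂ] S.Loc i := fun i =>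
    conv ((S.fibAt i).toLinearMap ∘ₗ HopfAlgebra.antipode ℂ) (δ i)
  have hw : ∀ i, conv (S.fibAt i).toLinearMap (w i) = δ i := fun i => conv_cancel_antipode _ _
  have hD' := fun i => hD.apply_eq (hσ i) (hδ i) (hw i)
  -- On `p ∈ P`, of degree zero, the convolution is `D(p) - dp` in every component, and this
  -- difference is a global element of `Γ_c(P)`.
  have hmem : ∀ h, (fun i => w i h : S.Tot) ∈ S.gammaC := mem_gammaC_of_convLoc fun p => by
    have h := sub_mem (D (S.ofTotal p)).2.1 (S.dTot_mem (S.ofTotal p).2.1)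
    convert h using 1
    funext i
    have h' := hD' i (S.ofTotal p)
    rw [parityLoc_of_mem (S.ofTotal_mem_gradeTot p i trivial), pow_zero, one_smul] at h'
    change _ = (D (S.ofTotal p)).1 i - skewD _ _ ((S.ofTotal p).1 i)
    rw [h', add_sub_cancel_left]
    rfl
  let ω : H →ₗ[ℂ] S.gammaC :=
    { toFun := fun h => ⟨fun i => w i h, hmem h⟩
      map_add' := fun x y => Subtype.ext (funext fun i => map_add (w i) x y)
      map_smul' := fun r x => Subtype.ext (funext fun i => map_smul (w i) r x) }
  have hω : ∀ i, S.evalC i ∘ₗ ω = w i := fun i => rfl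
  refine ⟨ω, ⟨fun h i _ => ?_, ?_, fun h => ?_, fun i h => ?_⟩, fun γ => funext fun i => ?_⟩
  · refine conv_mem _ (fun x y => ?_) h
    have := skewGr_mul (fib_mem_skewGr (Γ := S.ΓB i) (HopfAlgebra.antipode ℂ x)) (hdeg i y)
    rwa [zero_add] at this
  · refine Subtype.ext (funext fun i => ?_)
    change w i 1 = 0
    simp [w, conv, Algebra.TensorProduct.one_def, hone]
  · refine gammaC_tensor_ext fun i => ?_
    rw [S.coactC_spec, ← LinearMap.comp_apply, ← LinearMap.rTensor_comp, hω]
    refine LinearMap.congr_fun ((coactLoc_comp_eq_adL_iff (w i)).2 ?_) h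
    rw [hw, hcov]
  · refine LinearMap.congr_fun ((vertC_comp_eq_vertL_iff (w i)).2 ?_) h
    rw [hw, hvert]
  · rw [Pi.add_apply, convL_apply, hω, parityHor_apply, dTot_apply, hD']

/-- The right pre-connection form of a right covariant derivative. -/
lemma exists_rightPreConnectionForm
    (hS : Function.Bijective (HopfAlgebra.antipode ℂ : H →ₗ[ℂ] H))
    {D : S.hor →ₗ[ℂ] S.hor} (hD : S.IsRightCovariantDerivative D) :
    ∃ ω : H →ₗ[ℂ] S.gammaC, S.IsRightPreConnectionForm hS ω ∧
      ∀ γ, (D γ).1 = S.dTot γ.1 + S.convR ω γ := by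
  choose δ σ hσ0 hσ hδ hdeg hone hcov hvert using exists_deviation hD.toIsCovariantOperator
  let w : ∀ i, H →ₗ[ℂ] S.Loc i := fun i =>
    convOp ((S.fibAt i).toLinearMap ∘ₗ antipodeInv H hS) (δ i)
  have hw : ∀ i, convOp (S.fibAt i).toLinearMap (w i) = δ i :=
    fun i => convOp_cancel_antipodeInv hS _ _
  have hD' := fun i => hD.apply_eq (hσ0 i) (hσ i) (hδ i) (hw i)
  have hmem : ∀ h, (fun i => w i h : S.Tot) ∈ S.gammaC := mem_gammaC_of_convOpLoc hS fun p => by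
    have h := sub_mem (D (S.ofTotal p)).2.1 (S.dTot_mem (S.ofTotal p).2.1)
    convert h using 1
    funext i
    change _ = (D (S.ofTotal p)).1 i - skewD _ _ ((S.ofTotal p).1 i)
    rw [hD' i (S.ofTotal p), add_sub_cancel_left]
    rfl
  let ω : H →ₗ[ℂ] S.gammaC :=
    { toFun := fun h => ⟨fun i => w i h, hmem h⟩
      map_add' := fun x y => Subtype.ext (funext fun i => map_add (w i) x y)
      map_smul' := fun r x => Subtype.ext (funext fun i => map_smul (w i) r x) }
  have hω : ∀ i, S.evalC i ∘ₗ ω = w i := fun i => rfl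
  refine ⟨ω, ⟨fun h i _ => ?_, ?_, fun h => ?_, fun i h => ?_⟩, fun γ => funext fun i => ?_⟩
  · refine convOp_mem _ (fun x y => ?_) h
    have := skewGr_mul (hdeg i y) (fib_mem_skewGr (Γ := S.ΓB i) (antipodeInv H hS x))
    rwa [add_zero] at this
  · refine Subtype.ext (funext fun i => ?_)
    change w i 1 = 0
    simp [w, convOp, Algebra.TensorProduct.one_def, hone]
  · refine gammaC_tensor_ext fun i => ?_
    rw [S.coactC_spec, ← LinearMap.comp_apply, ← LinearMap.rTensor_comp, hω]
    refine LinearMap.congr_fun ((coactLoc_comp_eq_adR_iff hS (w i)).2 ?_) h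
    rw [hw, hcov]
  · refine LinearMap.congr_fun ((vertC_comp_eq_vertR_iff hS (w i)).2 ?_) h
    rw [hw, hvert]
  · rw [Pi.add_apply, convR_apply, hω, dTot_apply, hD']

/-! ### Uniqueness of the form -/

/-- Evaluated on a degree zero lift of `1 ⊗ h`, the hypothesis becomes an equality of convolutions
with `h ↦ 1 ⊗ h`, which can be cancelled. -/
lemma convL_injective {ω ω' : H →ₗ[ℂ] S.gammaC}
    (h : ∀ γ, S.convL ω (S.parityHor γ) = S.convL ω' (S.parityHor γ)) : ω = ω' := by
  refine eq_of_evalC_comp_eq fun i => conv_left_injective (S.fibAt i) (LinearMap.ext fun x => ?_)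
  obtain ⟨σ, hσ⟩ := S.exists_fib_lift i
  have := congrFun (h (S.ofTotal (σ x))) i
  rwa [S.parityHor_of_mem (S.ofTotal_mem_gradeTot _), pow_zero, one_smul, convL_apply, convL_apply,
    hσ, convLoc_fib, convLoc_fib] at this

lemma convR_injective (hS : Function.Bijective (HopfAlgebra.antipode ℂ : H →ₗ[ℂ] H))
    {ω ω' : H →ₗ[ℂ] S.gammaC} (h : ∀ γ, S.convR ω γ = S.convR ω' γ) : ω = ω' := by
  refine eq_of_evalC_comp_eq fun i =>
    convOp_left_injective hS (S.fibAt i) (LinearMap.ext fun x => ?_)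
  obtain ⟨σ, hσ⟩ := S.exists_fib_lift i
  have := congrFun (h (S.ofTotal (σ x))) i
  rwa [convR_apply, convR_apply, hσ, convOpLoc_fib, convOpLoc_fib] at this

end DifferentialStructure

/-- A relation which is total and single-valued in both directions is a bijection. -/
lemma exists_equiv_of_rel {X Y : Type*} (r : X → Y → Prop) (h₁ : ∀ x, ∃ y, r x y)
    (h₂ : ∀ y, ∃ x, r x y) (h₃ : ∀ x y y', r x y → r x y' → y = y')
    (h₄ : ∀ x x' y, r x y → r x' y → x = x') : ∃ Φ : X ≃ Y, ∀ x, r x (Φ x) := by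
  choose f hf using h₁
  choose g hg using h₂
  exact ⟨⟨f, g, fun x => h₄ _ _ _ (hg _) (hf x), fun y => h₃ _ _ _ (hf _) (hg y)⟩, hf⟩

end QPB
end
-- The two bijections
theorem proposition14 {I P B H : Type*} [Fintype I] [DecidableEq I]
    [Ring P] [Algebra ℂ P] [Ring B] [Algebra ℂ B] [Ring H] [HopfAlgebra ℂ H]
    (hS : Function.Bijective (HopfAlgebra.antipode ℂ : H →ₗ[ℂ] H))
    (E : QPB.LocallyTrivialBundle I P B H) (S : QPB.DifferentialStructure E) :
    (∃ Φ : {D : S.hor →ₗ[ℂ] S.hor // S.IsLeftCovariantDerivative D} ≃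
        {ω : H →ₗ[ℂ] S.gammaC // S.IsLeftPreConnectionForm ω},
      ∀ D (n : ℕ) (γ : S.hor), γ.1 ∈ S.gradeTot n →
        (D.1 γ).1 = S.dTot γ.1 + (-1 : ℂ) ^ n • S.convL (Φ D).1 γ) ∧
    (∃ Φ : {D : S.hor →ₗ[ℂ] S.hor // S.IsRightCovariantDerivative D} ≃
        {ω : H →ₗ[ℂ] S.gammaC // S.IsRightPreConnectionForm hS ω},
      ∀ D (γ : S.hor), (D.1 γ).1 = S.dTot γ.1 + S.convR (Φ D).1 γ) := by
  constructor
  · obtain ⟨Φ, hΦ⟩ := QPB.exists_equiv_of_rel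
      (X := {D : S.hor →ₗ[ℂ] S.hor // S.IsLeftCovariantDerivative D})
      (Y := {ω : H →ₗ[ℂ] S.gammaC // S.IsLeftPreConnectionForm ω})
      -- The sign `(-1)^n` is written as the linear operator `parityHor`, so the formula makes sense
      -- for every `γ` and determines `D` without splitting forms by degree.
      (fun D ω => ∀ γ, (D.1 γ).1 = S.dTot γ.1 + S.convL ω.1 (S.parityHor γ))
      (fun D => by
        obtain ⟨ω, hω, h⟩ := QPB.DifferentialStructure.exists_leftPreConnectionForm D.2
        exact ⟨⟨ω, hω⟩, h⟩)
      (fun ω => by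
        obtain ⟨D, hD, h⟩ := QPB.DifferentialStructure.exists_leftCovariantDerivative ω.2
        exact ⟨⟨D, hD⟩, h⟩)
      (fun D ω ω' h h' => Subtype.ext (QPB.DifferentialStructure.convL_injective fun γ =>
        add_left_cancel ((h γ).symm.trans (h' γ))))
      (fun D D' ω h h' => Subtype.ext (LinearMap.ext fun γ =>
        Subtype.ext ((h γ).trans (h' γ).symm)))
    refine ⟨Φ, fun D n γ hγ => ?_⟩
    rw [hΦ D γ, S.parityHor_of_mem hγ, map_smul]
  · exact QPB.exists_equiv_of_rel
      (X := {D : S.hor →ₗ[ℂ] S.hor // S.IsRightCovariantDerivative D})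
      (Y := {ω : H →ₗ[ℂ] S.gammaC // S.IsRightPreConnectionForm hS ω})
      (fun D ω => ∀ γ, (D.1 γ).1 = S.dTot γ.1 + S.convR ω.1 γ)
      (fun D => by
        obtain ⟨ω, hω, h⟩ := QPB.DifferentialStructure.exists_rightPreConnectionForm hS D.2
        exact ⟨⟨ω, hω⟩, h⟩)
      (fun ω => by
        obtain ⟨D, hD, h⟩ := QPB.DifferentialStructure.exists_rightCovariantDerivative ω.2
        exact ⟨⟨D, hD⟩, h⟩)
      (fun D ω ω' h h' => Subtype.ext (QPB.DifferentialStructure.convR_injective hS fun γ =>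
        add_left_cancel ((h γ).symm.trans (h' γ))))
      (fun D D' ω h h' => Subtype.ext (LinearMap.ext fun γ =>
        Subtype.ext ((h γ).trans (h' γ).symm)))
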